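/- Let $(M^{n},g,J)$ be a compact Kähler–Einstein manifold ($J$ an orthogonal almost complex structure with $\nabla J=0$, $\nabla$ the Levi-Civita connection) with $\mathrm{ric}=Eg$ and $E<0$. Let $\{e_i\}$ be local orthonormal frames, let vectors and $1$-forms be identified through $g$, and let $\langle\cdot,\cdot\rangle_{L^2}$ be the $L^2$ product of sections of $\mathrm{End}(TM)$. Conventions: $R(X,Y)=\nabla^2_{Y,X}-\nabla^2_{X,Y}$ and $\mathring{R}h=\sum_i R(e_i,\cdot)he_i$; $d_\nabla h(X,Y)=(\nabla_Xh)Y-(\nabla_Yh)X$ and $\delta=-\sum_i e_i\lrcorner\nabla_{e_i}$ on $TM$-valued forms; $\delta^{*}\xi$ is the symmetric part of $\nabla\xi$ and $\delta^{*,-}\xi=\tfrac12(\delta^*\xi+J(\delta^*\xi)J)$ its $J$-anti-invariant part; $\Delta_E=\nabla^*\nabla-2\mathring{R}$ and $\widetilde\Delta_E h=\Delta_E h-2\delta^{*}(\delta h+\tfrac12 d\,\mathrm{tr}\,h)$. For $h,h_1,h_2\in\Gamma(\mathrm{Sym}^2TM)$ and $\alpha\in\Omega^2(M,TM)$ put $(h\sharp\alpha)(X,Y)=\alpha(hX,Y)+\alpha(X,hY)$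 and $$2[h_1,h_2]^{FN}=-(h_1\sharp d_\nabla h_2+h_2\sharp d_\nabla h_1)+d_\nabla(h_1h_2+h_2h_1),$$ the Frölicher–Nijenhuis bracket. Let $\mathbf v(h_1,h_2)\in\Gamma(\mathrm{Sym}^2TM)$ be determined by $$\langle\mathbf v(h_1,h_2),h_3\rangle_{L^2}=\langle\delta[h_1,h_2]^{FN},h_3\rangle_{L^2}+\langle\delta[h_2,h_3]^{FN},h_1\rangle_{L^2}+\langle\delta[h_3,h_1]^{FN},h_2\rangle_{L^2}$$ for all $h_3\in\Gamma(\mathrm{Sym}^2TM)$. For $h\in\Gamma(\mathrm{Sym}^2TM)$ with $hJ=-Jh$ let $\bar\partial h=\tfrac12\left(d_\nabla h-d_\nabla h(J\cdot,J\cdot)\right)$, and let the Kodaira–Spencer bracket be $[h,h]^c(X,Y)=\tfrac12\left(\gamma(X,Y)+J\gamma(X,JY)\right)$, where $\gamma=\tfrac12\left([h,h]^{FN}-[h,h]^{FN}(J\cdot,J\cdot)\right)$. Let $h\in\Gamma(\mathrm{Sym}^2TM)$ be $J$-anti-invariant ($hJ=-Jh$) with $\bar\partial h=0$ and $\delta h=0$.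 Then $\mathbf v(h,h)$ exists, is unique, and satisfies $$E h^2-\mathbf v(h,h)+\tfrac12\widetilde\Delta_E h^2=-2\,\delta[h,h]^c-\tfrac12\,\delta^{*,-}d\,\mathrm{tr}(h^2).$$ In particular the $J$-invariant part $\tfrac12(A-JAJ)$ of the left-hand side $A$ vanishes. -/

import Mathlib

open scoped Manifold ContDiff Bundle ENNReal

noncomputable section

namespace KEDeform

variable {n : ℕ} {M : Type*} [TopologicalSpace M] [ChartedSpace (EuclideanSpace ℝ (Fin n)) M]

/-! ### Tensor fields

`M` is a smooth `n`-manifold modelled on Euclidean space.  Tensor fields with values in the tangent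
bundle are given by their values on tangent vectors; 1-forms are identified with vector fields
through the metric. -/

/-- Vector fields on `M`. -/
abbrev VecField (n : ℕ) (M : Type*) [TopologicalSpace M]
    [ChartedSpace (EuclideanSpace ℝ (Fin n)) M] :=
  (x : M) → TangentSpace (𝓡 n) x

/-- `TM`-valued tensors with one argument (endomorphisms of `TM`, or `TM`-valued 1-forms). -/
abbrev Tensor1 (n : ℕ) (M : Type*) [TopologicalSpace M]
    [ChartedSpace (EuclideanSpace ℝ (Fin n)) M] :=
  (x : M) → TangentSpace (𝓡 n) x → TangentSpace (𝓡 n) x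

/-- `TM`-valued tensors with two arguments. -/
abbrev Tensor2 (n : ℕ) (M : Type*) [TopologicalSpace M]
    [ChartedSpace (EuclideanSpace ℝ (Fin n)) M] :=
  (x : M) → TangentSpace (𝓡 n) x → TangentSpace (𝓡 n) x → TangentSpace (𝓡 n) x

/-- Sections of the bundle `End(TM)` (no regularity imposed). -/
abbrev EndField (n : ℕ) (M : Type*) [TopologicalSpace M]
    [ChartedSpace (EuclideanSpace ℝ (Fin n)) M] :=
  (x : M) → TangentSpace (𝓡 n) x →L[ℝ] TangentSpace (𝓡 n) x

instance finiteDimensional_tangentSpace (x : M) : FiniteDimensional ℝ (TangentSpace (𝓡 n) x) :=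
  inferInstanceAs (FiniteDimensional ℝ (EuclideanSpace ℝ (Fin n)))

/-- The underlying tensor of a section of `End(TM)`. -/
def EndField.tensor (h : EndField n M) : Tensor1 n M := fun x X => h x X

/-- Composition of endomorphism fields. -/
def comp (A B : Tensor1 n M) : Tensor1 n M := fun x X => A x (B x X)

section Smooth

variable [IsManifold (𝓡 n) ∞ M]

/-- `h` is a smooth section of `End(TM)`. -/
def IsSmooth (h : EndField n M) : Prop :=
  ContMDiff (𝓡 n)
    ((𝓡 n).prod 𝓘(ℝ, EuclideanSpace ℝ (Fin n) →L[ℝ] EuclideanSpace ℝ (Fin n))) ∞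
    (fun x => Bundle.TotalSpace.mk'
      (EuclideanSpace ℝ (Fin n) →L[ℝ] EuclideanSpace ℝ (Fin n))
      (E := fun x : M => TangentSpace (𝓡 n) x →L[ℝ] TangentSpace (𝓡 n) x) x (h x))

/-- An extension of a tangent vector at `x` to a vector field, smooth near `x`. -/
def ext {x : M} (X : TangentSpace (𝓡 n) x) : VecField n M :=
  FiberBundle.extend (EuclideanSpace ℝ (Fin n)) X

variable [Bundle.RiemannianBundle (fun x : M => TangentSpace (𝓡 n) x)]

/-- `h` is a section of `Sym² TM`, i.e. `h ∈ Γ(Sym² TM)`: smooth and `g`-symmetric. -/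
def IsSymTensor (h : EndField n M) : Prop :=
  IsSmooth h ∧ ∀ (x : M) (X Y : TangentSpace (𝓡 n) x), inner ℝ (h x X) Y = inner ℝ X (h x Y)

/-- A `g`-orthonormal basis of `T_x M`. -/
def frame (x : M) := stdOrthonormalBasis ℝ (TangentSpace (𝓡 n) x)

/-! ### Levi-Civita connection and curvature -/

/-- The right-hand side of the Koszul formula for `2 g(∇_X Y, Z)`. -/
def koszul (X Y Z : VecField n M) (x : M) : ℝ :=
  mvfderiv (𝓡 n) (fun y => (inner ℝ (Y y) (Z y) : ℝ)) x (X x)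
    + mvfderiv (𝓡 n) (fun y => (inner ℝ (X y) (Z y) : ℝ)) x (Y x)
    - mvfderiv (𝓡 n) (fun y => (inner ℝ (X y) (Y y) : ℝ)) x (Z x)
    + inner ℝ (VectorField.mlieBracket (𝓡 n) X Y x) (Z x)
    - inner ℝ (VectorField.mlieBracket (𝓡 n) X Z x) (Y x)
    - inner ℝ (VectorField.mlieBracket (𝓡 n) Y Z x) (X x)

/-- The Levi-Civita connection: `nabla Y x X` is `(∇_X Y)(x)`. -/
def nabla (Y : VecField n M) : Tensor1 n M := fun x X =>
  ∑ i, (koszul (ext X) Y (ext (frame x i)) x / 2) • frame x i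

/-- `nabla1 h x X Y` is `(∇_X h) Y = ∇_X (h Y) - h (∇_X Y)`. -/
def nabla1 (h : Tensor1 n M) : Tensor2 n M := fun x X Y =>
  nabla (fun y => h y (ext Y y)) x X - h x (nabla (ext Y) x X)

/-- `nabla2 α x X Y Z` is `(∇_X α)(Y, Z)`. -/
def nabla2 (α : Tensor2 n M) (x : M) (X Y Z : TangentSpace (𝓡 n) x) : TangentSpace (𝓡 n) x :=
  nabla (fun y => α y (ext Y y) (ext Z y)) x X
    - α x (nabla (ext Y) x X) Z - α x Y (nabla (ext Z) x X)

/-- The curvature `R(X, Y) Z = ∇²_{Y,X} Z - ∇²_{X,Y} Z`, where `∇²_{X,Y} Z = (∇_X (∇ Z)) Y`. -/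
def curvature (x : M) (X Y Z : TangentSpace (𝓡 n) x) : TangentSpace (𝓡 n) x :=
  nabla1 (nabla (ext Z)) x Y X - nabla1 (nabla (ext Z)) x X Y

/-- The Ricci form; with the above sign of the curvature, `ric(X, Y) = ∑ g(R(e_i, X) e_i, Y)`, which
is positive on round spheres. -/
def ricci (x : M) (X Y : TangentSpace (𝓡 n) x) : ℝ :=
  ∑ i, inner ℝ (curvature x (frame x i) X (frame x i)) Y

variable (n M) in
/-- The metric is Einstein with Einstein constant `E`, i.e. `ric = E g`. -/
def IsEinstein (E : ℝ) : Prop :=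
  ∀ (x : M) (X Y : TangentSpace (𝓡 n) x), ricci x X Y = E * inner ℝ X Y

/-- `(g, J)` is a Kähler structure: `J` is a smooth `g`-orthogonal almost complex structure which is
parallel for the Levi-Civita connection. -/
structure IsKaehler (J : EndField n M) : Prop where
  smooth : IsSmooth J
  sq : ∀ (x : M) (X : TangentSpace (𝓡 n) x), J x (J x X) = -X
  orthogonal : ∀ (x : M) (X Y : TangentSpace (𝓡 n) x), inner ℝ (J x X) (J x Y) = inner ℝ X Y
  parallel : ∀ (x : M) (X Y : TangentSpace (𝓡 n) x), nabla1 J.tensor x X Y = 0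

/-- The curvature action `(R̊ h) X = ∑ R(e_i, X) h e_i`. -/
def curvAction (h : Tensor1 n M) : Tensor1 n M := fun x X =>
  ∑ i, curvature x (frame x i) X (h x (frame x i))

/-! ### Differential operators -/

/-- The trace of an endomorphism field. -/
def trace (A : Tensor1 n M) (x : M) : ℝ := ∑ i, inner ℝ (A x (frame x i)) (frame x i)

/-- The gradient of a function, that is the vector field dual to `d f`. -/
def grad (f : M → ℝ) : VecField n M := fun x =>
  ∑ i, (mvfderiv (𝓡 n) f x (frame x i)) • frame x i

/-- The coupled exterior differential `(d_∇ h)(X, Y) = (∇_X h) Y - (∇_Y h) X`. -/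
def dNabla (h : Tensor1 n M) : Tensor2 n M := fun x X Y => nabla1 h x X Y - nabla1 h x Y X

/-- The divergence `δ h = -∑ (∇_{e_i} h) e_i`, as a vector field. -/
def div1 (h : Tensor1 n M) : VecField n M := fun x =>
  -∑ i, nabla1 h x (frame x i) (frame x i)

/-- The divergence `(δ α) Y = -∑ (∇_{e_i} α)(e_i, Y)` of a `TM`-valued 2-form. -/
def div2 (α : Tensor2 n M) : Tensor1 n M := fun x Y =>
  -∑ i, nabla2 α x (frame x i) (frame x i) Y

/-- `δ^* ξ`, the `g`-symmetric part of `∇ ξ`. -/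
def deltaStar (ξ : VecField n M) : Tensor1 n M := fun x X =>
  ∑ i, ((inner ℝ (nabla ξ x X) (frame x i) + inner ℝ X (nabla ξ x (frame x i))) / 2 : ℝ) • frame x i

/-- The rough Laplacian `∇^* ∇ h = -∑ ∇²_{e_i,e_i} h`. -/
def roughLaplacian (h : Tensor1 n M) : Tensor1 n M := fun x Y =>
  -∑ i, nabla2 (nabla1 h) x (frame x i) (frame x i) Y

/-- The Einstein operator `Δ_E h = ∇^* ∇ h - 2 R̊ h`. -/
def einsteinOp (h : Tensor1 n M) : Tensor1 n M := fun x X =>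
  roughLaplacian h x X - (2 : ℝ) • curvAction h x X

/-- The perturbed Einstein operator `Δ̃_E h = Δ_E h - 2 δ^* (δ h + ½ d tr h)`. -/
def perturbedEinsteinOp (h : Tensor1 n M) : Tensor1 n M := fun x X =>
  einsteinOp h x X
    - (2 : ℝ) • deltaStar (fun y => div1 h y + (1 / 2 : ℝ) • grad (trace h) y) x X

/-! ### Brackets -/

/-- `(h ♯ α)(X, Y) = α(h X, Y) + α(X, h Y)`. -/
def sharp (h : Tensor1 n M) (α : Tensor2 n M) : Tensor2 n M := fun x X Y =>
  α x (h x X) Y + α x X (h x Y)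

/-- The anti-commutator `{h₁, h₂} = h₁ h₂ + h₂ h₁`. -/
def anticomm (h₁ h₂ : Tensor1 n M) : Tensor1 n M := fun x X => h₁ x (h₂ x X) + h₂ x (h₁ x X)

/-- The (symmetric) Frölicher-Nijenhuis bracket,
`2 [h₁, h₂] = -(h₁ ♯ d_∇ h₂ + h₂ ♯ d_∇ h₁) + d_∇ {h₁, h₂}`. -/
def fnBracket (h₁ h₂ : Tensor1 n M) : Tensor2 n M := fun x X Y =>
  (1 / 2 : ℝ) • (-(sharp h₁ (dNabla h₂) x X Y + sharp h₂ (dNabla h₁) x X Y)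
    + dNabla (anticomm h₁ h₂) x X Y)

/-- The component `½ (α - α(J·, J·))` of a `TM`-valued 2-form in `λ²(M, TM)`. -/
def lambdaPart (J : EndField n M) (α : Tensor2 n M) : Tensor2 n M := fun x X Y =>
  (1 / 2 : ℝ) • (α x X Y - α x (J x X) (J x Y))

/-- The component `γ₋(X, Y) = ½ (γ(X, Y) + J γ(X, J Y))` of `γ ∈ λ²(M, TM)` in `λ²₋(M, TM)`. -/
def lambdaMinus (J : EndField n M) (γ : Tensor2 n M) : Tensor2 n M := fun x X Y =>
  (1 / 2 : ℝ) • (γ x X Y + J x (γ x X (J x Y)))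

/-- `∂̄ h = ½ (d_∇ h - d_∇ h (J·, J·))`. -/
def dbar (J : EndField n M) (h : Tensor1 n M) : Tensor2 n M := lambdaPart J (dNabla h)

/-- The Kodaira-Spencer bracket `[h, h]^c`, the component of `[h, h]^FN` in `λ²₋(M, TM)`. -/
def ksBracket (J : EndField n M) (h : Tensor1 n M) : Tensor2 n M :=
  lambdaMinus J (lambdaPart J (fnBracket h h))

/-- The `J`-invariant part `½ (A - J A J)` of an endomorphism field. -/
def invPart (J : EndField n M) (A : Tensor1 n M) : Tensor1 n M := fun x X =>
  (1 / 2 : ℝ) • (A x X - J x (A x (J x X)))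

/-- The `J`-anti-invariant part `½ (A + J A J)` of an endomorphism field. -/
def antiInvPart (J : EndField n M) (A : Tensor1 n M) : Tensor1 n M := fun x X =>
  (1 / 2 : ℝ) • (A x X + J x (A x (J x X)))

/-! ### Riemannian volume, `L²` product and the operator `v` -/

/-- The Gram determinant `det (g_{ij})` of the metric in the chart at `p`, at the point `y` of the
chart domain. -/
def gramDet (p : M) (y : EuclideanSpace ℝ (Fin n)) : ℝ :=
  (Matrix.of fun i j : Fin n =>
    (inner ℝ
      (mfderiv (𝓡 n) (𝓡 n) (chartAt (EuclideanSpace ℝ (Fin n)) p).symm y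
        (EuclideanSpace.single i (1 : ℝ)))
      (mfderiv (𝓡 n) (𝓡 n) (chartAt (EuclideanSpace ℝ (Fin n)) p).symm y
        (EuclideanSpace.single j (1 : ℝ))) : ℝ)).det

variable [MeasurableSpace M]

/-- The Riemannian measure `√(det g_{ij}) dx` of the chart domain at `p`, as a measure on `M`
vanishing outside that domain. -/
def chartVolume (p : M) : MeasureTheory.Measure M :=
  MeasureTheory.Measure.map (chartAt (EuclideanSpace ℝ (Fin n)) p).symm
    ((MeasureTheory.volume.restrict (chartAt (EuclideanSpace ℝ (Fin n)) p).target).withDensity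
      fun y => ENNReal.ofReal (Real.sqrt (gramDet p y)))

variable (n M) in
/-- The Riemannian volume measure, obtained by gluing the measures of the charts (which agree on
overlaps): it is the least measure dominating all of them. -/
def volume : MeasureTheory.Measure M := ⨆ p : M, chartVolume (n := n) p

/-- The `L²` product `∫_M tr(A^T B) vol` of endomorphism fields. -/
def l2 (A B : Tensor1 n M) : ℝ :=
  ∫ x, (∑ i, inner ℝ (A x (frame x i)) (B x (frame x i)) : ℝ) ∂(volume n M)

/-- `v ∈ Γ(Sym² TM)` is the value `𝐯(h₁, h₂)`, i.e.
`⟨v, h₃⟩ = ⟨δ[h₁, h₂], h₃⟩ + ⟨δ[h₂, h₃], h₁⟩ + ⟨δ[h₃, h₁], h₂⟩` in `L²` for all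
`h₃ ∈ Γ(Sym² TM)`. -/
def IsV (h₁ h₂ v : EndField n M) : Prop :=
  IsSymTensor v ∧ ∀ h₃ : EndField n M, IsSymTensor h₃ →
    l2 v.tensor h₃.tensor =
      l2 (div2 (fnBracket h₁.tensor h₂.tensor)) h₃.tensor
      + l2 (div2 (fnBracket h₂.tensor h₃.tensor)) h₁.tensor
      + l2 (div2 (fnBracket h₃.tensor h₁.tensor)) h₂.tensor

/-- The tensor field `E h² - v + ½ Δ̃_E h²`. -/
def secondOrderTerm (E : ℝ) (h v : EndField n M) : Tensor1 n M := fun x X =>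
  E • h x (h x X) - v x X
    + (1 / 2 : ℝ) • perturbedEinsteinOp (comp h.tensor h.tensor) x X

end Smooth

end KEDeform

end

set_option linter.unusedSectionVars false
open scoped Manifold ContDiff Bundle ENNReal
open Filter Topology Bundle

noncomputable section

namespace KEDeform

/-! The theorem splits into an integral statement, which identifies $\mathbf v(h,h)$, and an
identity that holds at every single point.

Integral statement. By the divergence theorem
$\langle\delta[h,k]^{FN},h\rangle_{L^2}=\int\langle[h,k]^{FN},\nabla h\rangle$, and since the
bracket is antisymmetric only $d_\nabla h$ enters. The operation $h\sharp$ is self-adjoint and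
$\langle k\sharp d_\nabla h,d_\nabla h\rangle$ is already of order zero in $k$, so all derivatives
can be moved off $k$. The linear form defining $\mathbf v(h,h)$ is therefore $k\mapsto\langle\delta
d_\nabla h^2-2\delta(h\sharp d_\nabla h)+\{h,\delta d_\nabla h\}-P,k\rangle_{L^2}$, with $P$ the
Gram endomorphism of $d_\nabla h$ (`l2_preV`). Its symmetric part is the only possible value of
$\mathbf v(h,h)$, because the $L^2$ product is definite on smooth symmetric sections
(`existsUnique_isV`). The divergence theorem itself (`integral_divergence`) comes from $\sqrt{\det
g}\,\mathrm{div}\,\xi=\sum_i\partial_i(\sqrt{\det g}\,\xi^i)$ and a partition of unity.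

Pointwise identity. What remains involves only $h$, $\nabla h$, $\nabla^2h$, $J$ and $R$ at one
point. `PointData` records these together with the hypotheses and their covariant derivatives, which
keep their form because $J$ is parallel.

In second order, $\delta h=0$ and the Ricci identity give
$\sum_i(\nabla^2_{e_i,y}h)e_i=Ehy-\mathring Rh\,y$. Combined with $\bar\partial h=0$ and the Kähler
symmetries of $R$ this yields $\nabla^*\nabla h=2\mathring Rh$ (`sum_ddh_self`), that is
$\Delta_Eh=0$. The other contractions of $\nabla^2h$ with $h$ are compared in `second_order`.

In first order, $\nabla_Xh=\frac12(B_X+C_X)$ with $B_{JX}=-JB_X$ and $C_{JX}=JC_X$. The condition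
$\bar\partial h=0$ says precisely that $B_XY$ is symmetric in $X,Y$. Replacing $e_i$ by $Je_i$ in a
trace changes the sign of several mixed sums, which therefore vanish, and the rest is `first_order`.

`PointData.main` adds the two parts. The $J$-invariant part vanishes because the right-hand side is
$J$-anti-invariant: $\delta[h,h]^c$ inherits this from $h$, and $\delta^{*,-}$ has it by
construction. -/

variable {n : ℕ} {M : Type*} [TopologicalSpace M] [ChartedSpace (EuclideanSpace ℝ (Fin n)) M]
  [IsManifold (𝓡 n) ∞ M]

/-! ### Vector fields and functions smooth near a point -/

/-- The vector field `Y` is of class `C^k` at `x`. -/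
abbrev CSec (k : ℕ∞ω) (Y : VecField n M) (x : M) : Prop :=
  ContMDiffAt (𝓡 n) ((𝓡 n).prod 𝓘(ℝ, EuclideanSpace ℝ (Fin n))) k
    (fun y => TotalSpace.mk' (EuclideanSpace ℝ (Fin n)) (E := fun y : M => TangentSpace (𝓡 n) y)
      y (Y y)) x

/-- The vector field `Y` is differentiable at `x`. -/
abbrev MSec (Y : VecField n M) (x : M) : Prop :=
  MDifferentiableAt (𝓡 n) ((𝓡 n).prod 𝓘(ℝ, EuclideanSpace ℝ (Fin n)))
    (fun y => TotalSpace.mk' (EuclideanSpace ℝ (Fin n)) (E := fun y : M => TangentSpace (𝓡 n) y)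
      y (Y y)) x

/-- The vector field `Y` is smooth in a neighbourhood of `x`. -/
def Smt (Y : VecField n M) (x : M) : Prop := ∀ᶠ y in 𝓝 x, CSec ∞ Y y

/-- The function `f` is smooth in a neighbourhood of `x`. -/
def SmtF (n : ℕ) {M : Type*} [TopologicalSpace M] [ChartedSpace (EuclideanSpace ℝ (Fin n)) M]
    (f : M → ℝ) (x : M) : Prop :=
  ∀ᶠ y in 𝓝 x, ContMDiffAt (𝓡 n) 𝓘(ℝ, ℝ) ∞ f y

namespace SmtF

variable {f g : M → ℝ} {x : M}

/-- Being $C^\infty$ at a point only provides, for each finite $k$, a neighbourhood on which the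
function is $C^k$, and it may shrink with $k$. Requiring smoothness at all nearby points makes the
condition open. -/
lemma eventually (h : SmtF n f x) : ∀ᶠ y in 𝓝 x, SmtF n f y := eventually_eventually_nhds.2 h

lemma contMDiffAt (h : SmtF n f x) : ContMDiffAt (𝓡 n) 𝓘(ℝ, ℝ) ∞ f x := h.self_of_nhds

lemma mdiff (h : SmtF n f x) : MDifferentiableAt (𝓡 n) 𝓘(ℝ, ℝ) f x :=
  h.contMDiffAt.mdifferentiableAt (by simp)

lemma congr (h : SmtF n f x) (hg : ∀ᶠ y in 𝓝 x, g y = f y) : SmtF n g x := by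
  filter_upwards [h, hg.eventually_nhds] with y hy hz
  exact hy.congr_of_eventuallyEq hz

lemma const (c : ℝ) : SmtF n (fun _ : M => c) x := Eventually.of_forall fun _ => contMDiffAt_const

lemma add (h : SmtF n f x) (h' : SmtF n g x) : SmtF n (fun y => f y + g y) x := by
  filter_upwards [h, h'] with y hy hz using hy.add hz

lemma sub (h : SmtF n f x) (h' : SmtF n g x) : SmtF n (fun y => f y - g y) x := by
  filter_upwards [h, h'] with y hy hz using hy.sub hz

lemma mul (h : SmtF n f x) (h' : SmtF n g x) : SmtF n (fun y => f y * g y) x := by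
  filter_upwards [h, h'] with y hy hz using hy.mul hz

lemma comp {φ : ℝ → ℝ} (h : SmtF n f x) (hφ : ∀ᶠ y in 𝓝 x, ContDiffAt ℝ ∞ φ (f y)) :
    SmtF n (fun y => φ (f y)) x := by
  filter_upwards [h, hφ] with y hy hz using hz.contMDiffAt.comp y hy

lemma sum {ι : Type*} {s : Finset ι} {f : ι → M → ℝ} (h : ∀ i ∈ s, SmtF n (f i) x) :
    SmtF n (fun y => ∑ i ∈ s, f i y) x := by
  have := (Filter.eventually_all_finset s).2 h
  filter_upwards [this] with y hy using contMDiffAt_finsetSum fun i hi => hy i hi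

end SmtF

namespace Smt

variable {X Y Z : VecField n M} {f : M → ℝ} {x : M}

lemma eventually (h : Smt Y x) : ∀ᶠ y in 𝓝 x, Smt Y y := eventually_eventually_nhds.2 h

lemma csec (h : Smt Y x) : CSec ∞ Y x := h.self_of_nhds

lemma msec (h : Smt Y x) : MSec Y x := h.csec.mdifferentiableAt (by simp)

lemma congr (h : Smt Y x) (hZ : ∀ᶠ y in 𝓝 x, Z y = Y y) : Smt Z x := by
  filter_upwards [h, hZ.eventually_nhds] with y hy hz
  refine hy.congr_of_eventuallyEq ?_
  filter_upwards [hz] with w hw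
  simp [hw]

lemma add (h : Smt Y x) (h' : Smt Z x) : Smt (fun y => Y y + Z y) x := by
  filter_upwards [h, h'] with y hy hz using hy.add_section hz

lemma sub (h : Smt Y x) (h' : Smt Z x) : Smt (fun y => Y y - Z y) x := by
  filter_upwards [h, h'] with y hy hz using hy.sub_section hz

lemma neg (h : Smt Y x) : Smt (fun y => - Y y) x := by
  filter_upwards [h] with y hy using hy.neg_section

lemma smul (hf : SmtF n f x) (h : Smt Y x) : Smt (fun y => f y • Y y) x := by
  filter_upwards [hf, h] with y hy hz using hy.smul_section hz

lemma const_smul (c : ℝ) (h : Smt Y x) : Smt (fun y => c • Y y) x := by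
  filter_upwards [h] with y hy using hy.const_smul_section

lemma zero : Smt (fun y : M => (0 : TangentSpace (𝓡 n) y)) x :=
  Eventually.of_forall fun _ => contMDiffAt_zeroSection _ _

lemma sum {ι : Type*} {s : Finset ι} {Y : ι → VecField n M} (h : ∀ i ∈ s, Smt (Y i) x) :
    Smt (fun y => ∑ i ∈ s, Y i y) x := by
  have := (Filter.eventually_all_finset s).2 h
  filter_upwards [this] with y hy using ContMDiffAt.sum_section fun i hi => hy i hi

lemma ext (X : TangentSpace (𝓡 n) x) : Smt (ext X) x := by
  obtain ⟨s, hs, h⟩ := FiberBundle.exists_contMDiffOn_extend (k := ∞) (𝓡 n)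
    (EuclideanSpace ℝ (Fin n)) (V := fun y : M => TangentSpace (𝓡 n) y) X
  filter_upwards [eventually_mem_nhds_iff.2 hs] with y hy using h.contMDiffAt hy

end Smt

@[simp] lemma ext_self {x : M} (X : TangentSpace (𝓡 n) x) : ext X x = X :=
  FiberBundle.extend_apply_self _ _

lemma Smt.mvfderiv {f : M → ℝ} {X : VecField n M} {x : M} (hf : SmtF n f x) (hX : Smt X x) :
    SmtF n (fun y => mvfderiv (𝓡 n) f y (X y)) x := by
  filter_upwards [hf, hX] with y hf hX
  have h1 := hf.mfderiv_const (m := ∞) (by simp)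
  have := ContMDiffAt.clm_apply_of_inCoordinates (n := ∞)  (𝕜 := ℝ)
    (E₁ := fun y : M => TangentSpace (𝓡 n) y) (E₂ := fun y : ℝ => TangentSpace 𝓘(ℝ, ℝ) y) 
    (b₁ := id) (b₂ := f) (ϕ := fun y => mfderiv (𝓡 n) 𝓘(ℝ, ℝ) f y)
    (v := X) h1 hX hf
  rw [contMDiffAt_totalSpace] at this
  have h2 := this.2
  simp only [trivializationAt_model_space_apply] at h2
  exact h2

lemma isManifold_minSmoothness {m : ℕ} : IsManifold (𝓡 n) (minSmoothness ℝ m) M :=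
  IsManifold.of_le (n := ∞) (by simpa using mod_cast le_top)

lemma Smt.lie {X Y : VecField n M} {x : M} (hX : Smt X x) (hY : Smt Y x) :
    Smt (VectorField.mlieBracket (𝓡 n) X Y) x := by
  have : IsManifold (𝓡 n) (minSmoothness ℝ 2) M := isManifold_minSmoothness (m := 2)
  have : IsManifold (𝓡 n) (((⊤ : ℕ∞) : ℕ∞ω) + 1) M := inferInstanceAs (IsManifold (𝓡 n) ∞ M)
  filter_upwards [hX, hY] with y hX hY
  exact ContMDiffAt.mlieBracket_vectorField (m := ⊤) (n := ⊤) hX hY (by simp)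


open VectorField in
/-- The Lie bracket acts on functions as the commutator of derivations. -/
lemma mvfderiv_mlieBracket {f : M → ℝ} {X Y : VecField n M} {x : M}
    (hf : SmtF n f x) (hX : Smt X x) (hY : Smt Y x) :
    mvfderiv (𝓡 n) f x (mlieBracket (𝓡 n) X Y x) =
      mvfderiv (𝓡 n) (fun y => mvfderiv (𝓡 n) f y (Y y)) x (X x)
      - mvfderiv (𝓡 n) (fun y => mvfderiv (𝓡 n) f y (X y)) x (Y x) := by
  have : IsManifold (𝓡 n) (minSmoothness ℝ 2) M := isManifold_minSmoothness (m := 2)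
  have : IsManifold (𝓡 n) (minSmoothness ℝ 3) M := isManifold_minSmoothness (m := 3)
  rcases subsingleton_or_nontrivial (TangentSpace (𝓡 n) x) with hs | hs
  · rw [Subsingleton.elim (mlieBracket (𝓡 n) X Y x) 0, Subsingleton.elim (X x) 0,
      Subsingleton.elim (Y x) 0]
    simp
  obtain ⟨Z₀, hZ₀⟩ := exists_ne (0 : TangentSpace (𝓡 n) x)
  have hZ : Smt (KEDeform.ext Z₀) x := Smt.ext Z₀
  set Z := KEDeform.ext Z₀ with hZdef
  have hZx : Z x = Z₀ := ext_self Z₀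
  have two : minSmoothness ℝ 2 ≤ (∞ : ℕ∞ω) := by
    simpa using WithTop.coe_le_coe.2 (le_top (a := (2 : ℕ∞)))
  -- The Jacobi identity for $X$, $Y$, $fZ$ with $Z\neq0$ at $x$. The terms $(Xf)[Y,Z]+(Yf)[X,Z]$
  -- are symmetric in $X,Y$, and $f$ times the Jacobi identity for $X,Y,Z$ removes the
  -- undifferentiated $f$. Only a multiple of $Z$ is left, whose coefficient is the claim.
  have key := leibniz_identity_mlieBracket_apply (I := 𝓡 n) (hX.csec.of_le two) (hY.csec.of_le two)
    ((Smt.smul hf hZ).csec.of_le two)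
  have e (V : VecField n M) :
      mlieBracket (𝓡 n) V (fun y => f y • Z y) =ᶠ[𝓝 x]
      (fun y => mvfderiv (𝓡 n) f y (V y) • Z y) + fun y => f y • mlieBracket (𝓡 n) V Z y := by
    filter_upwards [hf.eventually, hZ.eventually] with y hf hZ
    exact mlieBracket_smul_right hf.mdiff hZ.msec
  have exp (V W : VecField n M) (hV : Smt V x) (hW : Smt W x) :
      mlieBracket (𝓡 n) W (mlieBracket (𝓡 n) V (fun y => f y • Z y)) x =
      mvfderiv (𝓡 n) (fun y => mvfderiv (𝓡 n) f y (V y)) x (W x) • Z x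
      + mvfderiv (𝓡 n) f x (V x) • mlieBracket (𝓡 n) W Z x
      + mvfderiv (𝓡 n) f x (W x) • mlieBracket (𝓡 n) V Z x
      + f x • mlieBracket (𝓡 n) W (mlieBracket (𝓡 n) V Z) x := by
    rw [EventuallyEq.rfl.mlieBracket_vectorField_eq (e V),
      mlieBracket_add_right (Smt.smul (hV.mvfderiv hf) hZ).msec (Smt.smul hf (hV.lie hZ)).msec]
    have h1 := mlieBracket_smul_right (I := 𝓡 n) (V := W) (hV.mvfderiv hf).mdiff hZ.msec
    have h2 := mlieBracket_smul_right (I := 𝓡 n) (V := W) hf.mdiff (hV.lie hZ).msec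
    erw [h1, h2]
    module
  rw [exp Y X hY hX, exp X Y hX hY, (e _).self_of_nhds,
    leibniz_identity_mlieBracket_apply (I := 𝓡 n) (hX.csec.of_le two) (hY.csec.of_le two)
    (hZ.csec.of_le two)] at key
  simp only [Pi.add_apply] at key
  have : (mvfderiv (𝓡 n) f x (mlieBracket (𝓡 n) X Y x) -
      (mvfderiv (𝓡 n) (fun y => mvfderiv (𝓡 n) f y (Y y)) x (X x)
      - mvfderiv (𝓡 n) (fun y => mvfderiv (𝓡 n) f y (X y)) x (Y x))) • Z x = 0 := by
    rw [← sub_eq_zero] at key; rw [← neg_eq_zero, ← key]; module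
  rw [hZx] at this
  exact sub_eq_zero.1 ((smul_eq_zero.1 this).resolve_right hZ₀)

variable [RiemannianBundle (fun x : M => TangentSpace (𝓡 n) x)]
  [IsContMDiffRiemannianBundle (𝓡 n) ∞ (EuclideanSpace ℝ (Fin n))
    (fun x : M => TangentSpace (𝓡 n) x)]

/-! ### Smooth local orthonormal frames -/

section frames

variable {X Y Z : VecField n M} {x : M}

lemma Smt.inner (hX : Smt X x) (hY : Smt Y x) :
    SmtF n (fun y => (inner ℝ (X y) (Y y) : ℝ)) x := by
  filter_upwards [hX, hY] with y hX hY using hX.inner_bundle hY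

scoped instance isContMDiffRiemannianBundle_one :
    IsContMDiffRiemannianBundle (𝓡 n) 1 (EuclideanSpace ℝ (Fin n))
      (fun x : M => TangentSpace (𝓡 n) x) :=
  IsContMDiffRiemannianBundle.of_le (n := ∞) (by simp)

lemma MSec.inner (hX : MSec X x) (hY : MSec Y x) :
    MDifferentiableAt (𝓡 n) 𝓘(ℝ, ℝ) (fun y => (inner ℝ (X y) (Y y) : ℝ)) x :=
  hX.inner_bundle hY

lemma finrank_tangentSpace (x : M) : Module.finrank ℝ (TangentSpace (𝓡 n) x) = n :=
  (finrank_euclideanSpace_fin (𝕜 := ℝ) (n := n) :)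

/-- A local frame, smooth near `x` and orthonormal near `x`. -/
structure IsONFrame (e : Fin n → VecField n M) (x : M) : Prop where
  smt : ∀ i, Smt (e i) x
  orthonormal : ∀ᶠ y in 𝓝 x, Orthonormal ℝ fun i => e i y

/-- Strong induction on the index: each vector is corrected by earlier ones, with denominators
$\langle\cdot,\cdot\rangle$ that do not vanish as long as the original vectors are independent. -/
lemma gramSchmidt_smt {e : Fin n → VecField n M} (he : ∀ i, Smt (e i) x)
    (hl : ∀ᶠ y in 𝓝 x, LinearIndependent ℝ fun i => e i y) (i : Fin n) :
    Smt (fun y => InnerProductSpace.gramSchmidt ℝ (fun i => e i y) i) x := by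
  induction i using WellFoundedLT.induction with
  | ind i ih =>
    have : (fun y => InnerProductSpace.gramSchmidt ℝ (fun i => e i y) i) = fun y => e i y -
        ∑ j ∈ Finset.Iio i, ((inner ℝ (InnerProductSpace.gramSchmidt ℝ (fun i => e i y) j) (e i y)) *
          (inner ℝ (InnerProductSpace.gramSchmidt ℝ (fun i => e i y) j)
            (InnerProductSpace.gramSchmidt ℝ (fun i => e i y) j) : ℝ)⁻¹) •
          InnerProductSpace.gramSchmidt ℝ (fun i => e i y) j := by
      ext1 y
      rw [InnerProductSpace.gramSchmidt_def]
      congr 1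
      refine Finset.sum_congr rfl fun j _ => ?_
      rw [Submodule.starProjection_singleton, real_inner_self_eq_norm_sq, div_eq_mul_inv]
      simp
    rw [this]
    refine (he i).sub (Smt.sum fun j hj => ?_)
    have hj := ih j (Finset.mem_Iio.1 hj)
    refine Smt.smul ((hj.inner (he i)).mul ((hj.inner hj).comp (φ := fun t => t⁻¹) ?_)) hj
    filter_upwards [hl] with y hy
    refine contDiffAt_inv _ ?_
    exact inner_self_ne_zero.2 (InnerProductSpace.gramSchmidt_ne_zero j hy)

/-- The bases `frame` in the definitions are chosen point by point and cannot be differentiated.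
Frames of this kind replace them whenever a derivative is taken. -/
lemma exists_isONFrame (x : M) : ∃ e : Fin n → VecField n M, IsONFrame e x := by
  let b : Module.Basis (Fin n) ℝ (EuclideanSpace ℝ (Fin n)) :=
    (EuclideanSpace.basisFun (Fin n) ℝ).toBasis
  let t := trivializationAt (EuclideanSpace ℝ (Fin n)) (fun y : M => TangentSpace (𝓡 n) y) x
  have hx : ∀ᶠ y in 𝓝 x, y ∈ t.baseSet :=
    t.open_baseSet.mem_nhds (FiberBundle.mem_baseSet_trivializationAt' x)
  have he : ∀ i, Smt (t.localFrame b i) x := fun i => by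
    filter_upwards [hx] with y hy using contMDiffAt_localFrame_of_mem ∞ t b i hy
  have hl : ∀ᶠ y in 𝓝 x, LinearIndependent ℝ fun i => t.localFrame b i y := by
    filter_upwards [hx] with y hy
    exact (t.isLocalFrameOn_localFrame_baseSet (𝓡 n) ∞ b).linearIndependent hy
  refine ⟨fun i y => InnerProductSpace.gramSchmidtNormed ℝ (fun i => t.localFrame b i y) i, ?_, ?_⟩
  · intro i
    have hi := gramSchmidt_smt he hl i
    have : (fun y => InnerProductSpace.gramSchmidtNormed ℝ (fun i => t.localFrame b i y) i) =
      fun y => (√(inner ℝ (InnerProductSpace.gramSchmidt ℝ (fun i => t.localFrame b i y) i)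
        (InnerProductSpace.gramSchmidt ℝ (fun i => t.localFrame b i y) i)))⁻¹ •
        InnerProductSpace.gramSchmidt ℝ (fun i => t.localFrame b i y) i := by
      ext1 y
      rw [InnerProductSpace.gramSchmidtNormed, ← norm_eq_sqrt_real_inner]
      rfl
    rw [this]
    refine Smt.smul ((hi.inner hi).comp (φ := fun t => (√t)⁻¹) ?_) hi
    filter_upwards [hl] with y hy
    have h0 : InnerProductSpace.gramSchmidt ℝ (fun i => t.localFrame b i y) i ≠ 0 :=
      InnerProductSpace.gramSchmidt_ne_zero i hy
    have h1 := (real_inner_self_pos (x := InnerProductSpace.gramSchmidt ℝ (fun i => t.localFrame b i y) i)).2 h0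
    exact (Real.contDiffAt_sqrt h1.ne').inv (Real.sqrt_pos.2 h1).ne'
  · filter_upwards [hl] with y hy using InnerProductSpace.gramSchmidtNormed_orthonormal hy

namespace IsONFrame

variable {e : Fin n → VecField n M}

lemma eventually (he : IsONFrame e x) : ∀ᶠ y in 𝓝 x, IsONFrame e y := by
  have := (Filter.eventually_all (l := 𝓝 x)).2 fun i => (he.smt i).eventually
  filter_upwards [this, he.orthonormal.eventually_nhds] with y h1 h2 using ⟨h1, h2⟩

/-- The orthonormal basis given by an orthonormal frame at the base point. -/
def basis (he : IsONFrame e x) : OrthonormalBasis (Fin n) ℝ (TangentSpace (𝓡 n) x) :=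
  OrthonormalBasis.mk he.orthonormal.self_of_nhds <| by
    have h := he.orthonormal.self_of_nhds.linearIndependent
    rw [h.span_eq_top_of_card_eq_finrank' (by simp [finrank_tangentSpace])]

@[simp] lemma basis_apply (he : IsONFrame e x) (i : Fin n) : he.basis i = e i x := by
  simp [basis]

lemma sum_inner_smul (he : IsONFrame e x) (X : TangentSpace (𝓡 n) x) :
    ∑ i, (inner ℝ (e i x) X : ℝ) • e i x = X := by
  simpa using he.basis.sum_repr' X

lemma eventually_sum (he : IsONFrame e x) (Y : VecField n M) :
    ∀ᶠ y in 𝓝 x, Y y = ∑ i, (inner ℝ (e i y) (Y y) : ℝ) • e i y := by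
  filter_upwards [he.eventually] with y hy using (hy.sum_inner_smul _).symm

end IsONFrame

/-- The sum of a bilinear expression over an orthonormal basis is independent of the basis. -/
lemma _root_.OrthonormalBasis.sum_bilin_eq {V W ι κ : Type*} [NormedAddCommGroup V] [InnerProductSpace ℝ V]
    [AddCommGroup W] [Module ℝ W] [Fintype ι] [Fintype κ] (b : OrthonormalBasis ι ℝ V)
    (c : OrthonormalBasis κ ℝ V) (T : V →ₗ[ℝ] V →ₗ[ℝ] W) :
    ∑ i, T (b i) (b i) = ∑ j, T (c j) (c j) := by
  have h1 (i) : T (b i) (b i) = ∑ j, ∑ k, ((inner ℝ (c j) (b i) : ℝ) * inner ℝ (c k) (b i)) • T (c j) (c k) := by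
    conv_lhs => rw [← c.sum_repr' (b i)]
    simp only [map_sum, LinearMap.sum_apply, map_smul, LinearMap.smul_apply, Finset.smul_sum, smul_smul]
    rw [Finset.sum_comm]
    simp only [mul_comm]
  simp only [h1]
  rw [Finset.sum_comm]
  refine Finset.sum_congr rfl fun j _ => ?_
  rw [Finset.sum_comm]
  simp only [← Finset.sum_smul]
  have (k : κ) : ∑ i, (inner ℝ (c j) (b i) : ℝ) * inner ℝ (c k) (b i) = inner ℝ (c j) (c k) := by
    rw [← b.sum_inner_mul_inner]
    simp only [real_inner_comm]
  simp only [this]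
  classical
  simp [orthonormal_iff_ite.1 c.orthonormal]

end frames

/-! ### The Levi-Civita connection from the Koszul formula -/

section levi_civita

open VectorField

variable {X Y Z : VecField n M} {x : M}

lemma mvfderiv_inner_smul_right {f : M → ℝ} (hf : MDifferentiableAt (𝓡 n) 𝓘(ℝ, ℝ) f x)
    (hX : MSec X x) (hY : MSec Y x) (v : TangentSpace (𝓡 n) x) :
    mvfderiv (𝓡 n) (fun y => (inner ℝ (X y) ((f • Y) y) : ℝ)) x v
      = mvfderiv (𝓡 n) f x v * inner ℝ (X x) (Y x)
        + f x * mvfderiv (𝓡 n) (fun y => (inner ℝ (X y) (Y y) : ℝ)) x v := by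
  have : (fun y => (inner ℝ (X y) ((f • Y) y) : ℝ)) = f * fun y => (inner ℝ (X y) (Y y) : ℝ) := by
    ext y; simp [inner_smul_right]
  rw [this, mvfderiv_mul hf (hX.inner hY)]
  simp; ring

lemma mvfderiv_inner_smul_left {f : M → ℝ} (hf : MDifferentiableAt (𝓡 n) 𝓘(ℝ, ℝ) f x)
    (hX : MSec X x) (hY : MSec Y x) (v : TangentSpace (𝓡 n) x) :
    mvfderiv (𝓡 n) (fun y => (inner ℝ ((f • X) y) (Y y) : ℝ)) x v
      = mvfderiv (𝓡 n) f x v * inner ℝ (X x) (Y x)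
        + f x * mvfderiv (𝓡 n) (fun y => (inner ℝ (X y) (Y y) : ℝ)) x v := by
  have := mvfderiv_inner_smul_right hf hY hX v
  simpa only [real_inner_comm] using this

lemma mvfderiv_inner_add_right (hX : MSec X x) (hY : MSec Y x) (hZ : MSec Z x)
    (v : TangentSpace (𝓡 n) x) :
    mvfderiv (𝓡 n) (fun y => (inner ℝ (X y) ((Y + Z) y) : ℝ)) x v
      = mvfderiv (𝓡 n) (fun y => (inner ℝ (X y) (Y y) : ℝ)) x v
        + mvfderiv (𝓡 n) (fun y => (inner ℝ (X y) (Z y) : ℝ)) x v := by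
  have : (fun y => (inner ℝ (X y) ((Y + Z) y) : ℝ)) =
      (fun y => (inner ℝ (X y) (Y y) : ℝ)) + fun y => (inner ℝ (X y) (Z y) : ℝ) := by
    ext y; simp [inner_add_right]
  rw [this, mvfderiv_add (hX.inner hY) (hX.inner hZ)]
  simp

lemma mvfderiv_inner_add_left (hX : MSec X x) (hY : MSec Y x) (hZ : MSec Z x)
    (v : TangentSpace (𝓡 n) x) :
    mvfderiv (𝓡 n) (fun y => (inner ℝ ((Y + Z) y) (X y) : ℝ)) x v
      = mvfderiv (𝓡 n) (fun y => (inner ℝ (Y y) (X y) : ℝ)) x v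
        + mvfderiv (𝓡 n) (fun y => (inner ℝ (Z y) (X y) : ℝ)) x v := by
  have := mvfderiv_inner_add_right hX hY hZ v
  simpa only [real_inner_comm] using this

scoped instance isManifold_minSmoothness_two : IsManifold (𝓡 n) (minSmoothness ℝ 2) M :=
  isManifold_minSmoothness (m := 2)

/-- The derivatives of $f$ coming from the inner products cancel those coming from the brackets, so
only the value of $Z$ at $x$ matters. Together with the same fact for $X$ this frees `nabla` from
the extensions used to define it. -/
lemma koszul_tensorial_right (hX : MSec X x) (hY : MSec Y x) :
    TensorialAt (𝓡 n) (EuclideanSpace ℝ (Fin n)) (V := fun y : M => TangentSpace (𝓡 n) y)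
      (fun Z => koszul X Y Z x) x where
  smul {f σ} hf hσ := by
    have h1 := mlieBracket_smul_right (V := X) hf hσ
    have h2 := mlieBracket_smul_right (V := Y) hf hσ
    simp only [koszul, mvfderiv_inner_smul_right hf hX hσ, mvfderiv_inner_smul_right hf hY hσ, h1,
      h2]
    simp only [inner_add_left, inner_smul_left, Pi.smul_apply', inner_smul_right, map_smul, smul_eq_mul,
      RCLike.conj_to_real, real_inner_comm]
    ring
  add {σ σ'} hσ hσ' := by
    have h1 := mlieBracket_add_right (V := X) hσ hσ'
    have h2 := mlieBracket_add_right (V := Y) hσ hσ'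
    simp only [koszul, mvfderiv_inner_add_right hX hσ hσ', mvfderiv_inner_add_right hY hσ hσ', h1,
      h2]
    simp only [inner_add_left, Pi.add_apply, inner_add_right, map_add]
    ring

lemma koszul_tensorial_left (hY : MSec Y x) (hZ : MSec Z x) :
    TensorialAt (𝓡 n) (EuclideanSpace ℝ (Fin n)) (V := fun y : M => TangentSpace (𝓡 n) y)
      (fun X => koszul X Y Z x) x where
  smul {f σ} hf hσ := by
    have h1 := mlieBracket_smul_left (W := Y) hf hσ
    have h2 := mlieBracket_smul_left (W := Z) hf hσ
    simp only [koszul, mvfderiv_inner_smul_left hf hσ hZ, mvfderiv_inner_smul_left hf hσ hY, h1,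
      h2]
    simp only [inner_add_left, inner_smul_left, Pi.smul_apply', inner_smul_right, map_smul, smul_eq_mul,
      RCLike.conj_to_real, neg_smul, inner_neg_left, real_inner_comm]
    ring
  add {σ σ'} hσ hσ' := by
    have h1 := mlieBracket_add_left (W := Y) hσ hσ'
    have h2 := mlieBracket_add_left (W := Z) hσ hσ'
    simp only [koszul, mvfderiv_inner_add_left hZ hσ hσ', mvfderiv_inner_add_left hY hσ hσ', h1,
      h2]
    simp only [inner_add_left, Pi.add_apply, inner_add_right, map_add]
    ring

lemma msec_ext (X : TangentSpace (𝓡 n) x) : MSec (ext X) x := (Smt.ext X).msec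

/-- The Koszul formula. -/
lemma inner_nabla (hX : MSec X x) (hY : MSec Y x) (hZ : MSec Z x) :
    inner ℝ (nabla Y x (X x)) (Z x) = koszul X Y Z x / 2 := by
  have hXe : MSec (ext (X x)) x := msec_ext _
  have ht := koszul_tensorial_right hXe hY
  have h1 : koszul X Y Z x = koszul (ext (X x)) Y Z x :=
    (koszul_tensorial_left hY hZ).pointwise hX hXe (by simp)
  have h2 (v : TangentSpace (𝓡 n) x) : koszul (ext (X x)) Y (ext v) x =
    TensorialAt.mkHom _ x ht v := rfl
  have h3 : TensorialAt.mkHom _ x ht (Z x) = koszul (ext (X x)) Y Z x := 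
    TensorialAt.mkHom_apply ht hZ
  simp only [nabla, h2, h1, ← h3, sum_inner, inner_smul_left]
  conv_rhs => rw [← (frame x).sum_repr' (Z x)]
  simp only [map_sum, map_smul, Finset.sum_div]
  refine Finset.sum_congr rfl fun i _ => ?_
  simp; ring

/-- The Koszul formula for tangent vectors. -/
lemma inner_nabla_ext (hY : MSec Y x) (v w : TangentSpace (𝓡 n) x) :
    inner ℝ (nabla Y x v) w = koszul (ext v) Y (ext w) x / 2 := by
  simpa using inner_nabla (msec_ext v) hY (msec_ext w)

lemma nabla_isLinearMap (hY : MSec Y x) : IsLinearMap ℝ (nabla Y x) where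
  map_add v w := by
    refine ext_inner_right ℝ fun u => ?_
    have ht := koszul_tensorial_left hY (msec_ext u)
    have h2 (v : TangentSpace (𝓡 n) x) : koszul (ext v) Y (ext u) x =
      TensorialAt.mkHom _ x ht v := rfl
    simp only [inner_add_left, inner_nabla_ext hY, h2, map_add]
    ring
  map_smul c v := by
    refine ext_inner_right ℝ fun u => ?_
    have ht := koszul_tensorial_left hY (msec_ext u)
    have h2 (v : TangentSpace (𝓡 n) x) : koszul (ext v) Y (ext u) x =
      TensorialAt.mkHom _ x ht v := rfl
    simp only [inner_smul_left, inner_nabla_ext hY, h2, map_smul]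
    simp; ring

lemma nabla_add (hY : MSec Y x) (hZ : MSec Z x) (v : TangentSpace (𝓡 n) x) :
    nabla (Y + Z) x v = nabla Y x v + nabla Z x v := by
  refine ext_inner_right ℝ fun u => ?_
  have hv := msec_ext v
  have hu := msec_ext u
  have h1 := mlieBracket_add_right (V := ext v) hY hZ
  have h2 := mlieBracket_add_left (W := ext u) hY hZ
  rw [inner_add_left, inner_nabla_ext hY, inner_nabla_ext hZ,
    inner_nabla_ext (mdifferentiableAt_add_section hY hZ)]
  simp only [koszul, mvfderiv_inner_add_left hu hY hZ, mvfderiv_inner_add_right hv hY hZ, h1,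
      h2]
  simp only [inner_add_left, Pi.add_apply, inner_add_right, map_add]
  ring

lemma nabla_smul {f : M → ℝ} (hf : MDifferentiableAt (𝓡 n) 𝓘(ℝ, ℝ) f x) (hY : MSec Y x)
    (v : TangentSpace (𝓡 n) x) :
    nabla (f • Y) x v = mvfderiv (𝓡 n) f x v • Y x + f x • nabla Y x v := by
  refine ext_inner_right ℝ fun u => ?_
  have hv := msec_ext v
  have hu := msec_ext u
  have h1 := mlieBracket_smul_right (V := ext v) hf hY
  have h2 := mlieBracket_smul_left (W := ext u) hf hY
  rw [inner_add_left, inner_smul_left, inner_smul_left, inner_nabla_ext hY,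
    inner_nabla_ext (hf.smul_section hY)]
  simp only [koszul, mvfderiv_inner_smul_left hf hY hu, mvfderiv_inner_smul_right hf hv hY, h1,
      h2]
  simp only [inner_add_left, inner_smul_left, Pi.smul_apply', inner_smul_right, map_smul,
    smul_eq_mul, RCLike.conj_to_real, neg_smul, inner_neg_left, real_inner_comm, ext_self]
  ring

lemma mvfderiv_congr {f g : M → ℝ} (h : ∀ᶠ y in 𝓝 x, f y = g y) :
    mvfderiv (𝓡 n) f x = mvfderiv (𝓡 n) g x := by
  simp only [mvfderiv, EventuallyEq.mfderiv_eq h]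
  rfl

lemma nabla_congr (h : ∀ᶠ y in 𝓝 x, Y y = Z y) (v : TangentSpace (𝓡 n) x) :
    nabla Y x v = nabla Z x v := by
  have h0 := h.self_of_nhds
  have hb (W : VecField n M) : mlieBracket (𝓡 n) W Y x = mlieBracket (𝓡 n) W Z x :=
    EventuallyEq.rfl.mlieBracket_vectorField_eq h
  have hb' (W : VecField n M) : mlieBracket (𝓡 n) Y W x = mlieBracket (𝓡 n) Z W x :=
    EventuallyEq.mlieBracket_vectorField_eq h EventuallyEq.rfl
  have hi (W : VecField n M) : mvfderiv (𝓡 n) (fun y => (inner ℝ (Y y) (W y) : ℝ)) x =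
      mvfderiv (𝓡 n) (fun y => (inner ℝ (Z y) (W y) : ℝ)) x := by
    have : (fun y => (inner ℝ (Y y) (W y) : ℝ)) =ᶠ[𝓝 x] (fun y => (inner ℝ (Z y) (W y) : ℝ)) := by
      filter_upwards [h] with y hy
      rw [hy]
    exact mvfderiv_congr this
  have hi' (W : VecField n M) : mvfderiv (𝓡 n) (fun y => (inner ℝ (W y) (Y y) : ℝ)) x =
      mvfderiv (𝓡 n) (fun y => (inner ℝ (W y) (Z y) : ℝ)) x := by
    simpa only [real_inner_comm] using hi W
  simp only [nabla, koszul, hb, hb', hi, hi', h0]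

/-- The Levi-Civita connection is compatible with the metric. -/
lemma mvfderiv_inner (hY : MSec Y x) (hZ : MSec Z x) (v : TangentSpace (𝓡 n) x) :
    mvfderiv (𝓡 n) (fun y => (inner ℝ (Y y) (Z y) : ℝ)) x v
      = inner ℝ (nabla Y x v) (Z x) + inner ℝ (Y x) (nabla Z x v) := by
  have h1 := inner_nabla (msec_ext v) hY hZ
  have h2 := inner_nabla (msec_ext v) hZ hY
  rw [ext_self] at h1 h2
  rw [real_inner_comm (nabla Z x v), h1, h2]
  simp only [koszul, mlieBracket_swap_apply (V := Z) (W := Y), inner_neg_left, ext_self,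
    real_inner_comm]
  ring

/-- The Levi-Civita connection is torsion-free. -/
lemma nabla_sub_nabla (hX : MSec X x) (hY : MSec Y x) :
    nabla Y x (X x) - nabla X x (Y x) = mlieBracket (𝓡 n) X Y x := by
  refine ext_inner_right ℝ fun u => ?_
  have h1 := inner_nabla hX hY (msec_ext u)
  have h2 := inner_nabla hY hX (msec_ext u)
  rw [ext_self] at h1 h2
  rw [inner_sub_left, h1, h2]
  simp only [koszul, mlieBracket_swap_apply (V := Y) (W := X), inner_neg_left, ext_self,
    real_inner_comm]
  ring

lemma koszul_smtF (hX : Smt X x) (hY : Smt Y x) (hZ : Smt Z x) :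
    SmtF n (fun y => koszul X Y Z y) x := by
  unfold koszul
  exact (((((hX.mvfderiv (hY.inner hZ)).add (hY.mvfderiv (hX.inner hZ))).sub
    (hZ.mvfderiv (hX.inner hY))).add ((hX.lie hY).inner hZ)).sub ((hX.lie hZ).inner hY)).sub
    ((hY.lie hZ).inner hX)

/-- The extensions in the definition of `nabla` change with the base point, so smoothness is read
off from the coefficients in a fixed orthonormal frame, which are Koszul expressions of smooth
fields. -/
lemma Smt.nabla (hY : Smt Y x) (hX : Smt X x) : Smt (fun y => nabla Y y (X y)) x := by
  obtain ⟨e, he⟩ := exists_isONFrame (n := n) x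
  have : Smt (fun y => ∑ i, (koszul X Y (e i) y * (1 / 2)) • e i y) x :=
    Smt.sum fun i _ => Smt.smul ((koszul_smtF hX hY (he.smt i)).mul (SmtF.const _)) (he.smt i)
  refine this.congr ?_
  filter_upwards [he.eventually, hX.eventually, hY.eventually] with y he hX hY
  rw [← he.sum_inner_smul (KEDeform.nabla Y y (X y))]
  refine Finset.sum_congr rfl fun i _ => ?_
  rw [real_inner_comm, inner_nabla hX.msec hY.msec (he.smt i).msec]
  ring_nf

end levi_civita

/-! ### Tensor fields as pointwise linear operators on vector fields, and product rules -/

/-- `A` is linear at `z` and maps fields smooth near `z` to such fields. -/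
structure T1 (A : Tensor1 n M) (z : M) : Prop where
  lin : IsLinearMap ℝ (A z)
  smt : ∀ Y, Smt Y z → Smt (fun y => A y (Y y)) z

/-- `α` is bilinear at `z` and maps fields smooth near `z` to such fields. -/
structure T2 (α : Tensor2 n M) (z : M) : Prop where
  lin₁ : ∀ Z, IsLinearMap ℝ fun Y => α z Y Z
  lin₂ : ∀ Y, IsLinearMap ℝ fun Z => α z Y Z
  smt : ∀ Y Z, Smt Y z → Smt Z z → Smt (fun y => α y (Y y) (Z y)) z

/-- `A` is a smooth tensor field near `x`. -/
def Tens1 (A : Tensor1 n M) (x : M) : Prop := ∀ᶠ z in 𝓝 x, T1 A z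

/-- `α` is a smooth tensor field near `x`. -/
def Tens2 (α : Tensor2 n M) (x : M) : Prop := ∀ᶠ z in 𝓝 x, T2 α z

section basic

variable {A B : Tensor1 n M} {α β : Tensor2 n M} {X Y Z : VecField n M} {x : M}

lemma Tens1.eventually (h : Tens1 A x) : ∀ᶠ y in 𝓝 x, Tens1 A y := eventually_eventually_nhds.2 h

lemma Tens2.eventually (h : Tens2 α x) : ∀ᶠ y in 𝓝 x, Tens2 α y := eventually_eventually_nhds.2 h

lemma Tens1.at (h : Tens1 A x) : T1 A x := h.self_of_nhds

lemma Tens2.at (h : Tens2 α x) : T2 α x := h.self_of_nhds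

lemma Tens1.add_apply (h : Tens1 A x) (v w : TangentSpace (𝓡 n) x) :
    A x (v + w) = A x v + A x w := h.at.lin.map_add v w

lemma Tens1.smul_apply (h : Tens1 A x) (c : ℝ) (v : TangentSpace (𝓡 n) x) :
    A x (c • v) = c • A x v := h.at.lin.map_smul c v

lemma Tens1.sub_apply (h : Tens1 A x) (v w : TangentSpace (𝓡 n) x) :
    A x (v - w) = A x v - A x w := h.at.lin.map_sub v w

lemma Tens1.sum_apply (h : Tens1 A x) {ι : Type*} (s : Finset ι)
    (v : ι → TangentSpace (𝓡 n) x) : A x (∑ i ∈ s, v i) = ∑ i ∈ s, A x (v i) :=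
  map_sum h.at.lin.mk' v s

lemma _root_.MDifferentiableAt.msec_smul {f : M → ℝ} (hf : MDifferentiableAt (𝓡 n) 𝓘(ℝ, ℝ) f x)
    (hY : MSec Y x) : MSec (fun y => f y • Y y) x := hf.smul_section hY

lemma MSec.congr (h : MSec Y x) (hZ : ∀ᶠ y in 𝓝 x, Z y = Y y) : MSec Z x := by
  refine h.congr_of_eventuallyEq ?_
  filter_upwards [hZ] with w hw
  simp [hw]

/-- `T1` only speaks of smooth inputs, while tensoriality criteria test differentiable ones. Writing
$AY=\sum_i\langle e_i,Y\rangle Ae_i$ in a smooth frame bridges the gap. -/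
lemma Tens1.msec (h : Tens1 A x) (hY : MSec Y x) : MSec (fun y => A y (Y y)) x := by
  obtain ⟨e, he⟩ := exists_isONFrame (n := n) x
  have : MSec (fun y => ∑ i, (inner ℝ (e i y) (Y y) : ℝ) • A y (e i y)) x :=
    MDifferentiableAt.sum_section fun i _ =>
      ((he.smt i).msec.inner hY).msec_smul (h.at.smt _ (he.smt i)).msec
  refine this.congr ?_
  filter_upwards [h.eventually, he.eventually] with y h he
  conv_lhs => rw [← he.sum_inner_smul (Y y)]
  simp only [h.sum_apply, h.smul_apply]

lemma Tens2.left (h : Tens2 α x) (hY : Smt Y x) : Tens1 (fun y Z => α y (Y y) Z) x := by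
  filter_upwards [h, hY.eventually] with y h hY
  exact ⟨h.lin₂ _, fun Z hZ => h.smt _ _ hY hZ⟩

lemma Tens2.right (h : Tens2 α x) (hZ : Smt Z x) : Tens1 (fun y Y => α y Y (Z y)) x := by
  filter_upwards [h, hZ.eventually] with y h hZ
  exact ⟨h.lin₁ _, fun Y hY => h.smt _ _ hY hZ⟩

lemma Tens2.add_left (h : Tens2 α x) (v v' w : TangentSpace (𝓡 n) x) :
    α x (v + v') w = α x v w + α x v' w := (h.at.lin₁ w).map_add v v'

lemma Tens2.add_right (h : Tens2 α x) (v w w' : TangentSpace (𝓡 n) x) :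
    α x v (w + w') = α x v w + α x v w' := (h.at.lin₂ v).map_add w w'

lemma Tens2.smul_left (h : Tens2 α x) (c : ℝ) (v w : TangentSpace (𝓡 n) x) :
    α x (c • v) w = c • α x v w := (h.at.lin₁ w).map_smul c v

lemma Tens2.smul_right (h : Tens2 α x) (c : ℝ) (v w : TangentSpace (𝓡 n) x) :
    α x v (c • w) = c • α x v w := (h.at.lin₂ v).map_smul c w

lemma Tens2.sum_left (h : Tens2 α x) {ι : Type*} (s : Finset ι)
    (v : ι → TangentSpace (𝓡 n) x) (w : TangentSpace (𝓡 n) x) :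
    α x (∑ i ∈ s, v i) w = ∑ i ∈ s, α x (v i) w :=
  map_sum (h.at.lin₁ w).mk' v s

lemma Tens2.msec (h : Tens2 α x) (hY : MSec Y x) (hZ : MSec Z x) :
    MSec (fun y => α y (Y y) (Z y)) x := by
  obtain ⟨e, he⟩ := exists_isONFrame (n := n) x
  have : MSec (fun y => ∑ i, (inner ℝ (e i y) (Y y) : ℝ) • α y (e i y) (Z y)) x :=
    MDifferentiableAt.sum_section fun i _ =>
      ((he.smt i).msec.inner hY).msec_smul ((h.left (he.smt i)).msec hZ)
  refine this.congr ?_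
  filter_upwards [h.eventually, he.eventually] with y h he
  conv_lhs => rw [← he.sum_inner_smul (Y y)]
  simp only [h.sum_left, h.smul_left]

end basic

section product_rule

variable {A B : Tensor1 n M} {α β : Tensor2 n M} {X Y Z : VecField n M} {x : M}

lemma nabla_add' (hY : MSec Y x) (hZ : MSec Z x) (v : TangentSpace (𝓡 n) x) :
    nabla (fun y => Y y + Z y) x v = nabla Y x v + nabla Z x v := nabla_add hY hZ v

lemma nabla_smul' {f : M → ℝ} (hf : MDifferentiableAt (𝓡 n) 𝓘(ℝ, ℝ) f x) (hY : MSec Y x)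
    (v : TangentSpace (𝓡 n) x) :
    nabla (fun y => f y • Y y) x v = mvfderiv (𝓡 n) f x v • Y x + f x • nabla Y x v :=
  nabla_smul hf hY v

lemma nabla_const_smul (c : ℝ) (hY : MSec Y x) (v : TangentSpace (𝓡 n) x) :
    nabla (fun y => c • Y y) x v = c • nabla Y x v := by
  rw [nabla_smul' (f := fun _ => c) mdifferentiableAt_const hY, mvfderiv_const]
  simp

lemma nabla_neg (hY : MSec Y x) (v : TangentSpace (𝓡 n) x) :
    nabla (fun y => - Y y) x v = - nabla Y x v := by
  simpa using nabla_const_smul (-1) hY v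

lemma nabla_sub (hY : MSec Y x) (hZ : MSec Z x) (v : TangentSpace (𝓡 n) x) :
    nabla (fun y => Y y - Z y) x v = nabla Y x v - nabla Z x v := by
  have h1 : MSec (fun y => - Z y) x := by
    simpa using (mdifferentiableAt_const (c := (-1 : ℝ))).msec_smul hZ
  simp only [sub_eq_add_neg]
  rw [nabla_add' hY h1, nabla_neg hZ]

lemma nabla_zero (v : TangentSpace (𝓡 n) x) : nabla (fun y : M => (0 : TangentSpace (𝓡 n) y)) x v = 0 := by
  have h : MSec (fun y : M => (0 : TangentSpace (𝓡 n) y)) x := (Smt.zero (n := n)).msec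
  have := nabla_const_smul (0 : ℝ) h v
  simpa using this

lemma nabla_sum {ι : Type*} {s : Finset ι} {Y : ι → VecField n M} (h : ∀ i ∈ s, MSec (Y i) x)
    (v : TangentSpace (𝓡 n) x) :
    nabla (fun y => ∑ i ∈ s, Y i y) x v = ∑ i ∈ s, nabla (Y i) x v := by
  classical
  induction s using Finset.induction_on with
  | empty => simpa using nabla_zero v
  | insert a s ha ih =>
    simp only [Finset.mem_insert, forall_eq_or_imp] at h
    simp only [Finset.sum_insert ha, ← ih h.2]
    exact nabla_add' h.1 (MDifferentiableAt.sum_section h.2) v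

/-- The product rule `∇_v (A Y) = (∇_v A) Y + A (∇_v Y)`. -/
lemma Tens1.nabla_apply (h : Tens1 A x) (hY : MSec Y x) (v : TangentSpace (𝓡 n) x) :
    nabla (fun y => A y (Y y)) x v = nabla1 A x v (Y x) + A x (nabla Y x v) := by
  -- The difference $\nabla_v(AY)-A(\nabla_vY)$ is tensorial in $Y$, so $Y$ may be replaced by the
  -- extension of its value that occurs in `nabla1`.
  have ht : TensorialAt (𝓡 n) (EuclideanSpace ℝ (Fin n)) (V := fun y : M => TangentSpace (𝓡 n) y)
      (fun Y : VecField n M => nabla (fun y => A y (Y y)) x v - A x (nabla Y x v)) x := by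
    constructor
    · intro f σ hf hσ
      have h1 : ∀ᶠ y in 𝓝 x, A y ((f • σ) y) = f y • A y (σ y) := by
        filter_upwards [h.eventually] with y h using h.smul_apply _ _
      rw [nabla_congr h1, nabla_smul' hf (h.msec hσ), nabla_smul hf hσ, h.add_apply, h.smul_apply,
        h.smul_apply]
      module
    · intro σ σ' hσ hσ'
      have h1 : ∀ᶠ y in 𝓝 x, A y ((σ + σ') y) = A y (σ y) + A y (σ' y) := by
        filter_upwards [h.eventually] with y h using h.add_apply _ _
      rw [nabla_congr h1, nabla_add' (h.msec hσ) (h.msec hσ'), nabla_add hσ hσ', h.add_apply]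
      module
  have := ht.pointwise hY (msec_ext (Y x)) (by simp)
  rw [nabla1, ← this]
  abel

/-- The product rule `∇_v (α(Y, Z)) = (∇_v α)(Y, Z) + α(∇_v Y, Z) + α(Y, ∇_v Z)`. -/
lemma Tens2.nabla_apply (h : Tens2 α x) (hY : MSec Y x) (hZ : MSec Z x)
    (v : TangentSpace (𝓡 n) x) :
    nabla (fun y => α y (Y y) (Z y)) x v =
      nabla2 α x v (Y x) (Z x) + α x (nabla Y x v) (Z x) + α x (Y x) (nabla Z x v) := by
  have := TensorialAt.pointwise₂ (I := 𝓡 n) (F := EuclideanSpace ℝ (Fin n))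
    (F' := EuclideanSpace ℝ (Fin n)) (V := fun y : M => TangentSpace (𝓡 n) y)
    (V' := fun y : M => TangentSpace (𝓡 n) y) (x := x)
    (Φ := fun Y Z : VecField n M => nabla (fun y => α y (Y y) (Z y)) x v - α x (nabla Y x v) (Z x)
      - α x (Y x) (nabla Z x v)) ?_ ?_ hY (msec_ext (Y x)) hZ (msec_ext (Z x)) (by simp) (by simp)
  · simp only [ext_self] at this
    rw [nabla2, ← this]
    abel
  · intro τ hτ
    constructor
    · intro f σ hf hσ
      have h1 : ∀ᶠ y in 𝓝 x, α y ((f • σ) y) (τ y) = f y • α y (σ y) (τ y) := by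
        filter_upwards [h.eventually] with y h using h.smul_left _ _ _
      rw [nabla_congr h1, nabla_smul' hf (h.msec hσ hτ), nabla_smul hf hσ, h.add_left,
        h.smul_left, h.smul_left, Pi.smul_apply', h.smul_left]
      module
    · intro σ σ' hσ hσ'
      have h1 : ∀ᶠ y in 𝓝 x, α y ((σ + σ') y) (τ y) = α y (σ y) (τ y) + α y (σ' y) (τ y) := by
        filter_upwards [h.eventually] with y h using h.add_left _ _ _
      rw [nabla_congr h1, nabla_add' (h.msec hσ hτ) (h.msec hσ' hτ), nabla_add hσ hσ', h.add_left,
        Pi.add_apply, h.add_left]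
      module
  · intro τ hτ
    constructor
    · intro f σ hf hσ
      have h1 : ∀ᶠ y in 𝓝 x, α y (τ y) ((f • σ) y) = f y • α y (τ y) (σ y) := by
        filter_upwards [h.eventually] with y h using h.smul_right _ _ _
      rw [nabla_congr h1, nabla_smul' hf (h.msec hτ hσ), nabla_smul hf hσ, h.add_right,
        h.smul_right, h.smul_right, Pi.smul_apply', h.smul_right]
      module
    · intro σ σ' hσ hσ'
      have h1 : ∀ᶠ y in 𝓝 x, α y (τ y) ((σ + σ') y) = α y (τ y) (σ y) + α y (τ y) (σ' y) := by
        filter_upwards [h.eventually] with y h using h.add_right _ _ _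
      rw [nabla_congr h1, nabla_add' (h.msec hτ hσ) (h.msec hτ hσ'), nabla_add hσ hσ', h.add_right,
        Pi.add_apply, h.add_right]
      module

end product_rule

/-! ### Closure of tensor fields under algebraic operations -/

section closure

variable {A B : Tensor1 n M} {α β : Tensor2 n M} {X Y Z : VecField n M} {x : M}

lemma T1.comp (hA : T1 A x) (hB : T1 B x) : T1 (comp A B) x :=
  ⟨⟨fun v w => by simp [KEDeform.comp, hB.lin.map_add, hA.lin.map_add],
    fun c w => by simp [KEDeform.comp, hB.lin.map_smul, hA.lin.map_smul]⟩,
    fun Y hY => hA.smt _ (hB.smt _ hY)⟩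

lemma T1.add (hA : T1 A x) (hB : T1 B x) : T1 (fun y X => A y X + B y X) x :=
  ⟨⟨fun v w => by rw [hA.lin.map_add, hB.lin.map_add]; abel,
    fun c w => by rw [hA.lin.map_smul, hB.lin.map_smul]; module⟩,
    fun Y hY => (hA.smt _ hY).add (hB.smt _ hY)⟩

lemma T1.sub (hA : T1 A x) (hB : T1 B x) : T1 (fun y X => A y X - B y X) x :=
  ⟨⟨fun v w => by rw [hA.lin.map_add, hB.lin.map_add]; abel,
    fun c w => by rw [hA.lin.map_smul, hB.lin.map_smul]; module⟩,
    fun Y hY => (hA.smt _ hY).sub (hB.smt _ hY)⟩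

lemma T1.smul (c : ℝ) (hA : T1 A x) : T1 (fun y X => c • A y X) x :=
  ⟨⟨fun v w => by rw [hA.lin.map_add]; module,
    fun c w => by rw [hA.lin.map_smul]; module⟩,
    fun Y hY => (hA.smt _ hY).const_smul c⟩

lemma T1.id : T1 (fun (y : M) (X : TangentSpace (𝓡 n) y) => X) x :=
  ⟨⟨fun _ _ => rfl, fun _ _ => rfl⟩, fun _ hY => hY⟩

lemma T2.add (hα : T2 α x) (hβ : T2 β x) : T2 (fun y X Y => α y X Y + β y X Y) x :=
  ⟨fun Z => ⟨fun v w => by rw [(hα.lin₁ Z).map_add, (hβ.lin₁ Z).map_add]; abel,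
      fun c w => by rw [(hα.lin₁ Z).map_smul, (hβ.lin₁ Z).map_smul]; module⟩,
    fun Z => ⟨fun v w => by rw [(hα.lin₂ Z).map_add, (hβ.lin₂ Z).map_add]; abel,
      fun c w => by rw [(hα.lin₂ Z).map_smul, (hβ.lin₂ Z).map_smul]; module⟩,
    fun Y Z hY hZ => (hα.smt _ _ hY hZ).add (hβ.smt _ _ hY hZ)⟩

lemma T2.smul (c : ℝ) (hα : T2 α x) : T2 (fun y X Y => c • α y X Y) x :=
  ⟨fun Z => ⟨fun v w => by rw [(hα.lin₁ Z).map_add]; module,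
      fun c w => by rw [(hα.lin₁ Z).map_smul]; module⟩,
    fun Z => ⟨fun v w => by rw [(hα.lin₂ Z).map_add]; module,
      fun c w => by rw [(hα.lin₂ Z).map_smul]; module⟩,
    fun Y Z hY hZ => (hα.smt _ _ hY hZ).const_smul c⟩

lemma T2.neg (hα : T2 α x) : T2 (fun y X Y => -α y X Y) x := by
  simpa using hα.smul (-1)

lemma T2.sub (hα : T2 α x) (hβ : T2 β x) : T2 (fun y X Y => α y X Y - β y X Y) x := by
  simpa [sub_eq_add_neg] using hα.add hβ.neg

lemma T2.flip (hα : T2 α x) : T2 (fun y X Y => α y Y X) x :=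
  ⟨hα.lin₂, hα.lin₁, fun _ _ hY hZ => hα.smt _ _ hZ hY⟩

lemma T2.comp_left (hα : T2 α x) (hA : T1 A x) : T2 (fun y X Y => α y (A y X) Y) x :=
  ⟨fun Z => ⟨fun v w => by rw [hA.lin.map_add, (hα.lin₁ Z).map_add],
      fun c w => by rw [hA.lin.map_smul, (hα.lin₁ Z).map_smul]⟩,
    fun Z => hα.lin₂ _, fun _ _ hY hZ => hα.smt _ _ (hA.smt _ hY) hZ⟩

lemma T2.comp_right (hα : T2 α x) (hA : T1 A x) : T2 (fun y X Y => α y X (A y Y)) x :=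
  (hα.flip.comp_left hA).flip

lemma T2.comp_out (hα : T2 α x) (hA : T1 A x) : T2 (fun y X Y => A y (α y X Y)) x :=
  ⟨fun Z => ⟨fun v w => by rw [(hα.lin₁ Z).map_add, hA.lin.map_add],
      fun c w => by rw [(hα.lin₁ Z).map_smul, hA.lin.map_smul]⟩,
    fun Z => ⟨fun v w => by rw [(hα.lin₂ Z).map_add, hA.lin.map_add],
      fun c w => by rw [(hα.lin₂ Z).map_smul, hA.lin.map_smul]⟩,
    fun _ _ hY hZ => hA.smt _ (hα.smt _ _ hY hZ)⟩

lemma Tens1.comp (hA : Tens1 A x) (hB : Tens1 B x) : Tens1 (comp A B) x := by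
  filter_upwards [hA, hB] with y hA hB using hA.comp hB

lemma Tens1.add (hA : Tens1 A x) (hB : Tens1 B x) : Tens1 (fun y X => A y X + B y X) x := by
  filter_upwards [hA, hB] with y hA hB using hA.add hB

lemma Tens1.sub (hA : Tens1 A x) (hB : Tens1 B x) : Tens1 (fun y X => A y X - B y X) x := by
  filter_upwards [hA, hB] with y hA hB using hA.sub hB

lemma Tens1.smul (c : ℝ) (hA : Tens1 A x) : Tens1 (fun y X => c • A y X) x := by
  filter_upwards [hA] with y hA using hA.smul c

lemma Tens1.id : Tens1 (fun (y : M) (X : TangentSpace (𝓡 n) y) => X) x :=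
  Eventually.of_forall fun _ => T1.id

lemma Tens2.add (hα : Tens2 α x) (hβ : Tens2 β x) : Tens2 (fun y X Y => α y X Y + β y X Y) x := by
  filter_upwards [hα, hβ] with y hα hβ using hα.add hβ

lemma Tens2.smul (c : ℝ) (hα : Tens2 α x) : Tens2 (fun y X Y => c • α y X Y) x := by
  filter_upwards [hα] with y hα using hα.smul c

lemma Tens2.neg (hα : Tens2 α x) : Tens2 (fun y X Y => -α y X Y) x := by
  filter_upwards [hα] with y hα using hα.neg

lemma Tens2.sub (hα : Tens2 α x) (hβ : Tens2 β x) : Tens2 (fun y X Y => α y X Y - β y X Y) x := by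
  filter_upwards [hα, hβ] with y hα hβ using hα.sub hβ

lemma Tens2.flip (hα : Tens2 α x) : Tens2 (fun y X Y => α y Y X) x := by
  filter_upwards [hα] with y hα using hα.flip

lemma Tens2.comp_left (hα : Tens2 α x) (hA : Tens1 A x) :
    Tens2 (fun y X Y => α y (A y X) Y) x := by
  filter_upwards [hα, hA] with y hα hA using hα.comp_left hA

lemma Tens2.comp_right (hα : Tens2 α x) (hA : Tens1 A x) :
    Tens2 (fun y X Y => α y X (A y Y)) x := by
  filter_upwards [hα, hA] with y hα hA using hα.comp_right hA

lemma Tens2.comp_out (hα : Tens2 α x) (hA : Tens1 A x) :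
    Tens2 (fun y X Y => A y (α y X Y)) x := by
  filter_upwards [hα, hA] with y hα hA using hα.comp_out hA

end closure

/-! ### Covariant derivatives of tensor fields are tensor fields -/

section nabla

variable {A B : Tensor1 n M} {α β : Tensor2 n M} {ξ X Y Z : VecField n M} {x : M}

lemma Smt.tens1_nabla (h : Smt ξ x) : Tens1 (KEDeform.nabla ξ) x := by
  filter_upwards [h.eventually] with y h
  exact ⟨nabla_isLinearMap h.msec, fun Y hY => h.nabla hY⟩

lemma nabla_vadd (h : MSec ξ x) (v w : TangentSpace (𝓡 n) x) :
    nabla ξ x (v + w) = nabla ξ x v + nabla ξ x w := (nabla_isLinearMap h).map_add v w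

lemma nabla_vsmul (h : MSec ξ x) (c : ℝ) (v : TangentSpace (𝓡 n) x) :
    nabla ξ x (c • v) = c • nabla ξ x v := (nabla_isLinearMap h).map_smul c v

lemma Tens1.nabla1_eq (h : Tens1 A x) (hY : MSec Y x) (v : TangentSpace (𝓡 n) x) :
    nabla1 A x v (Y x) = nabla (fun y => A y (Y y)) x v - A x (nabla Y x v) := by
  rw [h.nabla_apply hY]; abel

lemma Tens2.nabla2_eq (h : Tens2 α x) (hY : MSec Y x) (hZ : MSec Z x)
    (v : TangentSpace (𝓡 n) x) :
    nabla2 α x v (Y x) (Z x) = nabla (fun y => α y (Y y) (Z y)) x v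
      - α x (nabla Y x v) (Z x) - α x (Y x) (nabla Z x v) := by
  rw [h.nabla_apply hY hZ]; abel

lemma Tens1.nabla1 (h : Tens1 A x) : Tens2 (nabla1 A) x := by
  filter_upwards [h.eventually] with y h
  refine ⟨fun w => ⟨fun v v' => ?_, fun c v => ?_⟩, fun v => ⟨fun w w' => ?_, fun c w => ?_⟩,
    fun Y Z hY hZ => ?_⟩
  · have hw := msec_ext w
    have := nabla_vadd (h.msec hw) v v'
    simp only [KEDeform.nabla1, this, nabla_vadd hw, h.add_apply]
    abel
  · have hw := msec_ext w
    have := nabla_vsmul (h.msec hw) c v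
    simp only [KEDeform.nabla1, this, nabla_vsmul hw, h.smul_apply]
    module
  · have hw := msec_ext w
    have hw' := msec_ext w'
    have h1 := h.nabla1_eq (mdifferentiableAt_add_section hw hw') v
    simp only [Pi.add_apply, ext_self] at h1
    have h2 : ∀ᶠ z in 𝓝 y, A z (ext w z + ext w' z) = A z (ext w z) + A z (ext w' z) := by
      filter_upwards [h.eventually] with z h using h.add_apply _ _
    rw [h1, nabla_congr h2, nabla_add' (h.msec hw) (h.msec hw'), nabla_add hw hw', h.add_apply]
    simp only [KEDeform.nabla1]
    abel
  · have hw := msec_ext w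
    have h1 := h.nabla1_eq (mdifferentiableAt_const (c := c) |>.msec_smul hw) v
    simp only [ext_self] at h1
    have h2 : ∀ᶠ z in 𝓝 y, A z (c • ext w z) = c • A z (ext w z) := by
      filter_upwards [h.eventually] with z h using h.smul_apply _ _
    rw [h1, nabla_congr h2, nabla_const_smul _ (h.msec hw), nabla_const_smul _ hw, h.smul_apply]
    simp only [KEDeform.nabla1]
    module
  · refine Smt.congr (((h.at.smt _ hZ).nabla hY).sub (h.at.smt _ (hZ.nabla hY))) ?_
    filter_upwards [h.eventually, hZ.eventually] with z h hZ
    exact h.nabla1_eq hZ.msec _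

/-- Freezing one argument along a field turns a two-argument tensor into an endomorphism field. This
reduces statements about `nabla2` to statements about `nabla1`, up to a zeroth-order correction. -/
lemma Tens2.nabla1_left (h : Tens2 α x) (hY : Smt Y x) (v w : TangentSpace (𝓡 n) x) :
    KEDeform.nabla1 (fun y Z => α y (Y y) Z) x v w
      = nabla2 α x v (Y x) w + α x (nabla Y x v) w := by
  have h1 := (h.left hY).nabla1_eq (msec_ext w) v
  have h2 := h.nabla_apply hY.msec (msec_ext w) v
  simp only [ext_self] at h1 h2
  rw [h1, h2]
  abel

lemma Tens2.nabla1_right (h : Tens2 α x) (hZ : Smt Z x) (v w : TangentSpace (𝓡 n) x) :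
    KEDeform.nabla1 (fun y Y => α y Y (Z y)) x v w
      = nabla2 α x v w (Z x) + α x w (nabla Z x v) := by
  have h1 := (h.right hZ).nabla1_eq (msec_ext w) v
  have h2 := h.nabla_apply (msec_ext w) hZ.msec v
  simp only [ext_self] at h1 h2
  rw [h1, h2]
  abel

lemma Tens2.nabla2_lin₁ (h : Tens2 α x) (v w : TangentSpace (𝓡 n) x) :
    IsLinearMap ℝ fun u => nabla2 α x u v w := by
  have hv := msec_ext v
  have hw := msec_ext w
  have hl := nabla_isLinearMap (h.msec hv hw)
  refine ⟨fun u u' => ?_, fun c u => ?_⟩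
  · simp only [nabla2, hl.map_add, nabla_vadd hv, nabla_vadd hw, h.add_left, h.add_right]
    abel
  · simp only [nabla2, hl.map_smul, nabla_vsmul hv, nabla_vsmul hw, h.smul_left, h.smul_right]
    module

lemma Tens2.nabla2_lin₂ (h : Tens2 α x) (u w : TangentSpace (𝓡 n) x) :
    IsLinearMap ℝ fun v => nabla2 α x u v w := by
  have h1 (v) : nabla2 α x u v w = KEDeform.nabla1 (fun y Y => α y Y (ext w y)) x u v
      - α x v (nabla (ext w) x u) := by
    rw [h.nabla1_right (Smt.ext w), ext_self]; abel
  have h2 := (h.right (Smt.ext w)).nabla1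
  refine ⟨fun u u' => ?_, fun c u => ?_⟩
  · simp only [h1, h2.add_right, h.add_left]
    abel
  · simp only [h1, h2.smul_right, h.smul_left]
    module

lemma Tens2.nabla2_lin₃ (h : Tens2 α x) (u v : TangentSpace (𝓡 n) x) :
    IsLinearMap ℝ fun w => nabla2 α x u v w := by
  have h1 (w) : nabla2 α x u v w = KEDeform.nabla1 (fun y Z => α y (ext v y) Z) x u w
      - α x (nabla (ext v) x u) w := by
    rw [h.nabla1_left (Smt.ext v), ext_self]; abel
  have h2 := (h.left (Smt.ext v)).nabla1
  refine ⟨fun u u' => ?_, fun c u => ?_⟩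
  · simp only [h1, h2.add_right, h.add_right]
    abel
  · simp only [h1, h2.smul_right, h.smul_right]
    module

lemma Tens2.nabla2_smt (h : Tens2 α x) (hX : Smt X x) (hY : Smt Y x) (hZ : Smt Z x) :
    Smt (fun y => nabla2 α y (X y) (Y y) (Z y)) x := by
  refine Smt.congr ((((h.at.smt _ _ hY hZ).nabla hX).sub (h.at.smt _ _ (hY.nabla hX) hZ)).sub
    (h.at.smt _ _ hY (hZ.nabla hX))) ?_
  filter_upwards [h.eventually, hY.eventually, hZ.eventually] with y h hY hZ
  exact h.nabla2_eq hY.msec hZ.msec _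

lemma Tens2.nabla2_tens12 (h : Tens2 α x) (hZ : Smt Z x) :
    Tens2 (fun y X Y => nabla2 α y X Y (Z y)) x := by
  filter_upwards [h.eventually, hZ.eventually] with y h hZ
  exact ⟨fun Y => h.nabla2_lin₁ _ _, fun X => h.nabla2_lin₂ _ _,
    fun X Y hX hY => h.nabla2_smt hX hY hZ⟩

end nabla

section rules

variable {A B : Tensor1 n M} {α β : Tensor2 n M} {x : M} (u v w : TangentSpace (𝓡 n) x)

lemma nabla1_comp (hA : Tens1 A x) (hB : Tens1 B x) :
    nabla1 (comp A B) x v w = nabla1 A x v (B x w) + A x (nabla1 B x v w) := by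
  have hw := msec_ext w
  have h1 := (hA.comp hB).nabla1_eq hw v
  have h2 := hA.nabla_apply (hB.msec hw) v
  have h3 := hB.nabla_apply hw v
  simp only [ext_self] at h1 h2 h3
  rw [h1]
  simp only [comp, h2, h3, hA.add_apply]
  abel

lemma nabla1_add (hA : Tens1 A x) (hB : Tens1 B x) :
    nabla1 (fun y X => A y X + B y X) x v w = nabla1 A x v w + nabla1 B x v w := by
  have hw := msec_ext w
  simp only [nabla1, nabla_add' (hA.msec hw) (hB.msec hw)]
  abel

lemma nabla2_flip : nabla2 (fun y X Y => α y Y X) x u v w = nabla2 α x u w v := by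
  simp only [nabla2]
  abel

lemma nabla2_add (hα : Tens2 α x) (hβ : Tens2 β x) :
    nabla2 (fun y X Y => α y X Y + β y X Y) x u v w = nabla2 α x u v w + nabla2 β x u v w := by
  simp only [nabla2, nabla_add' (hα.msec (msec_ext v) (msec_ext w))
    (hβ.msec (msec_ext v) (msec_ext w))]
  abel

lemma nabla2_smul (c : ℝ) (hα : Tens2 α x) :
    nabla2 (fun y X Y => c • α y X Y) x u v w = c • nabla2 α x u v w := by
  simp only [nabla2, nabla_const_smul _ (hα.msec (msec_ext v) (msec_ext w))]
  module

lemma nabla2_sub (hα : Tens2 α x) (hβ : Tens2 β x) :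
    nabla2 (fun y X Y => α y X Y - β y X Y) x u v w = nabla2 α x u v w - nabla2 β x u v w := by
  simp only [nabla2, nabla_sub (hα.msec (msec_ext v) (msec_ext w))
    (hβ.msec (msec_ext v) (msec_ext w))]
  abel

lemma nabla2_comp_left (hα : Tens2 α x) (hA : Tens1 A x) :
    nabla2 (fun y X Y => α y (A y X) Y) x u v w
      = nabla2 α x u (A x v) w + α x (nabla1 A x u v) w := by
  have hv := msec_ext v
  have h2 := hα.nabla_apply (hA.msec hv) (msec_ext w) u
  have h3 := hA.nabla_apply hv u
  simp only [ext_self] at h2 h3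
  simp only [nabla2] at h2 ⊢
  rw [h2, h3, hα.add_left]
  abel

lemma nabla2_comp_right (hα : Tens2 α x) (hA : Tens1 A x) :
    nabla2 (fun y X Y => α y X (A y Y)) x u v w
      = nabla2 α x u v (A x w) + α x v (nabla1 A x u w) := by
  have := nabla2_comp_left u w v hα.flip hA
  rw [nabla2_flip u (A x w) v] at this
  rw [← this]
  exact (nabla2_flip (α := fun y X Y => α y X (A y Y)) u w v).symm

lemma nabla2_comp_out (hα : Tens2 α x) (hA : Tens1 A x) :
    nabla2 (fun y X Y => A y (α y X Y)) x u v w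
      = A x (nabla2 α x u v w) + nabla1 A x u (α x v w) := by
  have h2 := hA.nabla_apply (hα.msec (msec_ext v) (msec_ext w)) u
  simp only [ext_self] at h2
  simp only [nabla2]
  rw [h2, hA.sub_apply, hA.sub_apply]
  abel

end rules

/-! ### Traces over orthonormal frames and their derivatives -/

section frame_sums

variable {A B : Tensor1 n M} {α β : Tensor2 n M} {ξ X Y Z : VecField n M} {x : M}

lemma _root_.OrthonormalBasis.sum_isBilinearMap_eq {V W ι κ : Type*} [NormedAddCommGroup V]
    [InnerProductSpace ℝ V] [AddCommGroup W] [Module ℝ W] [Fintype ι] [Fintype κ]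
    (b : OrthonormalBasis ι ℝ V) (c : OrthonormalBasis κ ℝ V) {T : V → V → W}
    (hT : IsBilinearMap ℝ T) :
    ∑ i, T (b i) (b i) = ∑ j, T (c j) (c j) :=
  b.sum_bilin_eq c hT.toLinearMap

lemma IsONFrame.sum_eq {e : Fin n → VecField n M} (he : IsONFrame e x) {W : Type*}
    [AddCommGroup W] [Module ℝ W] {T : TangentSpace (𝓡 n) x → TangentSpace (𝓡 n) x → W}
    (hT : IsBilinearMap ℝ T) :
    ∑ i, T (frame x i) (frame x i) = ∑ i, T (e i x) (e i x) := by
  simpa using (frame x).sum_isBilinearMap_eq he.basis hT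

lemma mvfderiv_add' {f g : M → ℝ} (hf : MDifferentiableAt (𝓡 n) 𝓘(ℝ, ℝ) f x)
    (hg : MDifferentiableAt (𝓡 n) 𝓘(ℝ, ℝ) g x) (v : TangentSpace (𝓡 n) x) :
    mvfderiv (𝓡 n) (fun y => f y + g y) x v = mvfderiv (𝓡 n) f x v + mvfderiv (𝓡 n) g x v := by
  have := mvfderiv_add hf hg
  exact DFunLike.congr_fun this v

lemma mvfderiv_mul' {f g : M → ℝ} (hf : MDifferentiableAt (𝓡 n) 𝓘(ℝ, ℝ) f x)
    (hg : MDifferentiableAt (𝓡 n) 𝓘(ℝ, ℝ) g x) (v : TangentSpace (𝓡 n) x) :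
    mvfderiv (𝓡 n) (fun y => f y * g y) x v
      = f x * mvfderiv (𝓡 n) g x v + mvfderiv (𝓡 n) f x v * g x := by
  have := mvfderiv_mul hf hg
  have := DFunLike.congr_fun this v
  simp only [add_apply, smul_apply, smul_eq_mul] at this
  rw [mul_comm _ (g x)]
  exact this

lemma mdifferentiableAt_sum {ι : Type*} {s : Finset ι} {f : ι → M → ℝ}
    (h : ∀ i ∈ s, MDifferentiableAt (𝓡 n) 𝓘(ℝ, ℝ) (f i) x) :
    MDifferentiableAt (𝓡 n) 𝓘(ℝ, ℝ) (fun y => ∑ i ∈ s, f i y) x := by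
  classical
  induction s using Finset.induction_on with
  | empty => simpa using mdifferentiableAt_const
  | insert a s ha ih =>
    simp only [Finset.mem_insert, forall_eq_or_imp] at h
    simp only [Finset.sum_insert ha]
    exact h.1.add (ih h.2)

lemma mvfderiv_sum {ι : Type*} {s : Finset ι} {f : ι → M → ℝ}
    (h : ∀ i ∈ s, MDifferentiableAt (𝓡 n) 𝓘(ℝ, ℝ) (f i) x) (v : TangentSpace (𝓡 n) x) :
    mvfderiv (𝓡 n) (fun y => ∑ i ∈ s, f i y) x v = ∑ i ∈ s, mvfderiv (𝓡 n) (f i) x v := by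
  classical
  induction s using Finset.induction_on with
  | empty => simp [mvfderiv_const]
  | insert a s ha ih =>
    simp only [Finset.mem_insert, forall_eq_or_imp] at h
    simp only [Finset.sum_insert ha, ← ih h.2]
    exact mvfderiv_add' h.1 (mdifferentiableAt_sum h.2) v

lemma IsONFrame.inner_nabla_skew {e : Fin n → VecField n M} (he : IsONFrame e x) (i j : Fin n)
    (v : TangentSpace (𝓡 n) x) :
    (inner ℝ (nabla (e i) x v) (e j x) : ℝ) = - inner ℝ (e i x) (nabla (e j) x v) := by
  have h := mvfderiv_inner (he.smt i).msec (he.smt j).msec v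
  have h2 : ∀ᶠ y in 𝓝 x, (inner ℝ (e i y) (e j y) : ℝ) = if i = j then 1 else 0 := by
    filter_upwards [he.orthonormal] with y hy using orthonormal_iff_ite.1 hy i j
  rw [mvfderiv_congr h2, mvfderiv_const] at h
  simp only [zero_apply] at h
  linarith

/-- The coefficients $\langle e_j,\nabla_ve_i\rangle$ are skew in $i,j$, while they multiply the
symmetric expression $T(e_j,e_i)+T(e_i,e_j)$. -/
lemma IsONFrame.sum_nabla {e : Fin n → VecField n M} (he : IsONFrame e x) {W : Type*}
    [AddCommGroup W] [Module ℝ W] {T : TangentSpace (𝓡 n) x → TangentSpace (𝓡 n) x → W}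
    (hT : IsBilinearMap ℝ T) (v : TangentSpace (𝓡 n) x) :
    ∑ i, (T (nabla (e i) x v) (e i x) + T (e i x) (nabla (e i) x v)) = 0 := by
  have h (i) : nabla (e i) x v = ∑ j, (inner ℝ (e j x) (nabla (e i) x v) : ℝ) • e j x :=
    (he.sum_inner_smul _).symm
  have h1 (i) : T (nabla (e i) x v) (e i x) =
      ∑ j, (inner ℝ (e j x) (nabla (e i) x v) : ℝ) • T (e j x) (e i x) := by
    conv_lhs => rw [h i]
    change hT.toLinearMap _ _ = _
    simp only [map_sum, map_smul, LinearMap.sum_apply, LinearMap.smul_apply]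
    rfl
  have h2 (i) : T (e i x) (nabla (e i) x v) =
      ∑ j, (inner ℝ (e j x) (nabla (e i) x v) : ℝ) • T (e i x) (e j x) := by
    conv_lhs => rw [h i]
    change hT.toLinearMap _ _ = _
    simp only [map_sum, map_smul]
    rfl
  simp only [h1, h2, Finset.sum_add_distrib]
  rw [Finset.sum_comm, ← Finset.sum_add_distrib]
  refine Finset.sum_eq_zero fun i _ => ?_
  rw [← Finset.sum_add_distrib]
  refine Finset.sum_eq_zero fun j _ => ?_
  have := he.inner_nabla_skew i j v
  rw [real_inner_comm (nabla (e i) x v), this, real_inner_comm (nabla (e j) x v)]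
  simp

lemma T2.isBilinearMap (h : T2 α x) : IsBilinearMap ℝ (α x) :=
  ⟨fun v w u => (h.lin₁ u).map_add v w, fun c v u => (h.lin₁ u).map_smul c v,
    fun u v w => (h.lin₂ u).map_add v w, fun c u v => (h.lin₂ u).map_smul c v⟩

lemma Tens2.isBilinearMap (h : Tens2 α x) : IsBilinearMap ℝ (α x) := h.at.isBilinearMap

lemma isBilinearMap_inner {V : Type*} [NormedAddCommGroup V] [InnerProductSpace ℝ V] {f g : V → V}
    (hf : IsLinearMap ℝ f) (hg : IsLinearMap ℝ g) :
    IsBilinearMap ℝ fun v w => (inner ℝ (f v) (g w) : ℝ) :=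
  ⟨fun v w u => by rw [hf.map_add, inner_add_left],
    fun c v u => by rw [hf.map_smul, inner_smul_left]; rfl,
    fun u v w => by rw [hg.map_add, inner_add_right],
    fun c u v => by rw [hg.map_smul, inner_smul_right]; rfl⟩

/-- `frame` need not depend continuously on the point. By bilinearity the trace equals the one over
a smooth frame near $x$. -/
lemma Tens2.sum_frame_smt (h : Tens2 α x) :
    Smt (fun y => ∑ i, α y (frame y i) (frame y i)) x := by
  obtain ⟨e, he⟩ := exists_isONFrame (n := n) x
  refine Smt.congr (Smt.sum (s := Finset.univ) fun i _ => h.at.smt _ _ (he.smt i) (he.smt i)) ?_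
  filter_upwards [h, he.eventually] with y h he using he.sum_eq h.isBilinearMap

/-- The trace of a tensor field commutes with covariant differentiation. -/
lemma Tens2.nabla_sum_frame (h : Tens2 α x) (v : TangentSpace (𝓡 n) x) :
    nabla (fun y => ∑ i, α y (frame y i) (frame y i)) x v
      = ∑ i, nabla2 α x v (frame x i) (frame x i) := by
  obtain ⟨e, he⟩ := exists_isONFrame (n := n) x
  have h1 : ∀ᶠ y in 𝓝 x, ∑ i, α y (frame y i) (frame y i) = ∑ i, α y (e i y) (e i y) := by
    filter_upwards [h, he.eventually] with y h he using he.sum_eq h.isBilinearMap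
  have h2 : IsBilinearMap ℝ (nabla2 α x v) :=
    ⟨fun u u' w => (h.nabla2_lin₂ v w).map_add u u', fun c u w => (h.nabla2_lin₂ v w).map_smul c u,
      fun u w w' => (h.nabla2_lin₃ v u).map_add w w', fun c u w => (h.nabla2_lin₃ v u).map_smul c w⟩
  rw [nabla_congr h1, nabla_sum fun i _ => h.msec (he.smt i).msec (he.smt i).msec, he.sum_eq h2]
  simp only [h.nabla_apply (he.smt _).msec (he.smt _).msec, add_assoc]
  rw [Finset.sum_add_distrib, he.sum_nabla h.isBilinearMap, add_zero]

lemma Tens1.sum_inner_smt (hA : Tens1 A x) (hB : Tens1 B x) :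
    SmtF n (fun y => ∑ i, (inner ℝ (A y (frame y i)) (B y (frame y i)) : ℝ)) x := by
  obtain ⟨e, he⟩ := exists_isONFrame (n := n) x
  refine SmtF.congr (SmtF.sum (s := Finset.univ) fun i _ =>
    (hA.at.smt _ (he.smt i)).inner (hB.at.smt _ (he.smt i))) ?_
  filter_upwards [hA, hB, he.eventually] with y hA hB he
    using he.sum_eq (isBilinearMap_inner hA.lin hB.lin)

lemma Tens1.mvfderiv_sum_inner (hA : Tens1 A x) (hB : Tens1 B x) (v : TangentSpace (𝓡 n) x) :
    mvfderiv (𝓡 n) (fun y => ∑ i, (inner ℝ (A y (frame y i)) (B y (frame y i)) : ℝ)) x v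
      = ∑ i, ((inner ℝ (KEDeform.nabla1 A x v (frame x i)) (B x (frame x i)) : ℝ)
        + inner ℝ (A x (frame x i)) (KEDeform.nabla1 B x v (frame x i))) := by
  obtain ⟨e, he⟩ := exists_isONFrame (n := n) x
  have h1 : ∀ᶠ y in 𝓝 x, ∑ i, (inner ℝ (A y (frame y i)) (B y (frame y i)) : ℝ)
      = ∑ i, (inner ℝ (A y (e i y)) (B y (e i y)) : ℝ) := by
    filter_upwards [hA, hB, he.eventually] with y hA hB he
      using he.sum_eq (isBilinearMap_inner hA.lin hB.lin)
  have hs (i) := (hA.at.smt _ (he.smt i)).inner (hB.at.smt _ (he.smt i))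
  have h2 := he.sum_eq (isBilinearMap_inner (hA.nabla1.at.lin₂ v) hB.at.lin)
  have h3 := he.sum_eq (isBilinearMap_inner hA.at.lin (hB.nabla1.at.lin₂ v))
  rw [mvfderiv_congr h1, mvfderiv_sum fun i _ => (hs i).mdiff, Finset.sum_add_distrib, h2, h3,
    ← Finset.sum_add_distrib]
  have h4 := he.sum_nabla (isBilinearMap_inner hA.at.lin hB.at.lin) v
  rw [← sub_eq_zero, ← h4, ← Finset.sum_sub_distrib]
  refine Finset.sum_congr rfl fun i _ => ?_
  rw [mvfderiv_inner (hA.msec (he.smt i).msec) (hB.msec (he.smt i).msec),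
    hA.nabla_apply (he.smt i).msec, hB.nabla_apply (he.smt i).msec, inner_add_left,
    inner_add_right]
  ring

end frame_sums

/-! ### Curvature: tensoriality, symmetries and the Ricci identity -/

section curvature

open VectorField

variable {A B : Tensor1 n M} {α β : Tensor2 n M} {ξ η X Y Z U V W : VecField n M} {x : M}
  {u v w z : TangentSpace (𝓡 n) x}

/-- The Hessian of a function is symmetric. -/
lemma hessian_symm {f : M → ℝ} (hf : SmtF n f x) (hU : Smt U x) (hV : Smt V x) :
    mvfderiv (𝓡 n) (fun y => mvfderiv (𝓡 n) f y (V y)) x (U x)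
        - mvfderiv (𝓡 n) f x (nabla V x (U x))
      = mvfderiv (𝓡 n) (fun y => mvfderiv (𝓡 n) f y (U y)) x (V x)
        - mvfderiv (𝓡 n) f x (nabla U x (V x)) := by
  have h1 := mvfderiv_mlieBracket hf hU hV
  rw [← nabla_sub_nabla hU.msec hV.msec, map_sub] at h1
  linarith

lemma nabla1_congr (h : ∀ᶠ y in 𝓝 x, A y = B y) : nabla1 A x v w = nabla1 B x v w := by
  simp only [nabla1, h.self_of_nhds]
  rw [nabla_congr (h.mono fun y hy => congr_fun hy _)]

lemma nabla_nabla_congr (h : ∀ᶠ y in 𝓝 x, ξ y = η y) :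
    nabla1 (nabla ξ) x v w = nabla1 (nabla η) x v w := by
  refine nabla1_congr ?_
  filter_upwards [h.eventually_nhds] with y hy
  ext1 u
  exact nabla_congr hy u

lemma nabla1_nabla_eq (hξ : Smt ξ x) (hV : Smt V x) (u : TangentSpace (𝓡 n) x) :
    nabla1 (nabla ξ) x u (V x)
      = nabla (fun y => nabla ξ y (V y)) x u - nabla ξ x (nabla V x u) :=
  hξ.tens1_nabla.nabla1_eq hV.msec u

/-- The antisymmetrised second derivative of a vector field. -/
def curv (ξ : VecField n M) (x : M) (u v : TangentSpace (𝓡 n) x) : TangentSpace (𝓡 n) x :=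
  nabla1 (nabla ξ) x v u - nabla1 (nabla ξ) x u v

/-- In $\nabla^2_{u,v}(f\xi)$ the Hessian of $f$ and the cross terms $df\otimes\nabla\xi$ are
symmetric in $u,v$, so antisymmetrising leaves only $f$ times the curvature. -/
lemma curv_smul {f : M → ℝ} (hf : SmtF n f x) (hξ : Smt ξ x) :
    curv (fun y => f y • ξ y) x u v = f x • curv ξ x u v := by
  have key (U V : VecField n M) (hU : Smt U x) (hV : Smt V x) :
      nabla1 (nabla (fun y => f y • ξ y)) x (U x) (V x) =
      (mvfderiv (𝓡 n) (fun y => mvfderiv (𝓡 n) f y (V y)) x (U x)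
        - mvfderiv (𝓡 n) f x (nabla V x (U x))) • ξ x
      + (mvfderiv (𝓡 n) f x (V x) • nabla ξ x (U x) + mvfderiv (𝓡 n) f x (U x) • nabla ξ x (V x))
      + f x • nabla1 (nabla ξ) x (U x) (V x) := by
    have h1 : ∀ᶠ y in 𝓝 x, nabla (fun y => f y • ξ y) y (V y) =
        mvfderiv (𝓡 n) f y (V y) • ξ y + f y • nabla ξ y (V y) := by
      filter_upwards [hf.eventually, hξ.eventually] with y hf hξ
      exact nabla_smul' hf.mdiff hξ.msec _
    rw [nabla1_nabla_eq (Smt.smul hf hξ) hV, nabla_congr h1, nabla1_nabla_eq hξ hV,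
      nabla_add' (Smt.smul (hV.mvfderiv hf) hξ).msec (Smt.smul hf (hξ.nabla hV)).msec,
      nabla_smul' (hV.mvfderiv hf).mdiff hξ.msec, nabla_smul' hf.mdiff (hξ.nabla hV).msec,
      nabla_smul' hf.mdiff hξ.msec]
    module
  have h1 := key (ext u) (ext v) (Smt.ext u) (Smt.ext v)
  have h2 := key (ext v) (ext u) (Smt.ext v) (Smt.ext u)
  have h3 := hessian_symm hf (Smt.ext u) (Smt.ext v)
  simp only [ext_self] at h1 h2 h3
  rw [curv, h1, h2, h3, curv]
  module

lemma curv_sum {ι : Type*} {s : Finset ι} {Y : ι → VecField n M} (h : ∀ i ∈ s, Smt (Y i) x) :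
    curv (fun y => ∑ i ∈ s, Y i y) x u v = ∑ i ∈ s, curv (Y i) x u v := by
  have key (u v : TangentSpace (𝓡 n) x) : nabla1 (nabla (fun y => ∑ i ∈ s, Y i y)) x u v =
      ∑ i ∈ s, nabla1 (nabla (Y i)) x u v := by
    have h1 : ∀ᶠ y in 𝓝 x, nabla (fun y => ∑ i ∈ s, Y i y) y (ext v y) =
        ∑ i ∈ s, nabla (Y i) y (ext v y) := by
      filter_upwards [(Filter.eventually_all_finset s).2 fun i hi => (h i hi).eventually] with y h
      exact nabla_sum (fun i hi => (h i hi).msec) _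
    rw [nabla1, nabla_congr h1, nabla_sum fun i hi => ((h i hi).nabla (Smt.ext v)).msec,
      nabla_sum fun i hi => (h i hi).msec, ← Finset.sum_sub_distrib]
    rfl
  simp only [curv, key, Finset.sum_sub_distrib]

/-- The curvature is tensorial in its last argument. -/
lemma curv_eq (hξ : Smt ξ x) : curv ξ x u v = curvature x u v (ξ x) := by
  obtain ⟨e, he⟩ := exists_isONFrame (n := n) x
  -- Expanding in a frame and using linearity over functions, only the coefficients of $\xi$ at $x$
  -- survive.
  have key (ξ : VecField n M) (hξ : Smt ξ x) : curv ξ x u v =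
      ∑ i, (inner ℝ (e i x) (ξ x) : ℝ) • curv (e i) x u v := by
    have h1 (i) : SmtF n (fun y => (inner ℝ (e i y) (ξ y) : ℝ)) x := (he.smt i).inner hξ
    rw [curv, nabla_nabla_congr (he.eventually_sum ξ), nabla_nabla_congr (he.eventually_sum ξ)]
    change curv _ x u v = _
    rw [curv_sum fun i _ => Smt.smul (h1 i) (he.smt i)]
    exact Finset.sum_congr rfl fun i _ => curv_smul (h1 i) (he.smt i)
  have h2 : curvature x u v (ξ x) = curv (ext (ξ x)) x u v := rfl
  rw [h2, key _ hξ, key _ (Smt.ext _), ext_self]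

lemma curvature_lin₃ (u v : TangentSpace (𝓡 n) x) : IsLinearMap ℝ (curvature x u v) := by
  refine ⟨fun w w' => ?_, fun c w => ?_⟩
  · have h1 := curv_eq (u := u) (v := v) ((Smt.ext w).add (Smt.ext w'))
    simp only [ext_self] at h1
    rw [← h1]
    have := curv_sum (u := u) (v := v) (s := Finset.univ) (Y := ![ext w, ext w'])
      fun i _ => by fin_cases i <;> exact Smt.ext _
    simp only [Fin.sum_univ_two] at this
    exact this
  · have h1 := curv_eq (u := u) (v := v) ((Smt.ext w).const_smul c)
    simp only [ext_self] at h1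
    rw [← h1, curv_smul (f := fun _ => c) (SmtF.const c) (Smt.ext w)]
    rfl

lemma curvature_lin₁ (v w : TangentSpace (𝓡 n) x) :
    IsLinearMap ℝ fun u => curvature x u v w := by
  have h := (Smt.ext w).tens1_nabla.nabla1
  refine ⟨fun u u' => ?_, fun c u => ?_⟩
  · simp only [curvature, h.add_left, h.add_right]; abel
  · simp only [curvature, h.smul_left, h.smul_right]; module

lemma curvature_antisymm (u v w : TangentSpace (𝓡 n) x) :
    curvature x u v w = -curvature x v u w := by
  simp only [curvature]; abel

lemma curvature_lin₂ (u w : TangentSpace (𝓡 n) x) :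
    IsLinearMap ℝ fun v => curvature x u v w := by
  have h := (Smt.ext w).tens1_nabla.nabla1
  refine ⟨fun u u' => ?_, fun c u => ?_⟩
  · simp only [curvature, h.add_left, h.add_right]; abel
  · simp only [curvature, h.smul_left, h.smul_right]; module

/-- The Ricci identity for endomorphism fields. -/
lemma Tens1.ricci_identity (h : Tens1 A x) (u v w : TangentSpace (𝓡 n) x) :
    nabla2 (KEDeform.nabla1 A) x u v w - nabla2 (KEDeform.nabla1 A) x v u w
      = A x (curvature x u v w) - curvature x u v (A x w) := by
  have hw := Smt.ext w
  -- The two middle terms are exchanged by swapping $u$ and $v$ and disappear from the difference.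
  have key (u v : TangentSpace (𝓡 n) x) :
      KEDeform.nabla1 (nabla fun y => A y (ext w y)) x u v
        = nabla2 (KEDeform.nabla1 A) x u v w + (KEDeform.nabla1 A x v (nabla (ext w) x u)
          + KEDeform.nabla1 A x u (nabla (ext w) x v))
          + A x (KEDeform.nabla1 (nabla (ext w)) x u v) := by
    have h1 : ∀ᶠ y in 𝓝 x, (nabla fun y => A y (ext w y)) y =
        fun X => KEDeform.nabla1 A y X (ext w y) + KEDeform.comp A (nabla (ext w)) y X := by
      filter_upwards [h.eventually, hw.eventually] with y h hw
      ext1 X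
      exact h.nabla_apply hw.msec X
    rw [nabla1_congr h1, nabla1_add _ _ (h.nabla1.right hw) (h.comp hw.tens1_nabla),
      h.nabla1.nabla1_right hw, nabla1_comp _ _ h hw.tens1_nabla, ext_self]
    abel
  have h2 := curv_eq (u := u) (v := v) (h.at.smt _ hw)
  rw [curv, key, key, ext_self] at h2
  rw [← h2, KEDeform.curvature, h.sub_apply]
  abel

/-- The Hessian of the function $\langle w,z\rangle$ is symmetric. By metric compatibility it is
$\langle\nabla^2w,z\rangle+\langle w,\nabla^2z\rangle$ plus terms symmetric in the two directions.
-/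
lemma curvature_skew (u v w z : TangentSpace (𝓡 n) x) :
    (inner ℝ (curvature x u v w) z : ℝ) = - inner ℝ w (curvature x u v z) := by
  have hw := Smt.ext w
  have hz := Smt.ext z
  have key (U V : VecField n M) (hU : Smt U x) (hV : Smt V x) :
      mvfderiv (𝓡 n) (fun y => mvfderiv (𝓡 n) (fun y => (inner ℝ (ext w y) (ext z y) : ℝ)) y (V y))
        x (U x) - mvfderiv (𝓡 n) (fun y => (inner ℝ (ext w y) (ext z y) : ℝ)) x (nabla V x (U x))
      = inner ℝ (nabla1 (nabla (ext w)) x (U x) (V x)) z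
        + inner ℝ w (nabla1 (nabla (ext z)) x (U x) (V x))
        + (inner ℝ (nabla (ext w) x (U x)) (nabla (ext z) x (V x))
          + inner ℝ (nabla (ext w) x (V x)) (nabla (ext z) x (U x))) := by
    have h1 : ∀ᶠ y in 𝓝 x, mvfderiv (𝓡 n) (fun y => (inner ℝ (ext w y) (ext z y) : ℝ)) y (V y)
        = inner ℝ (nabla (ext w) y (V y)) (ext z y) + inner ℝ (ext w y) (nabla (ext z) y (V y)) := by
      filter_upwards [hw.eventually, hz.eventually] with y hw hz
      exact mvfderiv_inner hw.msec hz.msec _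
    have s1 := hw.nabla hV
    have s2 := hz.nabla hV
    rw [mvfderiv_congr h1, mvfderiv_add' (s1.inner hz).mdiff (hw.inner s2).mdiff,
      mvfderiv_inner s1.msec hz.msec, mvfderiv_inner hw.msec s2.msec,
      mvfderiv_inner hw.msec hz.msec, nabla1_nabla_eq hw hV, nabla1_nabla_eq hz hV,
      inner_sub_left, inner_sub_right, ext_self, ext_self]
    ring
  have h3 := hessian_symm (hw.inner hz) (Smt.ext u) (Smt.ext v)
  rw [key _ _ (Smt.ext u) (Smt.ext v), key _ _ (Smt.ext v) (Smt.ext u)] at h3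
  simp only [ext_self] at h3
  simp only [curvature, inner_sub_left, inner_sub_right]
  linarith

/-- The first Bianchi identity. -/
lemma curvature_bianchi (u v w : TangentSpace (𝓡 n) x) :
    curvature x u v w + curvature x v w u + curvature x w u v = 0 := by
  have : IsManifold (𝓡 n) (minSmoothness ℝ 3) M := isManifold_minSmoothness (m := 3)
  have two : minSmoothness ℝ 2 ≤ (∞ : ℕ∞ω) := by
    simpa using WithTop.coe_le_coe.2 (le_top (a := (2 : ℕ∞)))
  have hu := Smt.ext u
  have hv := Smt.ext v
  have hw := Smt.ext w
  -- Torsion-freeness expresses iterated brackets by second covariant derivatives. The Jacobi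
  -- identity then becomes the Bianchi identity.
  have key (u v w : TangentSpace (𝓡 n) x) : mlieBracket (𝓡 n) (ext u) (mlieBracket (𝓡 n) (ext v) (ext w)) x
      = nabla1 (nabla (ext w)) x u v - nabla1 (nabla (ext v)) x u w
        + (nabla (ext w) x (nabla (ext v) x u) - nabla (ext v) x (nabla (ext w) x u))
        - nabla (ext u) x (mlieBracket (𝓡 n) (ext v) (ext w) x) := by
    have hu := Smt.ext u
    have hv := Smt.ext v
    have hw := Smt.ext w
    have h1 : ∀ᶠ y in 𝓝 x, mlieBracket (𝓡 n) (ext v) (ext w) y =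
        nabla (ext w) y (ext v y) - nabla (ext v) y (ext w y) := by
      filter_upwards [hv.eventually, hw.eventually] with y hv hw
      exact (nabla_sub_nabla hv.msec hw.msec).symm
    rw [← nabla_sub_nabla hu.msec (hv.lie hw).msec, nabla_congr h1,
      nabla_sub (hw.nabla hv).msec (hv.nabla hw).msec, nabla1, nabla1, ext_self]
    abel
  have h2 := leibniz_identity_mlieBracket_apply (I := 𝓡 n) (hu.csec.of_le two) (hv.csec.of_le two)
    (hw.csec.of_le two)
  rw [mlieBracket_swap_apply (V := mlieBracket (𝓡 n) (ext u) (ext v)), key u v w, key w u v,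
    key v u w] at h2
  have e (u v w : TangentSpace (𝓡 n) x) : nabla (ext u) x (mlieBracket (𝓡 n) (ext v) (ext w) x)
      = nabla (ext u) x (nabla (ext w) x v) - nabla (ext u) x (nabla (ext v) x w) := by
    have h := nabla_isLinearMap (msec_ext u)
    rw [← nabla_sub_nabla (msec_ext v) (msec_ext w), h.map_sub, ext_self, ext_self]
  rw [e, e, e] at h2
  simp only [curvature]
  rw [← sub_eq_zero] at h2
  rw [← neg_eq_zero, ← h2]
  abel

/-- The octahedron argument: four Bianchi identities combined with the two skew-symmetries. -/
lemma curvature_pair_symm (u v w z : TangentSpace (𝓡 n) x) :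
    (inner ℝ (curvature x u v w) z : ℝ) = inner ℝ (curvature x w z u) v := by
  have b (u v w z : TangentSpace (𝓡 n) x) : (inner ℝ (curvature x u v w) z : ℝ)
      + inner ℝ (curvature x v w u) z + inner ℝ (curvature x w u v) z = 0 := by
    rw [← inner_add_left, ← inner_add_left, curvature_bianchi, inner_zero_left]
  have s (u v w z : TangentSpace (𝓡 n) x) : (inner ℝ (curvature x u v w) z : ℝ)
      = - inner ℝ (curvature x u v z) w := by
    rw [curvature_skew, real_inner_comm]
  have a (u v w z : TangentSpace (𝓡 n) x) : (inner ℝ (curvature x u v w) z : ℝ)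
      = - inner ℝ (curvature x v u w) z := by
    rw [curvature_antisymm, inner_neg_left]
  have b1 := b u v w z
  have b2 := b v w z u
  have b3 := b w z u v
  have b4 := b z u v w
  linarith [s u v w z, s v w u z, s w u v z, s v w z u, s w z v u, s z v w u, s w z u v, s z u w v,
    s u w z v, s z u v w, s u v z w, s v z u w, a u v w z, a v w u z, a w u v z, a z v w u,
    a u w z v, a v z u w, a w z u v, a z u v w]

/-- The Ricci identity with vanishing left-hand side. -/
lemma curvature_parallel (h : Tens1 A x) (h0 : ∀ (y : M) (X Y), KEDeform.nabla1 A y X Y = 0)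
    (u v w : TangentSpace (𝓡 n) x) : curvature x u v (A x w) = A x (curvature x u v w) := by
  have h1 : KEDeform.nabla1 A = fun _ _ _ => 0 := by
    ext1 y; ext1 X; ext1 Y; exact h0 y X Y
  have h2 := h.ricci_identity u v w
  have h3 (u v w : TangentSpace (𝓡 n) x) : nabla2 (KEDeform.nabla1 A) x u v w = 0 := by
    rw [h1, nabla2, nabla_zero]; simp
  rw [h3, h3, sub_zero] at h2
  exact (sub_eq_zero.1 h2.symm).symm

end curvature

/-! ### Coordinate vector fields -/

section coordinates

open VectorField

variable {p x : M}

local notation "𝔼" => EuclideanSpace ℝ (Fin n)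

/-- The coordinate functions of the chart at `p`. -/
def coordFun (p : M) (i : Fin n) (y : M) : ℝ := chartAt 𝔼 p y i

/-- The coordinate vector fields of the chart at `p`. -/
def coordField (p : M) (i : Fin n) : VecField n M := fun y =>
  mfderiv (𝓡 n) (𝓡 n) (chartAt 𝔼 p).symm (chartAt 𝔼 p y) (EuclideanSpace.single i (1 : ℝ))

lemma chart_mdifferentiable (p : M) :
    (chartAt 𝔼 p).MDifferentiable (𝓡 n) (𝓡 n) := by
  have : IsManifold (𝓡 n) 1 M := IsManifold.of_le (n := ∞) (by simp)
  exact mdifferentiable_chart p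

lemma chart_contMDiffAt (hx : x ∈ (chartAt 𝔼 p).source) :
    ContMDiffAt (𝓡 n) (𝓡 n) ∞ (chartAt 𝔼 p) x :=
  (contMDiffOn_chart (I := 𝓡 n) (n := ∞) (x := p)).contMDiffAt
    ((chartAt 𝔼 p).open_source.mem_nhds hx)

lemma chart_symm_contMDiffAt {y : 𝔼} (hy : y ∈ (chartAt 𝔼 p).target) :
    ContMDiffAt (𝓡 n) (𝓡 n) ∞ (chartAt 𝔼 p).symm y :=
  (contMDiffOn_chart_symm (I := 𝓡 n) (n := ∞) (x := p)).contMDiffAt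
    ((chartAt 𝔼 p).open_target.mem_nhds hy)

/-- The differential of the chart at `p`. -/
def dchart (p x : M) : TangentSpace (𝓡 n) x →L[ℝ] 𝔼 := mfderiv (𝓡 n) (𝓡 n) (chartAt 𝔼 p) x

/-- The differential of the inverse of the chart at `p`. -/
def dchartSymm (p x : M) : 𝔼 →L[ℝ] TangentSpace (𝓡 n) x :=
  mfderiv (𝓡 n) (𝓡 n) (chartAt 𝔼 p).symm (chartAt 𝔼 p x)

lemma coordField_eq (p x : M) (i : Fin n) :
    coordField p i x = dchartSymm p x (EuclideanSpace.single i (1 : ℝ)) := rfl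

lemma dchartSymm_dchart (hx : x ∈ (chartAt 𝔼 p).source) (v : TangentSpace (𝓡 n) x) :
    dchartSymm p x (dchart p x v) = v := by
  have := (chart_mdifferentiable p).symm_comp_deriv hx
  exact DFunLike.congr_fun this v

lemma dchart_dchartSymm (hx : x ∈ (chartAt 𝔼 p).source) (v : 𝔼) :
    dchart p x (dchartSymm p x v) = v := by
  have := (chart_mdifferentiable p).comp_symm_deriv ((chartAt 𝔼 p).map_source hx)
  rw [(chartAt 𝔼 p).left_inv hx] at this
  exact DFunLike.congr_fun this v

/-- Constant vector fields on Euclidean space. -/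
def constField (v : 𝔼) : VecField n 𝔼 := fun _ => v

/-- As pullbacks of constant fields, the coordinate fields inherit smoothness and vanishing Lie
brackets from Euclidean space. -/
lemma coordField_eq_mpullback (hx : x ∈ (chartAt 𝔼 p).source) (i : Fin n) :
    coordField p i x = mpullback (𝓡 n) (𝓡 n) (chartAt 𝔼 p)
      (constField (EuclideanSpace.single i (1 : ℝ))) x := by
  change _ = (mfderiv (𝓡 n) (𝓡 n) (chartAt 𝔼 p) x).inverse (EuclideanSpace.single i (1 : ℝ))
  have : mfderiv (𝓡 n) (𝓡 n) (chartAt 𝔼 p) x = ((chart_mdifferentiable p).mfderiv hx : _ →L[ℝ] _) := rfl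
  rw [this, ContinuousLinearMap.inverse_equiv]
  rfl

lemma eventually_coordField_eq (hx : x ∈ (chartAt 𝔼 p).source) (i : Fin n) :
    ∀ᶠ y in 𝓝 x, coordField p i y = mpullback (𝓡 n) (𝓡 n) (chartAt 𝔼 p)
      (constField (EuclideanSpace.single i (1 : ℝ))) y := by
  filter_upwards [(chartAt 𝔼 p).open_source.mem_nhds hx] with y hy using coordField_eq_mpullback hy i

lemma constField_cSec (v : 𝔼) (x : 𝔼) : CSec ∞ (constField v) x := by
  refine (contMDiffAt_section (F := 𝔼) (E := fun y : 𝔼 => TangentSpace (𝓡 n) y) (IB := 𝓡 n)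
    (s := constField v) x).2 ?_
  simp only [trivializationAt_model_space_apply]
  exact contMDiffAt_const

lemma mpullback_cSec {f : M → 𝔼} {V : VecField n 𝔼} (hV : CSec ∞ V (f x))
    (hf : ContMDiffAt (𝓡 n) (𝓡 n) ∞ f x) (hf' : (mfderiv (𝓡 n) (𝓡 n) f x).IsInvertible) :
    CSec ∞ (mpullback (𝓡 n) (𝓡 n) f V) x := by
  have := ContMDiffWithinAt.mpullback_vectorField_preimage (t := Set.univ) hV.contMDiffWithinAt hf hf'
    (by simp)
  rw [Set.preimage_univ, contMDiffWithinAt_univ] at this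
  exact this

lemma coordField_smt (hx : x ∈ (chartAt 𝔼 p).source) (i : Fin n) : Smt (coordField p i) x := by
  have h : ∀ᶠ y in 𝓝 x, y ∈ (chartAt 𝔼 p).source := (chartAt 𝔼 p).open_source.mem_nhds hx
  filter_upwards [h] with y hy
  have h2 : CSec ∞ (mpullback (𝓡 n) (𝓡 n) (chartAt 𝔼 p)
      (constField (EuclideanSpace.single i (1 : ℝ)))) y := by
    refine mpullback_cSec (constField_cSec _ _) (chart_contMDiffAt hy) ?_
    exact ⟨(chart_mdifferentiable p).mfderiv hy, rfl⟩
  refine h2.congr_of_eventuallyEq ?_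
  filter_upwards [eventually_coordField_eq hy i] with z hz
  rw [hz]

lemma coordField_lie (hx : x ∈ (chartAt 𝔼 p).source) (i j : Fin n) :
    mlieBracket (𝓡 n) (coordField p i) (coordField p j) x = 0 := by
  have : IsManifold (𝓡 n) (minSmoothness ℝ 2) M := isManifold_minSmoothness (m := 2)
  have h1 := Filter.EventuallyEq.mlieBracket_vectorField_eq (I := 𝓡 n)
    (eventually_coordField_eq hx i) (eventually_coordField_eq hx j)
  have two : minSmoothness ℝ 2 ≤ (∞ : ℕ∞ω) := by
    simpa using WithTop.coe_le_coe.2 (le_top (a := (2 : ℕ∞)))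
  have h2 := mpullback_mlieBracket (I := 𝓡 n) (I' := 𝓡 n) (n := ∞)
    ((constField_cSec (EuclideanSpace.single i (1 : ℝ)) (chartAt 𝔼 p x)).mdifferentiableAt (by simp))
    ((constField_cSec (EuclideanSpace.single j (1 : ℝ)) (chartAt 𝔼 p x)).mdifferentiableAt (by simp))
    (chart_contMDiffAt hx) two
  rw [h1, ← h2, mpullback_apply]
  have h3 (v w : 𝔼) : mlieBracket (𝓡 n) (constField v) (constField w) = 0 := by
    rw [← mlieBracketWithin_univ, mlieBracketWithin_eq_lieBracketWithin]
    ext1 y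
    have : lieBracketWithin ℝ (fun _ : 𝔼 => v) (fun _ => w) Set.univ y = 0 := by
      simp [lieBracketWithin]
    exact this
  rw [h3, Pi.zero_apply, map_zero]

lemma coordFun_smtF (hx : x ∈ (chartAt 𝔼 p).source) (i : Fin n) : SmtF n (coordFun p i) x := by
  have h : ∀ᶠ y in 𝓝 x, y ∈ (chartAt 𝔼 p).source := (chartAt 𝔼 p).open_source.mem_nhds hx
  filter_upwards [h] with y hy
  exact (((EuclideanSpace.proj i : 𝔼 →L[ℝ] ℝ).contDiff (n := ∞)).contMDiff (n := ∞)).contMDiffAt.comp y (chart_contMDiffAt hy)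

lemma mvfderiv_coordFun (hx : x ∈ (chartAt 𝔼 p).source) (i : Fin n) (v : TangentSpace (𝓡 n) x) :
    mvfderiv (𝓡 n) (coordFun p i) x v =
      dchart p x v i := by
  have h1 := (chart_contMDiffAt hx).mdifferentiableAt (by simp)
  have h2 := (EuclideanSpace.proj i : 𝔼 →L[ℝ] ℝ).hasMFDerivAt (x := chartAt 𝔼 p x)
  have h3 := (h2.comp x h1.hasMFDerivAt).mfderiv
  change mfderiv (𝓡 n) 𝓘(ℝ, ℝ) (coordFun p i) x = _ at h3
  have : mvfderiv (𝓡 n) (coordFun p i) x v = mfderiv (𝓡 n) 𝓘(ℝ, ℝ) (coordFun p i) x v := rfl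
  rw [this, h3]
  rfl

lemma sum_coordField (hx : x ∈ (chartAt 𝔼 p).source) (v : TangentSpace (𝓡 n) x) :
    ∑ i, mvfderiv (𝓡 n) (coordFun p i) x v • coordField p i x = v := by
  conv_rhs => rw [← dchartSymm_dchart hx v]
  simp only [mvfderiv_coordFun hx, coordField_eq]
  simp only [← map_smul, ← map_sum]
  congr 1
  generalize dchart p x v = w
  ext j
  simp [Pi.single_apply]

lemma mvfderiv_coordFun_coordField (hx : x ∈ (chartAt 𝔼 p).source) (i j : Fin n) :
    mvfderiv (𝓡 n) (coordFun p i) x (coordField p j x) = if i = j then 1 else 0 := by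
  rw [mvfderiv_coordFun hx, coordField_eq, dchart_dchartSymm hx]
  simp

lemma mvfderiv_coordField {f : M → ℝ} (hx : x ∈ (chartAt 𝔼 p).source)
    (hf : MDifferentiableAt (𝓡 n) 𝓘(ℝ, ℝ) f x) (i : Fin n) :
    mvfderiv (𝓡 n) f x (coordField p i x) =
      fderiv ℝ (fun y => f ((chartAt 𝔼 p).symm y)) (chartAt 𝔼 p x) (EuclideanSpace.single i 1) := by
  have h1 := (chart_symm_contMDiffAt ((chartAt 𝔼 p).map_source hx)).mdifferentiableAt (by simp)
  have h0 : x = (chartAt 𝔼 p).symm (chartAt 𝔼 p x) := ((chartAt 𝔼 p).left_inv hx).symm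
  have h2 := mfderiv_comp_of_eq (x := chartAt 𝔼 p x) hf h1 h0.symm
  rw [mfderiv_eq_fderiv] at h2
  have : mvfderiv (𝓡 n) f x (coordField p i x) = mfderiv (𝓡 n) 𝓘(ℝ, ℝ) f x (coordField p i x) := rfl
  rw [this]
  rw [(chartAt 𝔼 p).left_inv hx] at h2
  exact (DFunLike.congr_fun h2 (EuclideanSpace.single i 1)).symm

end coordinates

/-- Jacobi's formula for the derivative of a determinant. -/
lemma _root_.HasFDerivAt.matrix_det {V ι : Type*} [NormedAddCommGroup V] [NormedSpace ℝ V] [Fintype ι]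
    [DecidableEq ι] {A : V → Matrix ι ι ℝ} {A' : ι → ι → V →L[ℝ] ℝ} {y : V}
    (h : ∀ i j, HasFDerivAt (fun z => A z i j) (A' i j) y) :
    HasFDerivAt (fun z => (A z).det) (∑ i, ∑ j, (A y).adjugate j i • A' i j) y := by
  have h1 : HasFDerivAt (fun z => (A z : ι → ι → ℝ)) (ContinuousLinearMap.pi fun i =>
      ContinuousLinearMap.pi fun j => A' i j) y :=
    hasFDerivAt_pi.2 fun i => hasFDerivAt_pi.2 fun j => h i j
  let D : ContinuousMultilinearMap ℝ (fun _ : ι => ι → ℝ) ℝ :=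
    { (Matrix.detRowAlternating : (ι → ℝ) [⋀^ι]→ₗ[ℝ] ℝ).toMultilinearMap with
      cont := by
        change Continuous fun z : ι → ι → ℝ => Matrix.det z
        exact Continuous.matrix_det continuous_id }
  have h2 := (D.hasFDerivAt (A y)).comp y h1
  refine HasFDerivAt.congr_fderiv h2 ?_
  ext v
  simp only [ContinuousLinearMap.comp_apply, sum_apply, smul_apply, smul_eq_mul]
  refine (ContinuousMultilinearMap.linearDeriv_apply D (fun i => A y i) fun i j => A' i j v).trans ?_
  refine Finset.sum_congr rfl fun i _ => ?_
  change ((A y).updateRow i (fun j => A' i j v)).det = _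
  rw [← Matrix.cramer_transpose_apply, Matrix.cramer_eq_adjugate_mulVec, ← Matrix.adjugate_transpose]
  simp [Matrix.mulVec, dotProduct]

lemma _root_.LinearIndependent.det_inner_pos {V ι : Type*} [NormedAddCommGroup V]
    [InnerProductSpace ℝ V] [Fintype ι] [DecidableEq ι] {b : ι → V} (hb : LinearIndependent ℝ b) :
    0 < (Matrix.of fun i j => (inner ℝ (b i) (b j) : ℝ)).det :=
  (Matrix.posDef_gram_of_linearIndependent hb).det_pos

/-! ### The volume density and the divergence in coordinates -/

section gram

variable {p x : M}

local notation "𝔼" => EuclideanSpace ℝ (Fin n)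

variable (n) in
/-- The Gram matrix of the coordinate fields. -/
def gramMat (p x : M) : Matrix (Fin n) (Fin n) ℝ :=
  Matrix.of fun i j => inner ℝ (coordField p i x) (coordField p j x)

variable (n) in
/-- The density of the Riemannian volume in the chart at `p`. -/
def volDensity (p x : M) : ℝ := √(gramMat n p x).det

lemma gramDet_eq {y : 𝔼} (hy : y ∈ (chartAt 𝔼 p).target) :
    gramDet p y = (gramMat n p ((chartAt 𝔼 p).symm y)).det := by
  have h := (chartAt 𝔼 p).right_inv hy
  -- The two sides differentiate the inverse chart at $y$ and at $\varphi(\varphi^{-1}(y))$. The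
  -- equation is generalised to a variable point so that it can be substituted inside the dependent
  -- types.
  have key (z : 𝔼) (hz : z = y) (v w : 𝔼) :
      (inner ℝ (show TangentSpace (𝓡 n) ((chartAt 𝔼 p).symm y) from
          mfderiv (𝓡 n) (𝓡 n) (chartAt 𝔼 p).symm z v)
        (show TangentSpace (𝓡 n) ((chartAt 𝔼 p).symm y) from
          mfderiv (𝓡 n) (𝓡 n) (chartAt 𝔼 p).symm z w) : ℝ) =
      inner ℝ (mfderiv (𝓡 n) (𝓡 n) (chartAt 𝔼 p).symm y v)
        (mfderiv (𝓡 n) (𝓡 n) (chartAt 𝔼 p).symm y w) := by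
    subst hz; rfl
  rw [gramDet, gramMat]
  congr 1
  ext i j
  exact (key _ h _ _).symm

lemma coordField_linearIndependent (hx : x ∈ (chartAt 𝔼 p).source) :
    LinearIndependent ℝ fun i : Fin n => coordField p i x := by
  rw [Fintype.linearIndependent_iff]
  intro g hg i
  have := congrArg (mvfderiv (𝓡 n) (coordFun p i) x) hg
  simpa [mvfderiv_coordFun_coordField hx] using this

lemma gramMat_det_pos (hx : x ∈ (chartAt 𝔼 p).source) : 0 < (gramMat n p x).det :=
  (coordField_linearIndependent hx).det_inner_pos

lemma volDensity_pos (hx : x ∈ (chartAt 𝔼 p).source) : 0 < volDensity n p x :=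
  Real.sqrt_pos.2 (gramMat_det_pos hx)

lemma gramMat_smtF (hx : x ∈ (chartAt 𝔼 p).source) (i j : Fin n) :
    SmtF n (fun y => gramMat n p y i j) x := (coordField_smt hx i).inner (coordField_smt hx j)

lemma gramMat_det_smtF (hx : x ∈ (chartAt 𝔼 p).source) : SmtF n (fun y => (gramMat n p y).det) x := by
  simp only [Matrix.det_apply']
  refine SmtF.sum fun σ _ => SmtF.mul (SmtF.const _) ?_
  have : ∀ᶠ y in 𝓝 x, y ∈ (chartAt 𝔼 p).source := (chartAt 𝔼 p).open_source.mem_nhds hx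
  filter_upwards [this] with y hy
  exact contMDiffAt_finsetProd fun i _ => (gramMat_smtF hy (σ i) i).contMDiffAt

lemma volDensity_smtF (hx : x ∈ (chartAt 𝔼 p).source) : SmtF n (volDensity n p) x := by
  refine (gramMat_det_smtF hx).comp (φ := fun t => √t) ?_
  have : ∀ᶠ y in 𝓝 x, y ∈ (chartAt 𝔼 p).source := (chartAt 𝔼 p).open_source.mem_nhds hx
  filter_upwards [this] with y hy using Real.contDiffAt_sqrt (gramMat_det_pos hy).ne'

lemma differentiableAt_comp_chart_symm {f : M → ℝ} (hx : x ∈ (chartAt 𝔼 p).source)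
    (hf : MDifferentiableAt (𝓡 n) 𝓘(ℝ, ℝ) f x) :
    DifferentiableAt ℝ (fun y => f ((chartAt 𝔼 p).symm y)) (chartAt 𝔼 p x) := by
  have h1 := (chart_symm_contMDiffAt ((chartAt 𝔼 p).map_source hx)).mdifferentiableAt (by simp)
  have h0 := (chartAt 𝔼 p).left_inv hx
  rw [← mdifferentiableAt_iff_differentiableAt]
  exact MDifferentiableAt.comp_of_eq (chartAt 𝔼 p x) hf h1 h0

/-- If $A$ is the matrix of $\nabla_{\partial_k}$ on the coordinate fields, metric compatibility
gives $\partial_kg=Ag+gA^T$. Jacobi's formula then gives $\partial_k\det g=2\det g\,\mathrm{tr}A$.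
-/
lemma mvfderiv_volDensity (hx : x ∈ (chartAt 𝔼 p).source) (k : Fin n) :
    mvfderiv (𝓡 n) (volDensity n p) x (coordField p k x) = volDensity n p x *
      ∑ i, mvfderiv (𝓡 n) (coordFun p i) x (nabla (coordField p i) x (coordField p k x)) := by
  set v := coordField p k x with hv
  set A : Matrix (Fin n) (Fin n) ℝ := Matrix.of fun i j =>
    mvfderiv (𝓡 n) (coordFun p j) x (nabla (coordField p i) x v) with hA
  have hg (i j) : mvfderiv (𝓡 n) (fun y => gramMat n p y i j) x v =
      (A * gramMat n p x + gramMat n p x * A.transpose) i j := by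
    have h1 (i) : nabla (coordField p i) x v = ∑ j, A i j • coordField p j x :=
      (sum_coordField hx _).symm
    have h2 := mvfderiv_inner (coordField_smt hx i).msec (coordField_smt hx j).msec v
    change mvfderiv (𝓡 n) (fun y => gramMat n p y i j) x v = _ at h2
    rw [h2, h1, h1]
    simp only [sum_inner, inner_sum, inner_smul_left, inner_smul_right, Matrix.add_apply,
      Matrix.mul_apply, Matrix.transpose_apply]
    congr 1
    refine Finset.sum_congr rfl fun l _ => ?_
    rw [mul_comm]
    rfl
  have hx0 := (chartAt 𝔼 p).left_inv hx
  have hd := HasFDerivAt.matrix_det (A := fun y => gramMat n p ((chartAt 𝔼 p).symm y))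
    (fun i j => (differentiableAt_comp_chart_symm hx (gramMat_smtF hx i j).mdiff).hasFDerivAt)
  have hpos := gramMat_det_pos hx
  have hs := hd.sqrt (by rw [hx0]; exact hpos.ne')
  rw [hv, mvfderiv_coordField hx (volDensity_smtF hx).mdiff]
  change fderiv ℝ (fun y => √(gramMat n p ((chartAt 𝔼 p).symm y)).det) _ _ = _
  rw [hs.fderiv]
  simp only [hx0, smul_apply, sum_apply, ← mvfderiv_coordField hx (gramMat_smtF hx _ _).mdiff,
    ← hv, hg, smul_eq_mul]
  have htr : ∑ i, ∑ j, (gramMat n p x).adjugate j i * (A * gramMat n p x + gramMat n p x * A.transpose) i j =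
      2 * (gramMat n p x).det * A.trace := by
    have : ∑ i, ∑ j, (gramMat n p x).adjugate j i * (A * gramMat n p x + gramMat n p x * A.transpose) i j =
        ((gramMat n p x).adjugate * (A * gramMat n p x + gramMat n p x * A.transpose)).trace := by
      rw [Finset.sum_comm]
      simp [Matrix.trace, Matrix.mul_apply]
    rw [this, Matrix.mul_add, Matrix.trace_add, ← Matrix.mul_assoc, Matrix.trace_mul_comm,
      ← Matrix.mul_assoc, ← Matrix.mul_assoc, Matrix.mul_adjugate, Matrix.adjugate_mul]
    simp
    ring
  rw [htr]
  change _ = √(gramMat n p x).det * A.trace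
  have h4 := (Real.sqrt_pos.2 hpos).ne'
  generalize A.trace = t
  nth_rw 2 [← Real.mul_self_sqrt hpos.le]
  field_simp

/-- The divergence of a vector field (the trace of its covariant derivative). -/
def divergence (ξ : VecField n M) (x : M) : ℝ :=
  ∑ i, (inner ℝ (nabla ξ x (frame x i)) (frame x i) : ℝ)

/-- Vanishing brackets of coordinate fields allow the lower Christoffel indices to be exchanged, so
that $\sum_i\Gamma^i_{ij}$ appears as the logarithmic derivative of $\sqrt{\det g}$ along
$\partial_j$. -/
lemma divergence_mul_volDensity {ξ : VecField n M} (hx : x ∈ (chartAt 𝔼 p).source) (hξ : Smt ξ x) :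
    divergence ξ x * volDensity n p x = ∑ i, mvfderiv (𝓡 n)
      (fun y => volDensity n p y * mvfderiv (𝓡 n) (coordFun p i) y (ξ y)) x (coordField p i x) := by
  have hb (i) := coordField_smt hx i
  have hc (i) : SmtF n (fun y => mvfderiv (𝓡 n) (coordFun p i) y (ξ y)) x :=
    hξ.mvfderiv (coordFun_smtF hx i)
  have h1 : divergence ξ x =
      ∑ i, mvfderiv (𝓡 n) (coordFun p i) x (nabla ξ x (coordField p i x)) := by
    have hl := nabla_isLinearMap hξ.msec
    have e1 (k) : (inner ℝ (nabla ξ x (frame x k)) (frame x k) : ℝ) =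
        ∑ i, mvfderiv (𝓡 n) (coordFun p i) x (nabla ξ x (frame x k)) *
          inner ℝ (frame x k) (coordField p i x) := by
      conv_lhs => rw [← sum_coordField hx (nabla ξ x (frame x k))]
      simp only [sum_inner, inner_smul_left, real_inner_comm]
      rfl
    simp only [divergence, e1]
    rw [Finset.sum_comm]
    refine Finset.sum_congr rfl fun i _ => ?_
    conv_rhs => rw [← (frame x).sum_repr' (coordField p i x)]
    have e2 : nabla ξ x (∑ k, (inner ℝ (frame x k) (coordField p i x) : ℝ) • frame x k) =
        ∑ k, (inner ℝ (frame x k) (coordField p i x) : ℝ) • nabla ξ x (frame x k) := by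
      change hl.mk' _ _ = _
      rw [map_sum]
      simp
    rw [e2, map_sum]
    refine Finset.sum_congr rfl fun k _ => ?_
    rw [map_smul, smul_eq_mul, mul_comm]
  have h2 (i) : mvfderiv (𝓡 n) (coordFun p i) x (nabla ξ x (coordField p i x)) =
      mvfderiv (𝓡 n) (fun y => mvfderiv (𝓡 n) (coordFun p i) y (ξ y)) x (coordField p i x) +
      ∑ j, mvfderiv (𝓡 n) (coordFun p j) x (ξ x) *
        mvfderiv (𝓡 n) (coordFun p i) x (nabla (coordField p i) x (coordField p j x)) := by
    have e1 : ∀ᶠ y in 𝓝 x, ξ y =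
        ∑ j, mvfderiv (𝓡 n) (coordFun p j) y (ξ y) • coordField p j y := by
      filter_upwards [(chartAt 𝔼 p).open_source.mem_nhds hx] with y hy
        using (sum_coordField hy _).symm
    rw [nabla_congr e1, nabla_sum fun j _ => (Smt.smul (hc j) (hb j)).msec]
    simp only [nabla_smul' (hc _).mdiff (hb _).msec, map_sum, map_add, map_smul,
      mvfderiv_coordFun_coordField hx, Finset.sum_add_distrib, smul_eq_mul]
    congr 1
    · simp
    · refine Finset.sum_congr rfl fun j _ => ?_
      have := nabla_sub_nabla (hb j).msec (hb i).msec
      rw [coordField_lie hx, sub_eq_zero] at this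
      rw [this]
  rw [h1]
  simp only [h2, mvfderiv_mul' (volDensity_smtF hx).mdiff (hc _).mdiff, mvfderiv_volDensity hx,
    Finset.sum_add_distrib, add_mul]
  congr 1
  · rw [Finset.sum_mul]
    exact Finset.sum_congr rfl fun i _ => mul_comm _ _
  · rw [Finset.sum_comm, Finset.sum_mul]
    refine Finset.sum_congr rfl fun i _ => ?_
    rw [← Finset.mul_sum]
    ring

end gram

/-! ### The Riemannian measure -/

section volume

open MeasureTheory

variable [MeasurableSpace M] [BorelSpace M] {p q x : M}

local notation "𝔼" => EuclideanSpace ℝ (Fin n)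

lemma chart_symm_aemeasurable {μ : Measure 𝔼} (hμ : μ ≪ (MeasureTheory.volume : Measure 𝔼).restrict (chartAt 𝔼 p).target) :
    AEMeasurable (chartAt 𝔼 p).symm μ :=
  ((chartAt 𝔼 p).continuousOn_symm.aemeasurable (chartAt 𝔼 p).open_target.measurableSet).mono_ac hμ

lemma measurableSet_chart_preimage {A : Set M} (hA : MeasurableSet A) :
    MeasurableSet ((chartAt 𝔼 p).symm ⁻¹' A ∩ (chartAt 𝔼 p).target) := by
  have h1 : Measurable ((chartAt 𝔼 p).target.domRestrict (chartAt 𝔼 p).symm) :=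
    (continuousOn_iff_continuous_domRestrict.1 (chartAt 𝔼 p).continuousOn_symm).measurable
  have h2 := (chartAt 𝔼 p).open_target.measurableSet.subtype_image (h1 hA)
  convert h2 using 1
  ext y
  simp [Set.domRestrict, and_comm]

lemma chartVolume_apply {A : Set M} (hA : MeasurableSet A) :
    chartVolume (n := n) p A = ∫⁻ y in (chartAt 𝔼 p).symm ⁻¹' A ∩ (chartAt 𝔼 p).target,
      ENNReal.ofReal √(gramDet p y) := by
  rw [chartVolume]
  rw [Measure.map_apply_of_aemeasurable
    (chart_symm_aemeasurable (withDensity_absolutelyContinuous _ _)) hA, withDensity_apply' _ _,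
    Measure.restrict_restrict' (chartAt 𝔼 p).open_target.measurableSet]

lemma gramDet_chart (hx : x ∈ (chartAt 𝔼 p).source) :
    gramDet p (chartAt 𝔼 p x) = (gramMat n p x).det := by
  rw [gramDet_eq ((chartAt 𝔼 p).map_source hx), (chartAt 𝔼 p).left_inv hx]

/-- The Gram matrices are congruent by the Jacobian matrix of the transition map. The square of its
determinant supplies the Jacobian factor in the change of variables. -/
lemma gramMat_det_eq (hp : x ∈ (chartAt 𝔼 p).source) :
    (gramMat n q x).det = (dchart (n := n) p x ∘L dchartSymm q x).det ^ 2 * (gramMat n p x).det := by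
  set P : Matrix (Fin n) (Fin n) ℝ := Matrix.of fun i j =>
    mvfderiv (𝓡 n) (coordFun p i) x (coordField q j x) with hP
  have h1 : gramMat n q x = P.transpose * gramMat n p x * P := by
    ext i j
    have h (i) : coordField q i x = ∑ j, P j i • coordField p j x := (sum_coordField hp _).symm
    change (inner ℝ (coordField q i x) (coordField q j x) : ℝ) = _
    rw [h, h]
    simp only [sum_inner, inner_sum, inner_smul_left, inner_smul_right,
      Matrix.mul_apply, Matrix.transpose_apply, Finset.sum_mul, Finset.mul_sum]
    refine Finset.sum_congr rfl fun a _ => Finset.sum_congr rfl fun b _ => ?_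
    simp only [gramMat, Matrix.of_apply, conj_trivial]
    ring
  have h2 : (dchart (n := n) p x ∘L dchartSymm q x).det = P.det := by
    rw [ContinuousLinearMap.det, ← LinearMap.det_toMatrix (EuclideanSpace.basisFun (Fin n) ℝ).toBasis]
    congr 1
    ext i j
    simp only [hP, Matrix.of_apply, mvfderiv_coordFun hp, coordField_eq]
    simp [LinearMap.toMatrix_apply]
  rw [h1, h2, Matrix.det_mul, Matrix.det_mul, Matrix.det_transpose]
  ring

lemma hasFDerivAt_transition (hp : x ∈ (chartAt 𝔼 p).source) (hq : x ∈ (chartAt 𝔼 q).source) :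
    HasFDerivAt (fun y => chartAt 𝔼 p ((chartAt 𝔼 q).symm y)) (dchart p x ∘L dchartSymm q x)
      (chartAt 𝔼 q x) := by
  have h1 := ((chart_symm_contMDiffAt ((chartAt 𝔼 q).map_source hq)).mdifferentiableAt
    (by simp)).hasMFDerivAt
  have h2 := ((chart_contMDiffAt hp).mdifferentiableAt (by simp)).hasMFDerivAt
  have h0 := (chartAt 𝔼 q).left_inv hq
  rw [← h0] at h2
  have h3 := (HasMFDerivAt.comp (chartAt 𝔼 q x) h2 h1).hasFDerivAt
  rw [h0] at h3
  exact h3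

/-- Change of variables along the transition map. The one-sided bound, for all $q$ against a fixed
$p$, is enough to control the supremum defining the measure. -/
lemma chartVolume_inter_source_le {A : Set M} (hA : MeasurableSet A) :
    chartVolume (n := n) q (A ∩ (chartAt 𝔼 p).source) ≤ chartVolume (n := n) p A := by
  have hAp := hA.inter (chartAt 𝔼 p).open_source.measurableSet
  set S := (chartAt 𝔼 q).symm ⁻¹' (A ∩ (chartAt 𝔼 p).source) ∩ (chartAt 𝔼 q).target with hS
  have hSm : MeasurableSet S := measurableSet_chart_preimage hAp
  let ψ : 𝔼 → 𝔼 := fun y => chartAt 𝔼 p ((chartAt 𝔼 q).symm y)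
  let ψ' : 𝔼 → 𝔼 →L[ℝ] 𝔼 := fun y =>
    dchart p ((chartAt 𝔼 q).symm y) ∘L dchartSymm q ((chartAt 𝔼 q).symm y)
  have hψ (y) (hy : y ∈ S) : HasFDerivWithinAt ψ (ψ' y) S y := by
    have := hasFDerivAt_transition (n := n) hy.1.2 ((chartAt 𝔼 q).map_target hy.2)
    rw [(chartAt 𝔼 q).right_inv hy.2] at this
    exact this.hasFDerivWithinAt
  have hinj : Set.InjOn ψ S := fun y hy z hz h =>
    (chartAt 𝔼 q).symm.injOn hy.2 hz.2 ((chartAt 𝔼 p).injOn hy.1.2 hz.1.2 h)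
  rw [chartVolume_apply hAp, chartVolume_apply hA]
  have h1 := lintegral_image_eq_lintegral_abs_det_fderiv_mul MeasureTheory.volume hSm hψ hinj
    fun y => ENNReal.ofReal √(gramDet p y)
  have h2 : ∫⁻ y in S, ENNReal.ofReal √(gramDet q y) =
      ∫⁻ y in S, ENNReal.ofReal |(ψ' y).det| * ENNReal.ofReal √(gramDet p (ψ y)) := by
    refine setLIntegral_congr_fun hSm fun y hy => ?_
    have hq := (chartAt 𝔼 q).map_target hy.2
    simp only [ψ]
    rw [gramDet_eq hy.2, gramDet_chart hy.1.2, gramMat_det_eq hy.1.2, Real.sqrt_mul (sq_nonneg _),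
      Real.sqrt_sq_eq_abs, ENNReal.ofReal_mul (abs_nonneg _)]
  rw [h2, ← h1]
  refine lintegral_mono_set ?_
  rintro _ ⟨y, hy, rfl⟩
  refine ⟨?_, (chartAt 𝔼 p).map_source hy.1.2⟩
  simp only [ψ, Set.mem_preimage]
  rw [(chartAt 𝔼 p).left_inv hy.1.2]
  exact hy.1.1

lemma chartVolume_compl_source : chartVolume (n := n) p (chartAt 𝔼 p).sourceᶜ = 0 := by
  rw [chartVolume_apply (chartAt 𝔼 p).open_source.measurableSet.compl]
  have : (chartAt 𝔼 p).symm ⁻¹' (chartAt 𝔼 p).sourceᶜ ∩ (chartAt 𝔼 p).target = ∅ := by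
    ext y
    simp only [Set.mem_inter_iff, Set.mem_preimage, Set.mem_compl_iff, Set.mem_empty_iff_false,
      iff_false, not_and, not_imp_not]
    exact (chartAt 𝔼 p).map_target
  rw [this]
  simp

/-- The Riemannian measure agrees with the chart measure on a chart domain. -/
lemma volume_restrict_source (p : M) :
    (KEDeform.volume n M).restrict (chartAt 𝔼 p).source = chartVolume (n := n) p := by
  have hs := (chartAt 𝔼 p).open_source.measurableSet
  have h0 : (chartVolume (n := n) p).restrict (chartAt 𝔼 p).source = chartVolume (n := n) p :=
    Measure.restrict_eq_self_of_ae_mem (by rw [ae_iff]; exact chartVolume_compl_source)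
  apply le_antisymm
  -- Every chart measure, hence the supremum, lies below a measure that equals the one of $p$ plus
  -- the largest possible measure off the chart domain. Restricting to the domain discards the
  -- latter.
  · have h1 : KEDeform.volume n M ≤
        chartVolume (n := n) p + (⊤ : Measure M).restrict (chartAt 𝔼 p).sourceᶜ := by
      refine iSup_le fun q => ?_
      refine Measure.le_iff.2 fun A hA => ?_
      rw [← measure_inter_add_sdiff A hs, Measure.add_apply]
      refine add_le_add (chartVolume_inter_source_le hA) ?_
      rw [Measure.restrict_apply hA]
      exact (le_top : chartVolume (n := n) q ≤ ⊤) _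
    refine (Measure.restrict_mono le_rfl h1).trans ?_
    rw [Measure.restrict_add, h0, Measure.restrict_restrict hs]
    simp
  · conv_lhs => rw [← h0]
    exact Measure.restrict_mono le_rfl (le_iSup (fun p : M => chartVolume (n := n) p) p)

lemma volume_apply_of_subset {A : Set M} (hA : MeasurableSet A) (h : A ⊆ (chartAt 𝔼 p).source) :
    KEDeform.volume n M A = ∫⁻ y in (chartAt 𝔼 p).symm ⁻¹' A ∩ (chartAt 𝔼 p).target,
      ENNReal.ofReal √(gramDet p y) := by
  rw [← chartVolume_apply hA, ← volume_restrict_source, Measure.restrict_eq_self _ h]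

lemma sqrt_gramDet_continuousOn (p : M) :
    ContinuousOn (fun y : 𝔼 => √(gramDet p y)) (chartAt 𝔼 p).target := by
  have : ContinuousOn (fun y : 𝔼 => volDensity n p ((chartAt 𝔼 p).symm y)) (chartAt 𝔼 p).target := by
    intro y hy
    exact ((volDensity_smtF ((chartAt 𝔼 p).map_target hy)).contMDiffAt.continuousAt.comp
      ((chartAt 𝔼 p).continuousAt_symm hy)).continuousWithinAt
  refine this.congr fun y hy => ?_
  simp only [gramDet_eq hy, volDensity]

-- On the compact manifold this makes continuous functions integrable.
scoped instance isLocallyFiniteMeasure_volume : IsLocallyFiniteMeasure (KEDeform.volume n M) where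
  finiteAtNhds x := by
    obtain ⟨K, hK, hxK, hKc⟩ := exists_compact_subset (chartAt 𝔼 x).open_target
      ((chartAt 𝔼 x).map_source (mem_chart_source _ x))
    have hU : IsOpen ((chartAt 𝔼 x).source ∩ chartAt 𝔼 x ⁻¹' interior K) :=
      (chartAt 𝔼 x).isOpen_inter_preimage isOpen_interior
    refine ⟨_, hU.mem_nhds ⟨mem_chart_source _ x, hxK⟩, ?_⟩
    rw [volume_apply_of_subset hU.measurableSet Set.inter_subset_left]
    have h1 := ((sqrt_gramDet_continuousOn x).mono hKc).integrableOn_compact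
      (μ := MeasureTheory.volume) hK
    refine (lintegral_mono_set ?_).trans_lt h1.lintegral_lt_top
    rintro y ⟨⟨-, hy⟩, hy2⟩
    rw [Set.mem_preimage, (chartAt 𝔼 x).right_inv hy2] at hy
    exact interior_subset hy

-- This is what turns a vanishing $L^2$ norm into pointwise vanishing, hence gives the uniqueness of
-- $\mathbf v(h,h)$.
scoped instance isOpenPosMeasure_volume : Measure.IsOpenPosMeasure (KEDeform.volume n M) where
  open_pos U hU := by
    rintro ⟨x, hx⟩ h0
    have hV : IsOpen (U ∩ (chartAt 𝔼 x).source) := hU.inter (chartAt 𝔼 x).open_source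
    have h1 := measure_mono_null (t := U) (s := U ∩ (chartAt 𝔼 x).source) Set.inter_subset_left h0
    rw [volume_apply_of_subset hV.measurableSet Set.inter_subset_right] at h1
    set S := (chartAt 𝔼 x).symm ⁻¹' (U ∩ (chartAt 𝔼 x).source) ∩ (chartAt 𝔼 x).target with hS
    have hSo : IsOpen S := by
      have := (chartAt 𝔼 x).symm.isOpen_inter_preimage hV
      rwa [Set.inter_comm] at this
    have hm : AEMeasurable (fun y => ENNReal.ofReal √(gramDet x y))
        (MeasureTheory.volume.restrict S) :=
      (((sqrt_gramDet_continuousOn x).mono Set.inter_subset_right).aemeasurable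
        hSo.measurableSet).ennreal_ofReal
    rw [lintegral_eq_zero_iff' hm, Filter.EventuallyEq, ae_restrict_iff' hSo.measurableSet] at h1
    have h2 : (MeasureTheory.volume : Measure 𝔼) S = 0 := by
      refine measure_mono_null (fun y hy => ?_) h1
      simp only [Set.mem_compl_iff, Set.mem_ofPred_eq, Classical.not_imp]
      refine ⟨hy, ?_⟩
      rw [gramDet_eq hy.2, Pi.zero_apply, ENNReal.ofReal_eq_zero, not_le]
      exact volDensity_pos hy.1.2
    refine hSo.measure_ne_zero _ ⟨chartAt 𝔼 x x, ?_, (chartAt 𝔼 x).map_source (mem_chart_source _ x)⟩ h2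
    rw [Set.mem_preimage, (chartAt 𝔼 x).left_inv (mem_chart_source _ x)]
    exact ⟨hx, mem_chart_source _ x⟩

end volume

/-! ### The divergence theorem -/

section divergence_theorem

open MeasureTheory

local notation "𝔼" => EuclideanSpace ℝ (Fin n)

/-- Integration by parts against the constant function 1. -/
lemma integral_fderiv_eq_zero {V : Type*} [NormedAddCommGroup V] [NormedSpace ℝ V] [FiniteDimensional ℝ V]
    [MeasurableSpace V] [BorelSpace V] (μ : Measure V) [μ.IsAddHaarMeasure] {F : V → ℝ}
    (hF : ContDiff ℝ ∞ F) (hc : HasCompactSupport F) (v : V) : ∫ y, fderiv ℝ F y v ∂μ = 0 := by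
  have h1 : Integrable (fun y => fderiv ℝ F y v) μ :=
    ((hF.continuous_fderiv (by simp)).clm_apply continuous_const).integrable_of_hasCompactSupport
      (hc.fderiv_apply ℝ v)
  have h2 : Integrable F μ := hF.continuous.integrable_of_hasCompactSupport hc
  have := integral_mul_fderiv_eq_neg_fderiv_mul_of_integrable (μ := μ) (f := fun _ : V => (1 : ℝ)) (g := F)
    (v := v) (by simp) (by simpa using h1) (by simpa using h2) (by simp)
    fun x _ => hF.differentiable (by simp) x
  simpa using this

variable {ξ η : VecField n M} {x p : M}

lemma divergence_smtF (hξ : Smt ξ x) : SmtF n (divergence ξ) x :=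
  hξ.tens1_nabla.sum_inner_smt Tens1.id

lemma divergence_sum {ι : Type*} {s : Finset ι} {Y : ι → VecField n M} (h : ∀ i ∈ s, Smt (Y i) x) :
    divergence (fun y => ∑ i ∈ s, Y i y) x = ∑ i ∈ s, divergence (Y i) x := by
  simp only [divergence, nabla_sum fun i hi => (h i hi).msec, sum_inner]
  rw [Finset.sum_comm]

lemma divergence_eq_zero (h : ∀ᶠ y in 𝓝 x, ξ y = 0) : divergence ξ x = 0 := by
  simp [divergence, nabla_congr (Z := fun _ => 0) h, nabla_zero]

lemma continuous_of_smtF {f : M → ℝ} (h : ∀ x, SmtF n f x) : Continuous f :=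
  continuous_iff_continuousAt.2 fun x => (h x).contMDiffAt.continuousAt

variable [MeasurableSpace M] [BorelSpace M] [T2Space M] [CompactSpace M]

lemma integrable_of_smtF {f : M → ℝ} (h : ∀ x, SmtF n f x) : Integrable f (KEDeform.volume n M) :=
  (continuous_of_smtF h).integrable_of_hasCompactSupport (HasCompactSupport.of_compactSpace f)

lemma integral_chartVolume {f : M → ℝ} (hf : Continuous f) (p : M) :
    ∫ x, f x ∂(chartVolume (n := n) p) =
      ∫ y in (chartAt 𝔼 p).target, √(gramDet p y) * f ((chartAt 𝔼 p).symm y) := by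
  rw [chartVolume]
  rw [integral_map (chart_symm_aemeasurable (withDensity_absolutelyContinuous _ _))
    hf.aestronglyMeasurable, integral_withDensity_eq_integral_toReal_smul₀]
  · refine setIntegral_congr_fun (chartAt 𝔼 p).open_target.measurableSet fun y _ => ?_
    simp only [smul_eq_mul, ENNReal.toReal_ofReal (Real.sqrt_nonneg _)]
  · exact ((sqrt_gramDet_continuousOn p).aemeasurable
      (chartAt 𝔼 p).open_target.measurableSet).ennreal_ofReal
  · simp

/-- In the chart the integrand is $\sum_i\partial_i(\sqrt{\det g}\,\xi^i)$. The functions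
$\sqrt{\det g}\,\xi^i$, extended by zero, are smooth on all of Euclidean space because the image of
$K$ is compact inside the open target, so each derivative integrates to zero. -/
lemma integral_divergence_of_subset_source (hξ : ∀ x, Smt ξ x) {K : Set M} (hK : IsCompact K)
    (hKs : K ⊆ (chartAt 𝔼 p).source) (h0 : ∀ x ∉ K, ξ x = 0) :
    ∫ x, divergence ξ x ∂(KEDeform.volume n M) = 0 := by
  have hdiv0 (x) (hx : x ∉ K) : divergence ξ x = 0 :=
    divergence_eq_zero (by filter_upwards [hK.isClosed.isOpen_compl.mem_nhds hx] with y hy using h0 y hy)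
  rw [← setIntegral_eq_integral_of_forall_compl_eq_zero (s := (chartAt 𝔼 p).source)
    fun x hx => hdiv0 x fun h => hx (hKs h), volume_restrict_source,
    integral_chartVolume (continuous_of_smtF fun x => divergence_smtF (hξ x))]
  let f (i : Fin n) (x : M) : ℝ := volDensity n p x * mvfderiv (𝓡 n) (coordFun p i) x (ξ x)
  have hf (i x) (hx : x ∈ (chartAt 𝔼 p).source) : SmtF n (f i) x :=
    (volDensity_smtF hx).mul ((hξ x).mvfderiv (coordFun_smtF hx i))
  let F (i : Fin n) : 𝔼 → ℝ := (chartAt 𝔼 p).target.indicator fun y => f i ((chartAt 𝔼 p).symm y)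
  have hKc : IsCompact (chartAt 𝔼 p '' K) := hK.image_of_continuousOn ((chartAt 𝔼 p).continuousOn.mono hKs)
  have hF0 (i y) (hy : y ∉ chartAt 𝔼 p '' K) : F i y = 0 := by
    by_cases hT : y ∈ (chartAt 𝔼 p).target
    · have : (chartAt 𝔼 p).symm y ∉ K := fun h => hy ⟨_, h, (chartAt 𝔼 p).right_inv hT⟩
      simp [F, hT, f, h0 _ this]
    · simp [F, hT]
  have hFT (i y) (hT : y ∈ (chartAt 𝔼 p).target) :
      F i =ᶠ[𝓝 y] fun y => f i ((chartAt 𝔼 p).symm y) := by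
    filter_upwards [(chartAt 𝔼 p).open_target.mem_nhds hT] with z hz using Set.indicator_of_mem hz _
  have hFz (i y) (hT : y ∉ (chartAt 𝔼 p).target) : F i =ᶠ[𝓝 y] fun _ => 0 := by
    have : y ∉ chartAt 𝔼 p '' K := by
      rintro ⟨x, hx, rfl⟩
      exact hT ((chartAt 𝔼 p).map_source (hKs hx))
    filter_upwards [hKc.isClosed.isOpen_compl.mem_nhds this] with z hz using hF0 i z hz
  have hFs (i) : ContDiff ℝ ∞ (F i) := by
    rw [contDiff_iff_contDiffAt]
    intro y
    by_cases hT : y ∈ (chartAt 𝔼 p).target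
    · refine ContDiffAt.congr_of_eventuallyEq ?_ (hFT i y hT)
      exact ((hf i _ ((chartAt 𝔼 p).map_target hT)).contMDiffAt.comp y
        (chart_symm_contMDiffAt hT)).contDiffAt
    · exact contDiffAt_const.congr_of_eventuallyEq (hFz i y hT)
  have hFc (i) : HasCompactSupport (F i) := HasCompactSupport.intro hKc fun y hy => hF0 i y hy
  have h1 : ∫ y in (chartAt 𝔼 p).target, √(gramDet p y) * divergence ξ ((chartAt 𝔼 p).symm y) =
      ∫ y in (chartAt 𝔼 p).target, ∑ i, fderiv ℝ (F i) y (EuclideanSpace.single i 1) := by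
    refine setIntegral_congr_fun (chartAt 𝔼 p).open_target.measurableSet fun y hy => ?_
    have hs := (chartAt 𝔼 p).map_target hy
    simp only [(hFT _ y hy).fderiv_eq]
    have h2 := divergence_mul_volDensity hs (hξ _)
    simp only [gramDet_eq hy]
    rw [mul_comm]
    refine h2.trans (Finset.sum_congr rfl fun i _ => ?_)
    rw [mvfderiv_coordField hs (hf i _ hs).mdiff, (chartAt 𝔼 p).right_inv hy]
  rw [h1, setIntegral_eq_integral_of_forall_compl_eq_zero, integral_finsetSum]
  · exact Finset.sum_eq_zero fun i _ => integral_fderiv_eq_zero _ (hFs i) (hFc i) _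
  · intro i _
    exact (((hFs i).continuous_fderiv (by simp)).clm_apply
      continuous_const).integrable_of_hasCompactSupport ((hFc i).fderiv_apply ℝ _)
  · intro y hy
    simp [(hFz _ y hy).fderiv_eq]

/-- The divergence theorem on a closed Riemannian manifold. -/
theorem integral_divergence (hξ : ∀ x, Smt ξ x) :
    ∫ x, divergence ξ x ∂(KEDeform.volume n M) = 0 := by
  obtain ⟨t, ht⟩ := CompactSpace.elim_nhds_subcover (fun p : M => (chartAt 𝔼 p).source)
    fun p => (chartAt 𝔼 p).open_source.mem_nhds (mem_chart_source _ p)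
  -- Since $\sum_i\rho_i=1$, the divergence of $\xi$ is the sum of those of the $\rho_i\xi$, each
  -- supported in one chart.
  obtain ⟨ρ, hρ⟩ := SmoothPartitionOfUnity.exists_isSubordinate (𝓡 n) (isClosed_univ (X := M))
    (fun i : t => (chartAt 𝔼 (i : M)).source) (fun i => (chartAt 𝔼 (i : M)).open_source) (by
      intro x _
      have hx : x ∈ ⋃ p ∈ t, (chartAt 𝔼 p).source := by rw [ht]; trivial
      simpa using hx)
  have hρs (i x) : SmtF n (ρ i) x := Eventually.of_forall fun y => (ρ i).contMDiff.contMDiffAt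
  have hs (i : t) (x) : Smt (fun y => ρ i y • ξ y) x := Smt.smul (hρs i x) (hξ x)
  have hsum : ξ = fun x => ∑ i, ρ i x • ξ x := by
    ext1 x
    have := ρ.sum_eq_one (Set.mem_univ x)
    rw [finsum_eq_sum_of_fintype] at this
    rw [← Finset.sum_smul, this, one_smul]
  have h1 (x) : divergence ξ x = ∑ i, divergence (fun y => ρ i y • ξ y) x := by
    conv_lhs => rw [hsum]
    exact divergence_sum fun i _ => hs i x
  simp only [h1]
  rw [integral_finsetSum _ fun i _ => integrable_of_smtF fun x => divergence_smtF (hs i x)]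
  refine Finset.sum_eq_zero fun i _ => ?_
  refine integral_divergence_of_subset_source (hs i) (isClosed_tsupport (ρ i)).isCompact (hρ i) ?_
  intro x hx
  rw [image_eq_zero_of_notMem_tsupport hx, zero_smul]

end divergence_theorem

/-! ### Smooth sections of $\mathrm{End}(TM)$ -/

section smooth_sections

variable {A B : Tensor1 n M} {h : EndField n M} {x : M}

local notation "𝔼" => EuclideanSpace ℝ (Fin n)

lemma IsSmooth.tens1 (h_smooth : IsSmooth h) (x : M) : Tens1 h.tensor x :=
  Eventually.of_forall fun y =>
    { lin := ⟨fun v w => (h y).map_add v w, fun c v => (h y).map_smul c v⟩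
      smt := fun Y hY => by
        filter_upwards [hY] with z hz
        exact (h_smooth z).clm_bundle_apply hz }

/-- In a trivialisation $A$ is the sum of the rank-one maps $v\mapsto v_i\,A(b_i)$ over the local
frame $b_i$, and the $A(b_i)$ are smooth. Tensors built pointwise can thus serve as test sections
and as $\mathbf v(h,h)$ itself. -/
lemma exists_isSmooth (hA : ∀ x, T1 A x) : ∃ h : EndField n M, IsSmooth h ∧ h.tensor = A := by
  refine ⟨fun x => LinearMap.toContinuousLinearMap ((hA x).lin.mk' _), ?_, rfl⟩
  intro x
  rw [contMDiffAt_hom_bundle]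
  refine ⟨contMDiffAt_id, ?_⟩
  let t := trivializationAt 𝔼 (fun y : M => TangentSpace (𝓡 n) y) x
  let b : Module.Basis (Fin n) ℝ 𝔼 := (EuclideanSpace.basisFun (Fin n) ℝ).toBasis
  have hx : ∀ᶠ y in 𝓝 x, y ∈ t.baseSet :=
    t.open_baseSet.mem_nhds (FiberBundle.mem_baseSet_trivializationAt' x)
  have he : ∀ i, Smt (t.localFrame b i) x := fun i => by
    filter_upwards [hx] with y hy using contMDiffAt_localFrame_of_mem ∞ t b i hy
  have h1 (i) := (contMDiffAt_section (F := 𝔼) (E := fun y : M => TangentSpace (𝓡 n) y) (IB := 𝓡 n) x).1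
    ((hA x).smt _ (he i)).csec
  have h2 : ContMDiffAt (𝓡 n) 𝓘(ℝ, 𝔼 →L[ℝ] 𝔼) ∞ (fun y => ∑ i,
      ContinuousLinearMap.smulRightL ℝ 𝔼 𝔼 (EuclideanSpace.proj i)
        (t ⟨y, A y (t.localFrame b i y)⟩).2) x := by
    refine contMDiffAt_finsetSum fun i _ => ?_
    exact (ContinuousLinearMap.smulRightL ℝ 𝔼 𝔼
      (EuclideanSpace.proj i)).contMDiff.contMDiffAt.comp x (h1 i)
  refine h2.congr_of_eventuallyEq ?_
  filter_upwards [hx] with y hy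
  ext v : 1
  have h3 (i) : t.localFrame b i y = t.symmL ℝ y (EuclideanSpace.single i 1) := by
    rw [t.localFrame_apply_of_mem_baseSet b hy]
    rw [t.symmL_apply hy]
    simp [Bundle.Trivialization.basisAt, b]
  have h4 : v = ∑ i, v i • (EuclideanSpace.single i (1 : ℝ) : 𝔼) := by
    ext j
    simp [Pi.single_apply]
  have h5 (w : 𝔼) : t.continuousLinearMapAt ℝ y (A y (t.symmL ℝ y w)) =
    ContinuousLinearMap.inCoordinates 𝔼 (fun y : M => TangentSpace (𝓡 n) y) 𝔼
      (fun y : M => TangentSpace (𝓡 n) y) x y x y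
      (LinearMap.toContinuousLinearMap ((hA y).lin.mk' _)) w := rfl
  rw [← h5]
  conv_lhs => rw [h4]
  have h6 : A y (∑ i, v i • t.localFrame b i y) = ∑ i, v i • A y (t.localFrame b i y) := by
    change (hA y).lin.mk' _ _ = _
    rw [map_sum]
    simp
  simp only [map_sum, map_smul, ← h3, h6]
  simp [t.continuousLinearMapAt_apply_of_mem (R := ℝ) hy]

end smooth_sections

/-! ### The pointwise identity as linear algebra -/

section algebra

variable {V W ι : Type*} [NormedAddCommGroup V] [InnerProductSpace ℝ V] [AddCommGroup W] [Module ℝ W]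
  [Fintype ι]

/-- Both sides are the same double sum over the matrix entries of $A$. For $A=h$ and $A=J$ it
carries $h$, and up to sign $J$, from one slot of a trace to the other. -/
lemma _root_.OrthonormalBasis.sum_transpose (b : OrthonormalBasis ι ℝ V) {A A' : V → V}
    (hA : ∀ x y, (inner ℝ (A x) y : ℝ) = inner ℝ x (A' y)) {T : V → V → W}
    (hT : IsBilinearMap ℝ T) : ∑ i, T (A (b i)) (b i) = ∑ i, T (b i) (A' (b i)) := by
  have h1 (i) : T (A (b i)) (b i) = ∑ j, (inner ℝ (b j) (A (b i)) : ℝ) • T (b j) (b i) := by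
    conv_lhs => rw [← b.sum_repr' (A (b i))]
    change hT.toLinearMap _ _ = _
    simp only [map_sum, map_smul, LinearMap.sum_apply, LinearMap.smul_apply]
    rfl
  have h2 (i) : T (b i) (A' (b i)) = ∑ j, (inner ℝ (b j) (A' (b i)) : ℝ) • T (b i) (b j) := by
    conv_lhs => rw [← b.sum_repr' (A' (b i))]
    change hT.toLinearMap _ _ = _
    simp only [map_sum, map_smul]
    rfl
  simp only [h1, h2, ← hA]
  rw [Finset.sum_comm]
  simp only [real_inner_comm]

/-- The values at a point of a `J`-anti-invariant symmetric endomorphism field `h` on a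
Kähler–Einstein manifold with `∂̄ h = 0` and `δ h = 0`, together with its first two covariant
derivatives and the curvature. -/
structure PointData (b : OrthonormalBasis ι ℝ V) (E : ℝ) where
  /-- the complex structure -/
  J : V →ₗ[ℝ] V
  /-- the endomorphism -/
  h : V →ₗ[ℝ] V
  /-- its first covariant derivative -/
  dh : V →ₗ[ℝ] V →ₗ[ℝ] V
  /-- its second covariant derivative -/
  ddh : V →ₗ[ℝ] V →ₗ[ℝ] V →ₗ[ℝ] V
  /-- the curvature -/
  R : V →ₗ[ℝ] V →ₗ[ℝ] V →ₗ[ℝ] V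
  J_sq : ∀ x, J (J x) = -x
  J_inner : ∀ x y, (inner ℝ (J x) y : ℝ) = -inner ℝ x (J y)
  h_inner : ∀ x y, (inner ℝ (h x) y : ℝ) = inner ℝ x (h y)
  h_J : ∀ x, h (J x) = -J (h x)
  dh_inner : ∀ w x y, (inner ℝ (dh w x) y : ℝ) = inner ℝ x (dh w y)
  dh_J : ∀ w x, dh w (J x) = -J (dh w x)
  dh_dbar : ∀ x y, dh x y + J (dh (J x) y) = dh y x + J (dh (J y) x)
  dh_div : ∑ i, dh (b i) (b i) = 0
  ddh_inner : ∀ v w x y, (inner ℝ (ddh v w x) y : ℝ) = inner ℝ x (ddh v w y)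
  ddh_J : ∀ v w x, ddh v w (J x) = -J (ddh v w x)
  ddh_dbar : ∀ w x y, ddh w x y + J (ddh w (J x) y) = ddh w y x + J (ddh w (J y) x)
  ddh_div : ∀ w, ∑ i, ddh w (b i) (b i) = 0
  ricci_identity : ∀ x y z, ddh x y z - ddh y x z = h (R x y z) - R x y (h z)
  R_antisymm : ∀ x y z, R x y z = -R y x z
  R_skew : ∀ x y z w, (inner ℝ (R x y z) w : ℝ) = -inner ℝ z (R x y w)
  R_pair : ∀ x y z w, (inner ℝ (R x y z) w : ℝ) = inner ℝ (R z w x) y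
  R_bianchi : ∀ x y z, R x y z + R y z x + R z x y = 0
  R_J : ∀ x y z, R x y (J z) = J (R x y z)
  einstein : ∀ x, ∑ i, R (b i) x (b i) = E • x

namespace PointData

variable {b : OrthonormalBasis ι ℝ V} {E : ℝ} (D : PointData b E) {T : V → V → W} {G : V →ₗ[ℝ] V}

lemma inner_bilin (f g : V →ₗ[ℝ] V) : IsBilinearMap ℝ fun u v => (inner ℝ (f u) (g v) : ℝ) :=
  isBilinearMap_inner f.isLinear g.isLinear

lemma J_inner_J (x y : V) : (inner ℝ (D.J x) (D.J y) : ℝ) = inner ℝ x y := by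
  rw [D.J_inner, D.J_sq, inner_neg_right, neg_neg]

lemma sum_h (hT : IsBilinearMap ℝ T) : ∑ i, T (D.h (b i)) (b i) = ∑ i, T (b i) (D.h (b i)) :=
  b.sum_transpose D.h_inner hT

lemma sum_J (hT : IsBilinearMap ℝ T) : ∑ i, T (D.J (b i)) (b i) = -∑ i, T (b i) (D.J (b i)) := by
  rw [b.sum_transpose (A' := fun x => -D.J x) (by simpa using D.J_inner) hT, ← Finset.sum_neg_distrib]
  refine Finset.sum_congr rfl fun i _ => ?_
  change hT.toLinearMap _ _ = - hT.toLinearMap _ _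
  rw [map_neg]

/-- Consequently a trace that changes sign when $e_i$ is replaced by $Je_i$ must vanish. This is the
mechanism of `first_order`. -/
lemma sum_J_J (hT : IsBilinearMap ℝ T) : ∑ i, T (D.J (b i)) (D.J (b i)) = ∑ i, T (b i) (b i) := by
  have h2 : IsBilinearMap ℝ fun x y => T x (D.J y) :=
    ⟨fun x y z => hT.add_left _ _ _, fun c x y => hT.smul_left _ _ _,
      fun x y z => by rw [map_add, hT.add_right], fun c x y => by rw [map_smul, hT.smul_right]⟩
  rw [D.sum_J h2, ← Finset.sum_neg_distrib]
  refine Finset.sum_congr rfl fun i _ => ?_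
  change - hT.toLinearMap _ _ = hT.toLinearMap _ _
  rw [D.J_sq, map_neg, neg_neg]

/-- $R(z,w)$ commutes with the orthogonal $J$, and pair symmetry carries this over to the first two
slots. -/
lemma R_J_J (x y z : V) : D.R (D.J x) (D.J y) z = D.R x y z := by
  refine ext_inner_right ℝ fun w => ?_
  rw [D.R_pair, D.R_J, D.J_inner_J, D.R_pair x]

lemma R_J_right (x y z : V) : D.R x (D.J y) z = -D.R (D.J x) y z := by
  rw [← D.R_J_J x, D.J_sq]
  simp

/-- The curvature action. -/
def rc (G : V →ₗ[ℝ] V) (y : V) : V := ∑ i, D.R (b i) y (G (b i))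

lemma rc_inner (hG : ∀ x y, (inner ℝ (G x) y : ℝ) = inner ℝ x (G y)) (y z : V) :
    (inner ℝ (D.rc G y) z : ℝ) = inner ℝ y (D.rc G z) := by
  have h1 := b.sum_transpose hG (T := fun u v => D.R u z v)
    ⟨by simp, by simp, by simp, by simp⟩
  rw [rc, rc, ← h1, sum_inner, inner_sum]
  refine Finset.sum_congr rfl fun i _ => ?_
  rw [D.R_pair, real_inner_comm]

lemma rc_J (y : V) : D.rc G (D.J y) = ∑ i, D.R (b i) y (G (D.J (b i))) := by
  have h1 := D.sum_J (T := fun u v => D.R u y (G v)) ⟨by simp, by simp, by simp, by simp⟩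
  rw [rc]
  simp only [D.R_J_right, Finset.sum_neg_distrib, h1, neg_neg]

lemma rc_h_J (y : V) : D.rc D.h (D.J y) = -D.J (D.rc D.h y) := by
  rw [rc_J, rc]
  simp [D.h_J, D.R_J]

lemma rc_J_comm (hG : ∀ x, G (D.J x) = D.J (G x)) (y : V) : D.rc G (D.J y) = D.J (D.rc G y) := by
  rw [rc_J, rc]
  simp [hG, D.R_J]

/-- The Bianchi identity splits $R(e_i,JGe_i)y$ into two terms. After moving $J$ and $G$ across the
trace, each of them sums to $J\mathring RG\,y$. For $G=\mathrm{id}$ this traces the curvature with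
$J$ to the Ricci endomorphism. -/
lemma sum_R_J (hG : ∀ x, G (D.J x) = D.J (G x))
    (hG' : ∀ x y, (inner ℝ (G x) y : ℝ) = inner ℝ x (G y)) (y : V) :
    ∑ i, D.R (b i) (D.J (G (b i))) y = (2 : ℝ) • D.J (D.rc G y) := by
  have h1 (i) : D.R (b i) (D.J (G (b i))) y =
      D.R (b i) y (D.J (G (b i))) - D.R (D.J (G (b i))) y (b i) := by
    have := D.R_bianchi (b i) (D.J (G (b i))) y
    rw [D.R_antisymm y (b i)] at this
    rw [← sub_eq_zero, ← this]
    abel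
  have h2 := D.sum_J (T := fun u v => D.R (G u) y v) ⟨by simp, by simp, by simp, by simp⟩
  have h3 := b.sum_transpose hG' (T := fun u v => D.R u y v) ⟨by simp, by simp, by simp, by simp⟩
  rw [Finset.sum_congr rfl fun i _ => h1 i, Finset.sum_sub_distrib]
  simp only [← hG, h2]
  simp only [hG, D.R_J, ← map_sum, h3]
  rw [rc, two_smul, sub_neg_eq_add]

lemma hh_J (x : V) : (D.h ∘ₗ D.h) (D.J x) = D.J ((D.h ∘ₗ D.h) x) := by simp [D.h_J]

lemma hh_inner (x y : V) : (inner ℝ ((D.h ∘ₗ D.h) x) y : ℝ) = inner ℝ x ((D.h ∘ₗ D.h) y) := by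
  simp [D.h_inner]

/-- Exchanging the two derivatives produces $\nabla_y$ of the divergence, which is zero. The Ricci
identity contributes the Ricci term and the curvature action. -/
lemma sum_ddh_right (y : V) : ∑ i, D.ddh (b i) y (b i) = E • D.h y - D.rc D.h y := by
  have h1 (i) : D.ddh (b i) y (b i) =
      D.ddh y (b i) (b i) + (D.h (D.R (b i) y (b i)) - D.R (b i) y (D.h (b i))) := by
    rw [← D.ricci_identity]; abel
  simp only [h1, Finset.sum_add_distrib, D.ddh_div, Finset.sum_sub_distrib, ← map_sum, D.einstein]
  simp [rc]

/-- The Weitzenböck formula. -/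
lemma sum_ddh_self (y : V) : ∑ i, D.ddh (b i) (b i) y = -(2 : ℝ) • D.rc D.h y := by
  -- The trace of the differentiated $\bar\partial$-equation: the Laplacian and a $J$-twisted trace
  -- on the left, two terms of the kind computed in `sum_ddh_right` on the right.
  have h1 : ∑ i, D.ddh (b i) (b i) y + D.J (∑ i, D.ddh (b i) (D.J (b i)) y) =
      ∑ i, D.ddh (b i) y (b i) + D.J (∑ i, D.ddh (b i) (D.J y) (b i)) := by
    simp only [map_sum, ← Finset.sum_add_distrib]
    exact Finset.sum_congr rfl fun i _ => D.ddh_dbar _ _ _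
  -- As $J$ is skew, the twisted trace only sees the antisymmetric part of $\nabla^2h$, which is
  -- curvature.
  have h2 : (2 : ℝ) • ∑ i, D.ddh (b i) (D.J (b i)) y =
      ∑ i, (D.ddh (b i) (D.J (b i)) y - D.ddh (D.J (b i)) (b i) y) := by
    have := D.sum_J (T := fun u v => D.ddh u v y) ⟨by simp, by simp, by simp, by simp⟩
    rw [Finset.sum_sub_distrib, this, two_smul, sub_neg_eq_add]
  have h3 (y : V) : ∑ i, D.R (b i) (D.J (b i)) y = (2 : ℝ) • D.J (E • y) := by
    have := D.sum_R_J (G := LinearMap.id) (by simp) (by simp) y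
    simp only [LinearMap.id_apply, rc, D.einstein] at this
    exact this
  simp only [D.ricci_identity, Finset.sum_sub_distrib, ← map_sum, h3] at h2
  have h4 : ∑ i, D.ddh (b i) (D.J (b i)) y = -(2 * E) • D.J (D.h y) := by
    have h5 : ∑ i, D.ddh (b i) (D.J (b i)) y =
      (1 / 2 : ℝ) • (2 : ℝ) • ∑ i, D.ddh (b i) (D.J (b i)) y := by rw [smul_smul]; norm_num
    rw [h5, h2]
    simp only [map_smul, D.h_J]
    module
  rw [sum_ddh_right, sum_ddh_right, h4] at h1
  simp only [map_smul, map_neg, map_sub, D.J_sq, D.h_J, rc_h_J] at h1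
  rw [← sub_eq_zero] at h1 ⊢
  rw [← h1]
  module

/-- `∑ ⟨(∇²_{y,e_i} h) z, h e_i⟩` -/
def K' (y z : V) : ℝ := ∑ i, inner ℝ (D.ddh y (b i) z) (D.h (b i))

/-- `∑ ⟨(∇²_{y,z} h) e_i, h e_i⟩` -/
def U (y z : V) : ℝ := ∑ i, inner ℝ (D.ddh y z (b i)) (D.h (b i))

/-- By the Ricci identity the antisymmetric part is the commutator of $h$ with $R(y,z)$ traced
against $h$. It vanishes because $R(y,z)$ is skew while $h$ and $h^2$ are symmetric. -/
lemma U_symm (y z : V) : D.U y z = D.U z y := by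
  have h1 := D.sum_h (T := fun u v => (inner ℝ u (D.R y z (D.h v)) : ℝ)) (inner_bilin LinearMap.id (D.R y z ∘ₗ D.h))
  have h0 (G : V →ₗ[ℝ] V) (hG : ∀ x y, (inner ℝ (G x) y : ℝ) = inner ℝ x (G y)) :
      ∑ i, (inner ℝ (b i) (D.R y z (G (b i))) : ℝ) = 0 := by
    have h2 := b.sum_transpose hG (T := fun u v => (inner ℝ u (D.R y z v) : ℝ)) (inner_bilin LinearMap.id (D.R y z))
    have h3 : ∑ i, (inner ℝ (G (b i)) (D.R y z (b i)) : ℝ) =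
        -∑ i, (inner ℝ (b i) (D.R y z (G (b i))) : ℝ) := by
      rw [← Finset.sum_neg_distrib]
      refine Finset.sum_congr rfl fun i _ => ?_
      rw [real_inner_comm, D.R_skew]
    linarith
  have h2 := h0 _ D.hh_inner
  have h3 : ∑ i, (inner ℝ (D.h (D.R y z (b i)) - D.R y z (D.h (b i))) (D.h (b i)) : ℝ) = 0 := by
    simp only [inner_sub_left, Finset.sum_sub_distrib]
    have h4 : ∑ i, (inner ℝ (D.h (D.R y z (b i))) (D.h (b i)) : ℝ) = 0 := by
      rw [← neg_eq_zero, ← h2, ← Finset.sum_neg_distrib]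
      refine Finset.sum_congr rfl fun i _ => ?_
      rw [D.h_inner, D.R_skew, neg_neg]
      rfl
    have h5 (i) : (inner ℝ (D.R y z (D.h (b i))) (D.h (b i)) : ℝ) = 0 := by
      linarith [D.R_skew y z (D.h (b i)) (D.h (b i)),
        real_inner_comm (D.R y z (D.h (b i))) (D.h (b i))]
    simp [h4, h5]
  rw [← sub_eq_zero, U, U, ← Finset.sum_sub_distrib, ← h3]
  refine Finset.sum_congr rfl fun i _ => ?_
  rw [← inner_sub_left, D.ricci_identity]

/-- `-∑ ⟨(∇²_{y,Jz} h) e_i, J h e_i⟩` -/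
def V' (y z : V) : ℝ := -∑ i, inner ℝ (D.ddh y (D.J z) (b i)) (D.J (D.h (b i)))

/-- Since $hJ=-Jh$, writing the trace over $Je_i$ gives a second expression for $K'$. In the sum of
both the $\bar\partial$-equation trades the derivative along $e_i$ for derivatives along $z$ and
$Jz$. -/
lemma two_mul_K' (y z : V) : 2 * D.K' y z = D.U y z + D.V' y z := by
  have h1 : ∑ i, (inner ℝ (D.ddh y (D.J (b i)) z) (D.h (D.J (b i))) : ℝ) = D.K' y z :=
    D.sum_J_J (inner_bilin ((D.ddh y).flip z) D.h)
  rw [two_mul]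
  nth_rw 1 [← h1]
  rw [U, V', K', ← sub_eq_add_neg, ← Finset.sum_add_distrib, ← Finset.sum_sub_distrib]
  refine Finset.sum_congr rfl fun i _ => ?_
  have h2 := congrArg (fun u => (inner ℝ u (D.h (b i)) : ℝ)) (D.ddh_dbar y (b i) z)
  simp only [inner_add_left, D.J_inner] at h2
  rw [D.h_J, inner_neg_right]
  linarith

/-- The two terms form the antisymmetrisation of $\nabla^2h$ in the directions $Jy$ and $z$. The
Ricci identity turns it into curvature, which `sum_R_J` evaluates with $G=h^2$. -/
lemma V'_add (y z : V) : D.V' (D.J y) (D.J z) + D.V' z y =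
    4 * inner ℝ (D.rc (D.h ∘ₗ D.h) y) z := by
  have h1 : ∑ i, (inner ℝ (D.R (D.J y) z (D.h (b i))) (D.J (D.h (b i))) : ℝ) =
      ∑ i, (inner ℝ (D.R (D.J y) z (b i)) (D.J (D.h (D.h (b i)))) : ℝ) :=
    D.sum_h (inner_bilin (D.R (D.J y) z) (D.J ∘ₗ D.h))
  have h2 : ∑ i, (inner ℝ (D.R (D.J y) z (b i)) (D.J (D.h (D.h (b i)))) : ℝ) =
      -2 * inner ℝ (D.rc (D.h ∘ₗ D.h) y) z := by
    have h3 := D.sum_R_J D.hh_J D.hh_inner (D.J y)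
    rw [D.rc_J_comm D.hh_J, D.J_sq] at h3
    have h4 := congrArg (fun u => (inner ℝ u z : ℝ)) h3
    rw [sum_inner, inner_smul_left, inner_neg_left] at h4
    simp only [D.R_pair (D.J y)]
    refine h4.trans ?_
    simp
  have h3 : D.V' (D.J y) (D.J z) + D.V' z y =
      ∑ i, (inner ℝ (D.h (D.R (D.J y) z (b i)) - D.R (D.J y) z (D.h (b i))) (D.J (D.h (b i))) : ℝ) := by
    simp only [V', ← D.ricci_identity, D.J_sq, map_neg, LinearMap.neg_apply, inner_neg_left,
      Finset.sum_neg_distrib, inner_sub_left, Finset.sum_sub_distrib]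
    ring
  rw [h3]
  simp only [inner_sub_left, Finset.sum_sub_distrib, D.h_inner, D.h_J, h1, h2, inner_neg_right,
    Finset.sum_neg_distrib]
  ring

lemma sum_ddh_h (y z : V) : ∑ i, (inner ℝ (D.ddh (b i) y (D.h (b i))) z : ℝ) =
    D.K' y z + inner ℝ (D.h (D.rc D.h y)) z - inner ℝ (D.rc (D.h ∘ₗ D.h) y) z := by
  rw [K', rc, rc, map_sum, sum_inner, sum_inner, ← Finset.sum_add_distrib, ← Finset.sum_sub_distrib]
  refine Finset.sum_congr rfl fun i _ => ?_
  have h1 := congrArg (fun u => (inner ℝ u z : ℝ)) (D.ricci_identity (b i) y (D.h (b i)))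
  rw [inner_sub_left, inner_sub_left, D.ddh_inner y (b i) (D.h (b i)), real_inner_comm] at h1
  simp only [LinearMap.comp_apply]
  linarith [real_inner_comm (D.ddh y (b i) z) (D.h (b i)),
    real_inner_comm (D.ddh (b i) y (D.h (b i))) z]

/-- The $\bar\partial$-equation moves $he_i$ out of the direction of differentiation. The curvature
terms of `sum_ddh_h` at $(y,z)$ and $(Jy,Jz)$ then agree and cancel. -/
lemma sum_ddh_h_left (y z : V) : ∑ i, (inner ℝ (D.ddh (b i) (D.h (b i)) y) z : ℝ) +
    ∑ i, (inner ℝ (D.J (D.ddh (b i) (D.J (D.h (b i))) y)) z : ℝ) = D.K' y z - D.K' (D.J y) (D.J z) := by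
  have h1 : ∑ i, (inner ℝ (D.ddh (b i) (D.h (b i)) y) z : ℝ) +
      ∑ i, (inner ℝ (D.J (D.ddh (b i) (D.J (D.h (b i))) y)) z : ℝ) =
      ∑ i, (inner ℝ (D.ddh (b i) y (D.h (b i))) z : ℝ) -
      ∑ i, (inner ℝ (D.ddh (b i) (D.J y) (D.h (b i))) (D.J z) : ℝ) := by
    rw [← Finset.sum_add_distrib, ← Finset.sum_sub_distrib]
    refine Finset.sum_congr rfl fun i _ => ?_
    rw [← inner_add_left, D.ddh_dbar, inner_add_left, D.J_inner, sub_eq_add_neg]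
  rw [h1, sum_ddh_h, sum_ddh_h, D.rc_J_comm D.hh_J, D.rc_h_J, map_neg, D.h_J, neg_neg, D.J_inner_J,
    D.J_inner_J]
  ring

/-- By `sum_ddh_h_left` this is a formula for $K'(z,y)+K'(Jy,Jz)$. `two_mul_K'` turns the sum into
$U$ and $V'$, and `V'_add` evaluates the $V'$ part. -/
lemma second_order (y z : V) :
    D.K' y z + D.K' z y - 2 * inner ℝ (D.rc (D.h ∘ₗ D.h) y) z - (D.U y z + D.U (D.J y) (D.J z)) / 2 =
      ∑ i, (inner ℝ (D.ddh (b i) (D.h (b i)) y) z : ℝ) +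
        ∑ i, (inner ℝ (D.J (D.ddh (b i) (D.J (D.h (b i))) y)) z : ℝ) := by
  rw [sum_ddh_h_left]
  linarith [D.two_mul_K' z y, D.two_mul_K' (D.J y) (D.J z), D.V'_add y z, D.U_symm y z]

/-- The holomorphic part of the first derivative. -/
def B : V →ₗ[ℝ] V →ₗ[ℝ] V := D.dh + (D.dh ∘ₗ D.J).compr₂ D.J

/-- The antiholomorphic part of the first derivative. -/
def C : V →ₗ[ℝ] V →ₗ[ℝ] V := D.dh - (D.dh ∘ₗ D.J).compr₂ D.J

lemma B_apply (x y : V) : D.B x y = D.dh x y + D.J (D.dh (D.J x) y) := rfl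

lemma C_apply (x y : V) : D.C x y = D.dh x y - D.J (D.dh (D.J x) y) := rfl

lemma B_symm (x y : V) : D.B x y = D.B y x := D.dh_dbar x y

lemma dh_eq (x y : V) : D.dh x y = (1 / 2 : ℝ) • (D.B x y + D.C x y) := by
  rw [B_apply, C_apply]; module

lemma d_eq (x y : V) : D.dh x y - D.dh y x = (1 / 2 : ℝ) • (D.C x y - D.C y x) := by
  rw [dh_eq, dh_eq, D.B_symm x y]; module

lemma B_J_left (x y : V) : D.B (D.J x) y = -D.J (D.B x y) := by
  simp only [B_apply, D.J_sq, map_neg, LinearMap.neg_apply, map_add]; abel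

lemma C_J_left (x y : V) : D.C (D.J x) y = D.J (D.C x y) := by
  simp only [C_apply, D.J_sq, map_neg, LinearMap.neg_apply, map_sub]; abel

lemma C_J_right (x y : V) : D.C x (D.J y) = -D.J (D.C x y) := by
  simp only [C_apply, D.dh_J, map_neg, map_sub]; abel

lemma J_dh_inner (w x y : V) : (inner ℝ (D.J (D.dh w x)) y : ℝ) = inner ℝ x (D.J (D.dh w y)) := by
  rw [D.J_inner, D.dh_inner, D.dh_J, inner_neg_right, neg_neg]

lemma C_inner (w x y : V) : (inner ℝ (D.C w x) y : ℝ) = inner ℝ x (D.C w y) := by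
  simp only [C_apply, inner_sub_left, inner_sub_right, D.dh_inner, D.J_dh_inner]

/-- In terms of $B$ and $C$ every sum is a combination of $\sum\langle B_{e_i}y,B_{e_i}z\rangle$,
$\sum\langle C_{e_i}y,C_{e_i}z\rangle$, $\sum\langle C_ye_i,C_ze_i\rangle$ and $\sum\langle
C_{C_{e_i}y}e_i,z\rangle$. The first three cancel, and the last is what $\delta[h,h]^c$ contains. -/
lemma first_order (y z : V) :
    -(∑ i, (inner ℝ (D.dh (b i) (D.dh (b i) y) - D.dh (D.dh (b i) y) (b i)) z : ℝ)
      + ∑ i, (inner ℝ (D.dh (b i) (D.dh (b i) z) - D.dh (D.dh (b i) z) (b i)) y : ℝ))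
    + ∑ i, (inner ℝ (D.dh (b i) (D.dh (b i) y)) z : ℝ)
    + ∑ i, (inner ℝ (D.dh y (b i) - D.dh (b i) y) (D.dh z (b i) - D.dh (b i) z) : ℝ)
    - (∑ i, (inner ℝ (D.dh y (b i)) (D.dh z (b i)) : ℝ)
      + ∑ i, (inner ℝ (D.dh (D.J y) (b i)) (D.dh (D.J z) (b i)) : ℝ)) / 2 =
    ∑ i, (inner ℝ (D.dh (D.dh (b i) y) (b i) - D.J (D.dh (D.J (D.dh (b i) y)) (b i))) z : ℝ) := by
  -- The sums in `e1`, `e2` and `e3` change sign under $e_i\mapsto Je_i$, because $B_{JX}=-JB_X$,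
  -- $C_{JX}=JC_X$ and $C_XJ=-JC_X$.
  have e1 (y z : V) : ∑ i, (inner ℝ (D.B (b i) y) (D.C (b i) z) : ℝ) = 0 := by
    have h1 : ∑ i, (inner ℝ (D.B (D.J (b i)) y) (D.C (D.J (b i)) z) : ℝ) =
        ∑ i, (inner ℝ (D.B (b i) y) (D.C (b i) z) : ℝ) :=
      D.sum_J_J (inner_bilin (D.B.flip y) (D.C.flip z))
    simp only [D.B_J_left, D.C_J_left, inner_neg_left, D.J_inner_J, Finset.sum_neg_distrib] at h1
    linarith
  have e2 (y z : V) : ∑ i, (inner ℝ (D.C (D.B (b i) y) (b i)) z : ℝ) = 0 := by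
    have h1 : ∑ i, D.C (D.B (D.J (b i)) y) (D.J (b i)) = ∑ i, D.C (D.B (b i) y) (b i) :=
      D.sum_J_J (T := fun u v => D.C (D.B u y) v) ⟨by simp, by simp, by simp, by simp⟩
    simp only [D.B_J_left, D.C_J_left, D.C_J_right, map_neg, LinearMap.neg_apply, D.J_sq, neg_neg,
      Finset.sum_neg_distrib] at h1
    have h2 := congrArg (fun u => (inner ℝ u z : ℝ)) h1
    rw [inner_neg_left, sum_inner] at h2
    linarith
  have e3 (y z : V) : ∑ i, (inner ℝ (D.C y (b i)) (D.C (b i) z) : ℝ) = 0 := by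
    have h1 : ∑ i, (inner ℝ (D.C y (D.J (b i))) (D.C (D.J (b i)) z) : ℝ) =
        ∑ i, (inner ℝ (D.C y (b i)) (D.C (b i) z) : ℝ) :=
      D.sum_J_J (inner_bilin (D.C y) (D.C.flip z))
    simp only [D.C_J_right, D.C_J_left, inner_neg_left, D.J_inner_J, Finset.sum_neg_distrib] at h1
    linarith
  -- As $C_X$ is symmetric, this is a double sum of products in which swapping $y$ and $z$ amounts
  -- to swapping the indices.
  have e4 : ∑ i, (inner ℝ (D.C (D.C (b i) y) (b i)) z : ℝ) =
      ∑ i, (inner ℝ (D.C (D.C (b i) z) (b i)) y : ℝ) := by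
    have h1 (y z : V) : ∑ i, (inner ℝ (D.C (D.C (b i) y) (b i)) z : ℝ) =
        ∑ i, ∑ k, (inner ℝ (b k) (D.C (b i) y) : ℝ) * inner ℝ (b i) (D.C (b k) z) := by
      refine Finset.sum_congr rfl fun i _ => ?_
      conv_lhs => rw [← b.sum_repr' (D.C (b i) y)]
      simp only [map_sum, map_smul, LinearMap.sum_apply, LinearMap.smul_apply, sum_inner,
        inner_smul_left, D.C_inner]
      rfl
    rw [h1, h1, Finset.sum_comm]
    simp only [mul_comm]
  have e5 : ∑ i, (inner ℝ (D.C (b i) y) (D.C (b i) z) : ℝ) =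
      ∑ i, (inner ℝ (D.C (b i) z) (D.C (b i) y) : ℝ) := by simp only [real_inner_comm]
  have t1 (y z : V) : ∑ i, (inner ℝ (D.dh (b i) (D.dh (b i) y) - D.dh (D.dh (b i) y) (b i)) z : ℝ) =
      (∑ i, (inner ℝ (D.C (b i) y) (D.C (b i) z) : ℝ)
        - ∑ i, (inner ℝ (D.C (D.C (b i) y) (b i)) z : ℝ)) / 4 := by
    have h1 (i) : (inner ℝ (D.dh (b i) (D.dh (b i) y) - D.dh (D.dh (b i) y) (b i)) z : ℝ) =
        (inner ℝ (D.B (b i) y) (D.C (b i) z) + inner ℝ (D.C (b i) y) (D.C (b i) z)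
          - inner ℝ (D.C (D.B (b i) y) (b i)) z - inner ℝ (D.C (D.C (b i) y) (b i)) z) / 4 := by
      rw [d_eq, dh_eq]
      simp only [map_smul, map_add, LinearMap.smul_apply, LinearMap.add_apply, inner_smul_left,
        inner_sub_left, inner_add_left, D.C_inner, conj_trivial]
      ring
    simp only [h1, ← Finset.sum_div, Finset.sum_sub_distrib, Finset.sum_add_distrib, e1, e2]
    ring
  have t2 : ∑ i, (inner ℝ (D.dh (b i) (D.dh (b i) y)) z : ℝ) =
      (∑ i, (inner ℝ (D.B (b i) y) (D.B (b i) z) : ℝ)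
        + ∑ i, (inner ℝ (D.C (b i) y) (D.C (b i) z) : ℝ)) / 4 := by
    have h1 (i) : (inner ℝ (D.dh (b i) (D.dh (b i) y)) z : ℝ) =
        (inner ℝ (D.B (b i) y) (D.B (b i) z) + inner ℝ (D.C (b i) y) (D.C (b i) z)
          + inner ℝ (D.B (b i) y) (D.C (b i) z) + inner ℝ (D.B (b i) z) (D.C (b i) y)) / 4 := by
      rw [D.dh_inner, D.dh_eq, D.dh_eq]
      simp only [inner_smul_left, inner_smul_right, inner_add_left, inner_add_right, conj_trivial,
        real_inner_comm (D.B (b i) z)]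
      ring
    simp only [h1, ← Finset.sum_div, Finset.sum_add_distrib, e1]
    ring
  have t3 : ∑ i, (inner ℝ (D.dh y (b i) - D.dh (b i) y) (D.dh z (b i) - D.dh (b i) z) : ℝ) =
      (∑ i, (inner ℝ (D.C y (b i)) (D.C z (b i)) : ℝ)
        + ∑ i, (inner ℝ (D.C (b i) y) (D.C (b i) z) : ℝ)) / 4 := by
    have h1 (i) : (inner ℝ (D.dh y (b i) - D.dh (b i) y) (D.dh z (b i) - D.dh (b i) z) : ℝ) =
        (inner ℝ (D.C y (b i)) (D.C z (b i)) + inner ℝ (D.C (b i) y) (D.C (b i) z)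
          - inner ℝ (D.C y (b i)) (D.C (b i) z) - inner ℝ (D.C z (b i)) (D.C (b i) y)) / 4 := by
      rw [D.d_eq, D.d_eq]
      simp only [inner_smul_left, inner_smul_right, inner_sub_left, inner_sub_right, conj_trivial,
        real_inner_comm (D.C z (b i))]
      ring
    simp only [h1, ← Finset.sum_div, Finset.sum_add_distrib, Finset.sum_sub_distrib, e3]
    ring
  have t4 : ∑ i, (inner ℝ (D.dh y (b i)) (D.dh z (b i)) : ℝ)
      + ∑ i, (inner ℝ (D.dh (D.J y) (b i)) (D.dh (D.J z) (b i)) : ℝ) =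
      (∑ i, (inner ℝ (D.B (b i) y) (D.B (b i) z) : ℝ)
        + ∑ i, (inner ℝ (D.C y (b i)) (D.C z (b i)) : ℝ)) / 2 := by
    simp only [← Finset.sum_add_distrib, Finset.sum_div]
    refine Finset.sum_congr rfl fun i _ => ?_
    simp only [dh_eq, D.B_J_left, D.C_J_left, inner_smul_left, inner_smul_right, inner_add_left,
      inner_add_right, inner_neg_left, inner_neg_right, D.J_inner_J, conj_trivial, D.B_symm (b i)]
    ring
  have t5 : ∑ i, (inner ℝ (D.dh (D.dh (b i) y) (b i) - D.J (D.dh (D.J (D.dh (b i) y)) (b i))) z : ℝ) =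
      (∑ i, (inner ℝ (D.C (D.C (b i) y) (b i)) z : ℝ)) / 2 := by
    have h1 (i) : (inner ℝ (D.dh (D.dh (b i) y) (b i) - D.J (D.dh (D.J (D.dh (b i) y)) (b i))) z : ℝ) =
        (inner ℝ (D.C (D.B (b i) y) (b i)) z + inner ℝ (D.C (D.C (b i) y) (b i)) z) / 2 := by
      rw [← C_apply, dh_eq]
      simp only [map_smul, map_add, LinearMap.smul_apply, LinearMap.add_apply, inner_smul_left,
        inner_add_left, conj_trivial]
      ring
    simp only [h1, ← Finset.sum_div, Finset.sum_add_distrib, e2]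
    ring
  rw [t1, t1, t2, t3, t4, t5, ← e4, ← e5]
  ring

/-- The second covariant derivative of `h²`. -/
def ddhh (w x y : V) : V :=
  D.ddh w x (D.h y) + D.dh x (D.dh w y) + D.dh w (D.dh x y) + D.h (D.ddh w x y)

/-- The covariant derivative of `d_∇ h`. -/
def dD (w x y : V) : V := D.ddh w x y - D.ddh w y x

/-- `δ d_∇ h` -/
def S (y : V) : V := -∑ i, D.dD (b i) (b i) y

/-- `δ (h ♯ d_∇ h)` -/
def divSharp (y : V) : V := -∑ i, (D.dD (b i) (D.h (b i)) y
  + (D.dh (D.dh (b i) (b i)) y - D.dh y (D.dh (b i) (b i)))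
  + D.dD (b i) (b i) (D.h y) + (D.dh (b i) (D.dh (b i) y) - D.dh (D.dh (b i) y) (b i)))

/-- The bilinear form whose symmetrisation is `𝐯(h, h)`. -/
def v (y z : V) : ℝ :=
  inner ℝ (-∑ i, (D.ddhh (b i) (b i) y - D.ddhh (b i) y (b i)) - (2 : ℝ) • D.divSharp y
      + D.h (D.S y) + D.S (D.h y)) z
    - ∑ i, inner ℝ (D.dh y (b i) - D.dh (b i) y) (D.dh z (b i) - D.dh (b i) z)

/-- Half of the Hessian of `tr h²`. -/
def hess (y z : V) : ℝ := D.U y z + ∑ i, inner ℝ (D.dh y (b i)) (D.dh z (b i))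

/-- The Weitzenböck formula contributes $2\mathring Rh$ and the divergence-type term $Eh-\mathring
Rh$. -/
lemma S_eq (y : V) : D.S y = D.rc D.h y + E • D.h y := by
  simp only [S, dD, Finset.sum_sub_distrib, D.sum_ddh_self, D.sum_ddh_right]
  module

/-- `δ[h, h]^c`, up to a factor -/
def ks (y : V) : V := ∑ i, (D.ddh (b i) (D.h y) (b i) + D.dh (D.dh (b i) y) (b i)
    - D.J (D.ddh (b i) (D.J (D.h y)) (b i)) - D.J (D.dh (D.J (D.dh (b i) y)) (b i))
    - (D.ddh (b i) (D.h (b i)) y + D.dh (D.dh (b i) (b i)) y)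
    + D.J (D.ddh (b i) (D.J (D.h (b i))) y) + D.J (D.dh (D.J (D.dh (b i) (b i))) y))

lemma sum_comp_dh_div (T : V →ₗ[ℝ] W) : ∑ i, T (D.dh (b i) (b i)) = 0 := by
  rw [← map_sum, D.dh_div, map_zero]

/-- Derivatives in the directions $\sum_i(\nabla_{e_i}h)e_i$ and its image under $J$ vanish by
$\delta h=0$. The trace $\sum_i(\nabla^2_{e_i,hy}h)e_i$ cancels its $J$-conjugate, because
$Eh-\mathring Rh$ anticommutes with $J$. -/
lemma ks_inner (y z : V) : (inner ℝ (D.ks y) z : ℝ) =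
    ∑ i, (inner ℝ (D.dh (D.dh (b i) y) (b i) - D.J (D.dh (D.J (D.dh (b i) y)) (b i))) z : ℝ)
      - ∑ i, (inner ℝ (D.ddh (b i) (D.h (b i)) y) z : ℝ)
      + ∑ i, (inner ℝ (D.J (D.ddh (b i) (D.J (D.h (b i))) y)) z : ℝ) := by
  have h1 := D.sum_comp_dh_div (D.dh.flip y)
  have h2 := D.sum_comp_dh_div (((D.dh ∘ₗ D.J).compr₂ D.J).flip y)
  have h3 : ∑ i, D.J (D.ddh (b i) (D.J (D.h y)) (b i)) = ∑ i, D.ddh (b i) (D.h y) (b i) := by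
    rw [← map_sum, sum_ddh_right, sum_ddh_right, rc_h_J, D.h_J]
    simp only [map_sub, map_neg, map_smul, D.J_sq]
    module
  have h4 : D.ks y = ∑ i, (D.dh (D.dh (b i) y) (b i) - D.J (D.dh (D.J (D.dh (b i) y)) (b i)))
      - ∑ i, D.ddh (b i) (D.h (b i)) y + ∑ i, D.J (D.ddh (b i) (D.J (D.h (b i))) y) := by
    simp only [LinearMap.flip_apply, LinearMap.compr₂_apply, LinearMap.comp_apply] at h1 h2
    simp only [ks, Finset.sum_add_distrib, Finset.sum_sub_distrib, h1, h2, h3]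
    abel
  rw [h4, inner_add_left, inner_sub_left, sum_inner, sum_inner, sum_inner]

lemma sum_ddhh_self (y z : V) : (inner ℝ (∑ i, D.ddhh (b i) (b i) y) z : ℝ) =
    -2 * inner ℝ (D.rc D.h (D.h y)) z - 2 * inner ℝ (D.h (D.rc D.h y)) z
      + 2 * ∑ i, (inner ℝ (D.dh (b i) (D.dh (b i) y)) z : ℝ) := by
  have h1 : ∑ i, D.ddhh (b i) (b i) y = -(2 : ℝ) • D.rc D.h (D.h y)
      + D.h (-(2 : ℝ) • D.rc D.h y) + (2 : ℝ) • ∑ i, D.dh (b i) (D.dh (b i) y) := by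
    simp only [ddhh, Finset.sum_add_distrib, D.sum_ddh_self, ← map_sum]
    module
  rw [h1]
  simp only [inner_add_left, inner_smul_left, map_smul, sum_inner, conj_trivial]
  ring

/-- The Ricci identity for $h^2$, assembled from the one for $h$. The reordered trace is left
unevaluated, since it cancels against the gauge term $\delta^*\delta h^2$ in `main`. -/
lemma sum_ddhh_right (y z : V) : (inner ℝ (∑ i, D.ddhh (b i) y (b i)) z : ℝ) =
    ∑ i, (inner ℝ (D.ddhh y (b i) (b i)) z : ℝ) + E * inner ℝ (D.h (D.h y)) z
      - inner ℝ (D.rc (D.h ∘ₗ D.h) y) z := by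
  have h1 (i) : D.ddhh (b i) y (b i) = D.ddhh y (b i) (b i)
      + (D.h (D.h (D.R (b i) y (b i))) - D.R (b i) y (D.h (D.h (b i)))) := by
    have e1 := D.ricci_identity (b i) y (D.h (b i))
    have e2 := congrArg D.h (D.ricci_identity (b i) y (b i))
    rw [map_sub, map_sub] at e2
    have e3 : D.ddhh (b i) y (b i) - D.ddhh y (b i) (b i) =
        (D.ddh (b i) y (D.h (b i)) - D.ddh y (b i) (D.h (b i)))
        + (D.h (D.ddh (b i) y (b i)) - D.h (D.ddh y (b i) (b i))) := by
      simp only [ddhh]; abel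
    rw [← sub_eq_iff_eq_add', e3, e1, e2]
    abel
  simp only [h1, Finset.sum_add_distrib, Finset.sum_sub_distrib, ← map_sum, D.einstein,
    inner_add_left, inner_sub_left, map_smul, inner_smul_left, conj_trivial, sum_inner, rc,
    LinearMap.comp_apply]
  ring

/-- The contributions of $S=\delta d_\nabla h$ combine to $hS-Sh$, in which the multiple $Eh$ drops
out and only the commutator of $h$ with $\mathring Rh$ remains. -/
lemma v_eq (y z : V) : D.v y z =
    -inner ℝ (∑ i, D.ddhh (b i) (b i) y) z + inner ℝ (∑ i, D.ddhh (b i) y (b i)) z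
    + 2 * ∑ i, (inner ℝ (D.ddh (b i) (D.h (b i)) y) z : ℝ)
    - 2 * ∑ i, (inner ℝ (D.ddh (b i) y (D.h (b i))) z : ℝ)
    + 2 * ∑ i, (inner ℝ (D.dh (b i) (D.dh (b i) y) - D.dh (D.dh (b i) y) (b i)) z : ℝ)
    + inner ℝ (D.h (D.rc D.h y)) z - inner ℝ (D.rc D.h (D.h y)) z
    - ∑ i, inner ℝ (D.dh y (b i) - D.dh (b i) y) (D.dh z (b i) - D.dh (b i) z) := by
  have h1 := D.sum_comp_dh_div (D.dh.flip y)
  have h2 := D.sum_comp_dh_div (D.dh y)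
  simp only [LinearMap.flip_apply] at h1
  have h3 : D.divSharp y = -∑ i, D.ddh (b i) (D.h (b i)) y + ∑ i, D.ddh (b i) y (D.h (b i))
      + D.S (D.h y) - ∑ i, (D.dh (b i) (D.dh (b i) y) - D.dh (D.dh (b i) y) (b i)) := by
    simp only [divSharp, S, dD, Finset.sum_add_distrib, Finset.sum_sub_distrib, h1, h2]
    abel
  rw [v, h3]
  simp only [D.S_eq, Finset.sum_sub_distrib, inner_add_left, inner_sub_left, inner_neg_left,
    inner_smul_left, conj_trivial, map_add, map_smul, sum_inner]
  ring

/-- The terms $Eh^2$ and $\sum_i(\nabla^2_{y,e_i}h^2)e_i$ cancel between $\mathbf v$ and the rest,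
and the products of $h$ with $\mathring Rh$ cancel between $\mathbf v$ and $\nabla^*\nabla h^2$.
Once the symmetric sums are brought to a common order of $y$ and $z$, what is left is `second_order`
plus `first_order`. -/
theorem main (y z : V) :
    E * inner ℝ (D.h (D.h y)) z - (D.v y z + D.v z y) / 2
      + (1 / 2) * (inner ℝ (-∑ i, D.ddhh (b i) (b i) y) z
        - 2 * inner ℝ (D.rc (D.h ∘ₗ D.h) y) z
        - 2 * (((-∑ i, inner ℝ (D.ddhh y (b i) (b i)) z + D.hess y z)
          + (-∑ i, inner ℝ (D.ddhh z (b i) (b i)) y + D.hess z y)) / 2)) =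
      inner ℝ (D.ks y) z - (1 / 2) * (D.hess y z - D.hess (D.J y) (D.J z)) := by
  have hL (y z : V) : ∑ i, (inner ℝ (D.ddh (b i) (D.h (b i)) y) z : ℝ) =
      ∑ i, (inner ℝ (D.ddh (b i) (D.h (b i)) z) y : ℝ) :=
    Finset.sum_congr rfl fun i _ => by rw [D.ddh_inner, real_inner_comm]
  have hA (y z : V) : ∑ i, (inner ℝ (D.dh (b i) (D.dh (b i) y)) z : ℝ) =
      ∑ i, (inner ℝ (D.dh (b i) (D.dh (b i) z)) y : ℝ) :=
    Finset.sum_congr rfl fun i _ => by rw [D.dh_inner, D.dh_inner, real_inner_comm]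
  have hP : ∑ i, (inner ℝ (D.dh z (b i) - D.dh (b i) z) (D.dh y (b i) - D.dh (b i) y) : ℝ) =
      ∑ i, inner ℝ (D.dh y (b i) - D.dh (b i) y) (D.dh z (b i) - D.dh (b i) z) :=
    Finset.sum_congr rfl fun i _ => by rw [real_inner_comm]
  have hQ : ∑ i, (inner ℝ (D.dh z (b i)) (D.dh y (b i)) : ℝ) =
      ∑ i, inner ℝ (D.dh y (b i)) (D.dh z (b i)) :=
    Finset.sum_congr rfl fun i _ => by rw [real_inner_comm]
  have hG : (inner ℝ (D.h (D.h z)) y : ℝ) = inner ℝ (D.h (D.h y)) z := by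
    rw [D.h_inner, D.h_inner, real_inner_comm]
  have hrG : (inner ℝ (D.rc (D.h ∘ₗ D.h) z) y : ℝ) = inner ℝ (D.rc (D.h ∘ₗ D.h) y) z := by
    rw [D.rc_inner D.hh_inner, real_inner_comm]
  have hr (y z : V) : (inner ℝ (D.h (D.rc D.h z)) y : ℝ) = inner ℝ (D.rc D.h (D.h y)) z := by
    rw [D.h_inner, D.rc_inner D.h_inner, real_inner_comm]
  rw [D.ks_inner, D.v_eq, D.v_eq, inner_neg_left]
  simp only [D.sum_ddhh_self, D.sum_ddhh_right, D.sum_ddh_h, hess]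
  rw [hL z y, hA z y, hP, hQ, hG, hrG, hr y z, hr z y, D.U_symm z y]
  linarith [D.second_order y z, D.first_order y z]

end PointData
end algebra

/-! ### Duals of forms and the divergence of a contraction -/

section dual

variable {x : M} {A : Tensor1 n M} {α D : Tensor2 n M}

/-- The vector field dual to a 1-form. -/
def dual (θ : (x : M) → TangentSpace (𝓡 n) x → ℝ) : VecField n M := fun x =>
  ∑ i, θ x (frame x i) • frame x i

lemma sum_linear_smul {W : Type*} [AddCommGroup W] [Module ℝ W] {V ι : Type*}
    [NormedAddCommGroup V] [InnerProductSpace ℝ V] [Fintype ι] (b : OrthonormalBasis ι ℝ V)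
    {f : V → W} (hf : IsLinearMap ℝ f) (v : V) : ∑ i, (inner ℝ (b i) v : ℝ) • f (b i) = f v := by
  conv_rhs => rw [← b.sum_repr' v]
  exact (by simp : ∑ i, (inner ℝ (b i) v : ℝ) • hf.mk' f (b i) =
    hf.mk' f (∑ i, (inner ℝ (b i) v : ℝ) • b i))

lemma inner_sum_linear_smul {V ι : Type*}
    [NormedAddCommGroup V] [InnerProductSpace ℝ V] [Fintype ι] (b : OrthonormalBasis ι ℝ V)
    {f : V → ℝ} (hf : IsLinearMap ℝ f) (v : V) :
    inner ℝ (∑ i, f (b i) • b i) v = f v := by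
  rw [← sum_linear_smul b hf v, sum_inner]
  exact Finset.sum_congr rfl fun i _ => by rw [real_inner_smul_left, smul_eq_mul, mul_comm]

variable {θ : (x : M) → TangentSpace (𝓡 n) x → ℝ}

lemma inner_dual (h : IsLinearMap ℝ (θ x)) (v : TangentSpace (𝓡 n) x) :
    inner ℝ (dual θ x) v = θ x v := inner_sum_linear_smul _ h v

lemma smt_dual (h : ∀ᶠ y in 𝓝 x, IsLinearMap ℝ (θ y))
    (hs : ∀ Z, Smt Z x → SmtF n (fun y => θ y (Z y)) x) : Smt (dual θ) x := by
  obtain ⟨e, he⟩ := exists_isONFrame (n := n) x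
  refine Smt.congr (Smt.sum (s := Finset.univ) fun i _ => Smt.smul (hs _ (he.smt i)) (he.smt i)) ?_
  filter_upwards [h, he.eventually] with y h he
  rw [← he.sum_inner_smul (dual θ y)]
  exact Finset.sum_congr rfl fun i _ => by rw [real_inner_comm, inner_dual h]

/-- The endomorphism field dual to a bilinear form. -/
def ofForm (β : (x : M) → TangentSpace (𝓡 n) x → TangentSpace (𝓡 n) x → ℝ) : Tensor1 n M :=
  fun x v => ∑ i, β x v (frame x i) • frame x i

variable {β : (x : M) → TangentSpace (𝓡 n) x → TangentSpace (𝓡 n) x → ℝ}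

lemma inner_ofForm (h : IsBilinearMap ℝ (β x)) (v w : TangentSpace (𝓡 n) x) :
    inner ℝ (ofForm β x v) w = β x v w :=
  inner_sum_linear_smul _ ⟨h.add_right v, fun c => h.smul_right c v⟩ w

lemma tens1_ofForm (h : ∀ y, IsBilinearMap ℝ (β y))
    (hs : ∀ y Y Z, Smt Y y → Smt Z y → SmtF n (fun y => β y (Y y) (Z y)) y) (x : M) :
    Tens1 (ofForm β) x :=
  Eventually.of_forall fun y =>
    { lin := ⟨fun v w => by simp only [ofForm, (h y).add_left, add_smul, Finset.sum_add_distrib],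
        fun c v => by simp only [ofForm, (h y).smul_left, smul_assoc, Finset.smul_sum]⟩
      smt := fun Y hY => smt_dual (θ := fun y w => β y (Y y) w)
        (Eventually.of_forall fun z => ⟨(h z).add_right _, fun c => (h z).smul_right c _⟩)
        fun Z hZ => hs y Y Z hY hZ }

lemma Tens2.div2 (h : Tens2 α x) : Tens1 (div2 α) x := by
  filter_upwards [h.eventually] with y h
  refine ⟨⟨fun v w => ?_, fun c v => ?_⟩, fun Y hY => (h.nabla2_tens12 hY).sum_frame_smt.neg⟩
  · simp only [KEDeform.div2, (h.nabla2_lin₃ _ _).map_add, Finset.sum_add_distrib, neg_add]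
  · simp only [KEDeform.div2, (h.nabla2_lin₃ _ _).map_smul, Finset.smul_sum, smul_neg]

/-- The pointwise scalar product of two `TM`-valued tensors with two arguments. -/
def pairing (α D : Tensor2 n M) (x : M) : ℝ :=
  ∑ i, ∑ j, inner ℝ (α x (frame x i) (frame x j)) (D x (frame x i) (frame x j))

/-- The contraction of a 2-tensor with an endomorphism field, as a vector field. -/
def contract (α : Tensor2 n M) (A : Tensor1 n M) : VecField n M :=
  dual fun x v => ∑ j, inner ℝ (α x v (frame x j)) (A x (frame x j))

lemma contract_lin (hα : Tens2 α x) : IsLinearMap ℝ fun v : TangentSpace (𝓡 n) x =>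
    (∑ j, inner ℝ (α x v (frame x j)) (A x (frame x j)) : ℝ) :=
  ⟨fun v w => by simp only [hα.add_left, inner_add_left, Finset.sum_add_distrib],
    fun c v => by
      simp only [hα.smul_left, real_inner_smul_left, Finset.mul_sum, smul_eq_mul]⟩

lemma inner_contract (hα : Tens2 α x) (v : TangentSpace (𝓡 n) x) :
    inner ℝ (contract α A x) v = ∑ j, (inner ℝ (α x v (frame x j)) (A x (frame x j)) : ℝ) :=
  inner_dual (θ := fun x v => ∑ j, inner ℝ (α x v (frame x j)) (A x (frame x j)))
    (contract_lin hα) v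

lemma smt_contract (hα : Tens2 α x) (hA : Tens1 A x) : Smt (contract α A) x :=
  smt_dual (hα.eventually.mono fun _ h => contract_lin h) fun _ hZ => (hα.left hZ).sum_inner_smt hA

lemma inner_nabla_contract (hα : Tens2 α x) (hA : Tens1 A x) (v w : TangentSpace (𝓡 n) x) :
    inner ℝ (nabla (contract α A) x v) w =
      ∑ j, (inner ℝ (nabla2 α x v w (frame x j)) (A x (frame x j))
        + inner ℝ (α x w (frame x j)) (nabla1 A x v (frame x j)) : ℝ) := by
  have hw := Smt.ext w
  have h1 := mvfderiv_inner (smt_contract hα hA).msec hw.msec v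
  have h2 : ∀ᶠ y in 𝓝 x, (inner ℝ (contract α A y) (ext w y) : ℝ) =
      ∑ j, inner ℝ (α y (ext w y) (frame y j)) (A y (frame y j)) := by
    filter_upwards [hα.eventually] with y h using inner_contract h _
  have h3 := (hα.left hw).mvfderiv_sum_inner hA v
  have h4 := inner_contract (A := A) hα (nabla (ext w) x v)
  rw [mvfderiv_congr h2, h3] at h1
  simp only [hα.nabla1_left hw, ext_self, inner_add_left, Finset.sum_add_distrib] at h1 h4 ⊢
  linarith

/-- The product rule behind the adjointness of $\delta$ and $\nabla$, before integration. -/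
lemma divergence_contract (hα : Tens2 α x) (hA : Tens1 A x) :
    divergence (contract α A) x =
      pairing α (nabla1 A) x - ∑ j, inner ℝ (div2 α x (frame x j)) (A x (frame x j)) := by
  simp only [divergence, inner_nabla_contract hα hA, pairing, div2, inner_neg_left, sum_inner,
    Finset.sum_add_distrib, Finset.sum_neg_distrib]
  rw [Finset.sum_comm]
  ring

end dual

/-! ### Integration by parts and definiteness of the $L^2$ product -/

section integration

open MeasureTheory

variable [MeasurableSpace M] [BorelSpace M] [T2Space M] [CompactSpace M]
  {A B C : Tensor1 n M} {α : Tensor2 n M}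

/-- Integration by parts: `δ` is the formal adjoint of `∇`. -/
lemma l2_div2 (hα : ∀ x, Tens2 α x) (hA : ∀ x, Tens1 A x) :
    l2 (div2 α) A = ∫ x, pairing α (nabla1 A) x ∂(KEDeform.volume n M) := by
  have h1 (x) : pairing α (nabla1 A) x = divergence (contract α A) x
      + ∑ j, inner ℝ (div2 α x (frame x j)) (A x (frame x j)) := by
    rw [divergence_contract (hα x) (hA x)]; ring
  have hs (x) := smt_contract (hα x) (hA x)
  simp only [h1]
  rw [integral_add (integrable_of_smtF fun x => divergence_smtF (hs x))
    (integrable_of_smtF fun x => (hα x).div2.sum_inner_smt (hA x)), integral_divergence hs, zero_add]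
  rfl

lemma integrable_inner (hA : ∀ x, Tens1 A x) (hB : ∀ x, Tens1 B x) :
    Integrable (fun x => ∑ i, (inner ℝ (A x (frame x i)) (B x (frame x i)) : ℝ))
      (KEDeform.volume n M) :=
  integrable_of_smtF fun x => (hA x).sum_inner_smt (hB x)

lemma integrable_pairing_nabla1 (hα : ∀ x, Tens2 α x) (hA : ∀ x, Tens1 A x) :
    Integrable (pairing α (nabla1 A)) (KEDeform.volume n M) := by
  have h1 : pairing α (nabla1 A) = fun x => divergence (contract α A) x
      + ∑ j, inner ℝ (div2 α x (frame x j)) (A x (frame x j)) := by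
    ext1 x
    rw [divergence_contract (hα x) (hA x)]; ring
  rw [h1]
  exact (integrable_of_smtF fun x => divergence_smtF (smt_contract (hα x) (hA x))).add
    (integrable_inner (fun x => (hα x).div2) hA)

lemma l2_add_left (hA : ∀ x, Tens1 A x) (hB : ∀ x, Tens1 B x) (hC : ∀ x, Tens1 C x) :
    l2 (fun x X => A x X + B x X) C = l2 A C + l2 B C := by
  simp only [l2, inner_add_left, Finset.sum_add_distrib]
  exact integral_add (integrable_inner hA hC) (integrable_inner hB hC)

lemma l2_smul_left (c : ℝ) : l2 (fun x X => c • A x X) C = c * l2 A C := by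
  simp only [l2, real_inner_smul_left, ← Finset.mul_sum, integral_const_mul]

lemma l2_sub_left (hA : ∀ x, Tens1 A x) (hB : ∀ x, Tens1 B x) (hC : ∀ x, Tens1 C x) :
    l2 (fun x X => A x X - B x X) C = l2 A C - l2 B C := by
  simp only [l2, inner_sub_left, Finset.sum_sub_distrib]
  exact integral_sub (integrable_inner hA hC) (integrable_inner hB hC)

/-- A continuous nonnegative density with zero integral vanishes identically, because the measure
charges every nonempty open set. -/
lemma eq_zero_of_l2_self (hA : ∀ x, Tens1 A x) (h : l2 A A = 0) (x : M)
    (v : TangentSpace (𝓡 n) x) : A x v = 0 := by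
  have hc := continuous_of_smtF fun x => (hA x).sum_inner_smt (hA x)
  have h0 : (fun x => ∑ i, (inner ℝ (A x (frame x i)) (A x (frame x i)) : ℝ)) = 0 := by
    refine Continuous.ae_eq_iff_eq (KEDeform.volume n M) hc continuous_zero |>.1 ?_
    exact (integral_eq_zero_iff_of_nonneg
      (fun x => Finset.sum_nonneg fun i _ => real_inner_self_nonneg) (integrable_inner hA hA)).1 h
  have h1 := congrFun h0 x
  have h2 (i) : A x (frame x i) = 0 := by
    have := (Finset.sum_eq_zero_iff_of_nonneg
      (fun i _ => real_inner_self_nonneg (x := A x (frame x i)))).1 h1 i (Finset.mem_univ i)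
    exact inner_self_eq_zero.1 this
  rw [← sum_linear_smul (frame x) (hA x).at.lin]
  simp [h2]

end integration

/-! ### Existence and uniqueness of $\mathbf v(h,h)$ -/

section second_order_operator

variable {x : M} {A B h k : Tensor1 n M} {α β D : Tensor2 n M}

lemma Tens1.dNabla (hA : Tens1 A x) : Tens2 (dNabla A) x := hA.nabla1.sub hA.nabla1.flip

lemma Tens2.sharp (hA : Tens1 A x) (hα : Tens2 α x) : Tens2 (sharp A α) x :=
  (hα.comp_left hA).add (hα.comp_right hA)

lemma Tens1.anticomm (hA : Tens1 A x) (hB : Tens1 B x) : Tens1 (anticomm A B) x :=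
  (hA.comp hB).add (hB.comp hA)

lemma Tens1.fnBracket (hA : Tens1 A x) (hB : Tens1 B x) : Tens2 (fnBracket A B) x :=
  Tens2.smul _ (((Tens2.sharp hA hB.dNabla).add (Tens2.sharp hB hA.dNabla)).neg.add
    (hA.anticomm hB).dNabla)

lemma dNabla_antisymm (v w : TangentSpace (𝓡 n) x) : dNabla A x v w = -dNabla A x w v := by
  simp [dNabla]

lemma fnBracket_antisymm (v w : TangentSpace (𝓡 n) x) :
    fnBracket A B x v w = -fnBracket A B x w v := by
  simp only [fnBracket, sharp, dNabla, ← smul_neg]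
  congr 1
  abel

lemma fnBracket_comm : fnBracket A B = fnBracket B A := by
  have h1 : anticomm A B = anticomm B A := by
    funext x v; exact add_comm _ _
  funext x v w
  simp only [fnBracket, h1, add_comm (sharp A _ x v w)]

lemma pairing_comm : pairing α β x = pairing β α x := by simp only [pairing, real_inner_comm]

/-- An antisymmetric $\alpha$ only sees the antisymmetric part of $\nabla A$. -/
lemma two_mul_pairing_nabla1 (hα : ∀ v w, α x v w = -α x w v) :
    2 * pairing α (nabla1 A) x = pairing α (dNabla A) x := by
  simp only [pairing, dNabla, inner_sub_right, Finset.sum_sub_distrib]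
  have h1 : ∑ i, ∑ j, (inner ℝ (α x (frame x i) (frame x j)) (nabla1 A x (frame x j) (frame x i)) : ℝ)
      = -∑ i, ∑ j, inner ℝ (α x (frame x i) (frame x j)) (nabla1 A x (frame x i) (frame x j)) := by
    rw [Finset.sum_comm, ← Finset.sum_neg_distrib]
    refine Finset.sum_congr rfl fun i _ => ?_
    rw [← Finset.sum_neg_distrib]
    refine Finset.sum_congr rfl fun j _ => ?_
    rw [hα, inner_neg_left]
  rw [h1]; ring

lemma sum_inner_transpose (hs : ∀ v w, (inner ℝ (A x v) w : ℝ) = inner ℝ v (A x w))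
    {f g : TangentSpace (𝓡 n) x → TangentSpace (𝓡 n) x} (hf : IsLinearMap ℝ f)
    (hg : IsLinearMap ℝ g) :
    ∑ i, (inner ℝ (f (A x (frame x i))) (g (frame x i)) : ℝ)
      = ∑ i, inner ℝ (f (frame x i)) (g (A x (frame x i))) :=
  (frame x).sum_transpose hs (isBilinearMap_inner hf hg)

lemma pairing_sharp (hs : ∀ v w, (inner ℝ (A x v) w : ℝ) = inner ℝ v (A x w))
    (hα : Tens2 α x) (hβ : Tens2 β x) : pairing (sharp A α) β x = pairing α (sharp A β) x := by
  simp only [pairing, sharp, inner_add_left, inner_add_right, Finset.sum_add_distrib]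
  congr 1
  · rw [Finset.sum_comm]
    conv_rhs => rw [Finset.sum_comm]
    exact Finset.sum_congr rfl fun j _ => sum_inner_transpose hs (hα.at.lin₁ _) (hβ.at.lin₁ _)
  · exact Finset.sum_congr rfl fun j _ => sum_inner_transpose hs (hα.at.lin₂ _) (hβ.at.lin₂ _)

/-- The symmetric endomorphism field `P` with `⟨P v, w⟩ = ∑ ⟨α(v, e_i), α(w, e_i)⟩`. -/
def gram (α : Tensor2 n M) : Tensor1 n M :=
  ofForm fun x v w => ∑ i, inner ℝ (α x v (frame x i)) (α x w (frame x i))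

lemma gram_isBilinearMap (hα : Tens2 α x) : IsBilinearMap ℝ fun v w : TangentSpace (𝓡 n) x =>
    (∑ i, inner ℝ (α x v (frame x i)) (α x w (frame x i)) : ℝ) where
  add_left v v' w := by simp only [hα.add_left, inner_add_left, Finset.sum_add_distrib]
  smul_left c v w := by
    simp only [hα.smul_left, real_inner_smul_left, Finset.mul_sum, smul_eq_mul]
  add_right v w w' := by simp only [hα.add_left, inner_add_right, Finset.sum_add_distrib]
  smul_right c v w := by
    simp only [hα.smul_left, real_inner_smul_right, Finset.mul_sum, smul_eq_mul]

lemma inner_gram (hα : Tens2 α x) (v w : TangentSpace (𝓡 n) x) :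
    inner ℝ (gram α x v) w = (∑ i, inner ℝ (α x v (frame x i)) (α x w (frame x i)) : ℝ) :=
  inner_ofForm (β := fun x v w => ∑ i, inner ℝ (α x v (frame x i)) (α x w (frame x i)))
    (gram_isBilinearMap hα) v w

lemma Tens2.gram (hα : ∀ x, Tens2 α x) (x : M) : Tens1 (gram α) x :=
  tens1_ofForm (fun y => gram_isBilinearMap (hα y))
    (fun y _ _ hY hZ => ((hα y).left hY).sum_inner_smt ((hα y).left hZ)) x

lemma pairing_sharp_self (hα : Tens2 α x) (ha : ∀ v w, α x v w = -α x w v) :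
    pairing (sharp A α) α x = 2 * ∑ i, (inner ℝ (gram α x (frame x i)) (A x (frame x i)) : ℝ) := by
  simp only [pairing, sharp, inner_add_left, Finset.sum_add_distrib, inner_gram hα, two_mul]
  congr 1
  · exact Finset.sum_congr rfl fun i _ => Finset.sum_congr rfl fun j _ => real_inner_comm _ _
  · rw [Finset.sum_comm]
    refine Finset.sum_congr rfl fun i _ => Finset.sum_congr rfl fun j _ => ?_
    rw [ha, ha (frame x j) (frame x i), inner_neg_neg, real_inner_comm]

/-- With $\nabla h$ replaced by $d_\nabla h$, self-adjointness of $h\sharp$ leaves $k$ only inside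
$\nabla\{h,k\}$ and $\nabla k$, ready for integration by parts, and in the zeroth-order Gram term.
-/
lemma two_mul_pairing_fnBracket (hs : ∀ v w, (inner ℝ (h x v) w : ℝ) = inner ℝ v (h x w))
    (hh : Tens1 h x) (hk : Tens1 k x) :
    2 * pairing (fnBracket h k) (nabla1 h) x =
      pairing (dNabla h) (nabla1 (anticomm h k)) x - pairing (sharp h (dNabla h)) (nabla1 k) x
        - ∑ i, inner ℝ (gram (dNabla h) x (frame x i)) (k x (frame x i)) := by
  have h1 : ∀ v w, sharp h (dNabla h) x v w = -sharp h (dNabla h) x w v := fun v w => by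
    simp only [sharp, dNabla]; abel
  have h2 := pairing_sharp hs hk.dNabla hh.dNabla
  have h3 := pairing_sharp_self (A := k) hh.dNabla dNabla_antisymm
  have h4 := two_mul_pairing_nabla1 (A := k) h1
  have h5 := two_mul_pairing_nabla1 (x := x) (A := anticomm h k) (dNabla_antisymm (A := h))
  have h6 : pairing (fnBracket h k) (dNabla h) x = (1 / 2) * (-(pairing (sharp h (dNabla k)) (dNabla h) x
      + pairing (sharp k (dNabla h)) (dNabla h) x)
      + pairing (dNabla (anticomm h k)) (dNabla h) x) := by
    simp only [pairing, fnBracket, real_inner_smul_left, inner_add_left, inner_neg_left,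
      Finset.sum_add_distrib, Finset.sum_neg_distrib, ← Finset.mul_sum]
  rw [two_mul_pairing_nabla1 fnBracket_antisymm, h6, h2, h3, pairing_comm, ← h4,
    pairing_comm (α := dNabla (anticomm h k)), ← h5]
  ring

lemma dNabla_anticomm_self (hh : Tens1 h x) (v w : TangentSpace (𝓡 n) x) :
    dNabla (anticomm h h) x v w = (2 : ℝ) • dNabla (comp h h) x v w := by
  have h1 : anticomm h h = fun x v => comp h h x v + comp h h x v := rfl
  simp only [dNabla, h1, nabla1_add _ _ (hh.comp hh) (hh.comp hh), two_smul]
  abel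

lemma fnBracket_self (hh : Tens1 h x) (v w : TangentSpace (𝓡 n) x) :
    fnBracket h h x v w = dNabla (comp h h) x v w - sharp h (dNabla h) x v w := by
  rw [fnBracket, dNabla_anticomm_self hh, ← two_smul ℝ (sharp h _ x v w), ← smul_neg, ← smul_add,
    smul_smul]
  norm_num
  abel

lemma div2_sub (hα : Tens2 α x) (hβ : Tens2 β x) (v : TangentSpace (𝓡 n) x) :
    div2 (fun x v w => α x v w - β x v w) x v = div2 α x v - div2 β x v := by
  simp only [div2, nabla2_sub _ _ _ hα hβ, Finset.sum_sub_distrib]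
  abel

/-- An endomorphism field representing the linear form `k ↦ ⟨𝐯(h, h), k⟩`. -/
def preV (h : Tensor1 n M) : Tensor1 n M := fun x X =>
  div2 (dNabla (comp h h)) x X - (2 : ℝ) • div2 (sharp h (dNabla h)) x X
    + anticomm h (div2 (dNabla h)) x X - gram (dNabla h) x X

lemma tens1_preV (hh : ∀ x, Tens1 h x) (x : M) : Tens1 (preV h) x :=
  (((((hh x).comp (hh x)).dNabla.div2).sub (((Tens2.sharp (hh x) (hh x).dNabla).div2).smul 2)).add
    ((hh x).anticomm (hh x).dNabla.div2)).sub (Tens2.gram (fun y => (hh y).dNabla) x)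

/-- The symmetric part of an endomorphism field. -/
def symPart (A : Tensor1 n M) : Tensor1 n M :=
  ofForm fun x v w => (inner ℝ (A x v) w + inner ℝ (A x w) v) / 2

lemma symPart_isBilinearMap (hA : Tens1 A x) : IsBilinearMap ℝ fun v w : TangentSpace (𝓡 n) x =>
    ((inner ℝ (A x v) w + inner ℝ (A x w) v) / 2 : ℝ) where
  add_left v v' w := by simp only [hA.add_apply, inner_add_left, inner_add_right]; ring
  smul_left c v w := by
    simp only [hA.smul_apply, real_inner_smul_left, real_inner_smul_right, smul_eq_mul]; ring
  add_right v w w' := by simp only [hA.add_apply, inner_add_left, inner_add_right]; ring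
  smul_right c v w := by
    simp only [hA.smul_apply, real_inner_smul_left, real_inner_smul_right, smul_eq_mul]; ring

lemma inner_symPart (hA : Tens1 A x) (v w : TangentSpace (𝓡 n) x) :
    inner ℝ (symPart A x v) w = ((inner ℝ (A x v) w + inner ℝ (A x w) v) / 2 : ℝ) :=
  inner_ofForm (β := fun x v w => (inner ℝ (A x v) w + inner ℝ (A x w) v) / 2)
    (symPart_isBilinearMap hA) v w

lemma Tens1.symPart (hA : ∀ x, Tens1 A x) (x : M) : Tens1 (symPart A) x :=
  tens1_ofForm (fun y => symPart_isBilinearMap (hA y)) (fun y Y Z hY hZ => by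
    refine ((((hA y).at.smt _ hY).inner hZ).add (((hA y).at.smt _ hZ).inner hY)).mul
      (SmtF.const (1 / 2)) |>.congr (Eventually.of_forall fun z => ?_)
    ring) x

variable [MeasurableSpace M]

/-- Symmetric test sections do not see the skew part, so the section representing the linear form
can be made symmetric. -/
lemma l2_symPart (hA : ∀ x, Tens1 A x)
    (hs : ∀ (x : M) v w, (inner ℝ (B x v) w : ℝ) = inner ℝ v (B x w)) :
    l2 (symPart A) B = l2 A B := by
  have (x : M) : ∑ i, (inner ℝ (symPart A x (frame x i)) (B x (frame x i)) : ℝ)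
      = ∑ i, inner ℝ (A x (frame x i)) (B x (frame x i)) := by
    simp only [inner_symPart (hA x), ← Finset.sum_div, Finset.sum_add_distrib]
    rw [sum_inner_transpose (hs x) (hA x).at.lin T1.id.lin]
    ring
  simp only [l2, this]

lemma l2_anticomm (hA : ∀ x, Tens1 A x) (hB : ∀ x, Tens1 B x)
    (hs : ∀ (x : M) v w, (inner ℝ (h x v) w : ℝ) = inner ℝ v (h x w)) :
    l2 A (anticomm h B) = l2 (anticomm h A) B := by
  have (x : M) : ∑ i, (inner ℝ (A x (frame x i)) (anticomm h B x (frame x i)) : ℝ)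
      = ∑ i, inner ℝ (anticomm h A x (frame x i)) (B x (frame x i)) := by
    simp only [anticomm, inner_add_left, inner_add_right, Finset.sum_add_distrib, hs x]
    rw [sum_inner_transpose (hs x) (hA x).at.lin (hB x).at.lin]
  simp only [l2, this]

open MeasureTheory

variable [BorelSpace M] [T2Space M] [CompactSpace M]

/-- The linear form defining `𝐯(h, h)` is represented by `preV h`. -/
lemma l2_preV (hh : ∀ x, Tens1 h x) (hk : ∀ x, Tens1 k x)
    (hs : ∀ (x : M) v w, (inner ℝ (h x v) w : ℝ) = inner ℝ v (h x w)) :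
    l2 (div2 (fnBracket h h)) k + l2 (div2 (fnBracket h k)) h + l2 (div2 (fnBracket k h)) h =
      l2 (preV h) k := by
  have hD (x) := (hh x).dNabla
  have hhD (x) := Tens2.sharp (hh x) (hD x)
  have hc (x) := ((hh x).comp (hh x)).dNabla
  have ha (x) := (hh x).anticomm (hk x)
  have hb (x) := (hh x).anticomm (hD x).div2
  have hg := Tens2.gram hD
  -- The last two terms of the defining form coincide by symmetry of the bracket, so exactly twice
  -- this product is needed.
  have h1 : 2 * l2 (div2 (fnBracket h k)) h = l2 (div2 (dNabla h)) (anticomm h k)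
      - l2 (div2 (sharp h (dNabla h))) k - l2 (gram (dNabla h)) k := by
    have hi : Integrable (fun x => pairing (dNabla h) (nabla1 (anticomm h k)) x
        - pairing (sharp h (dNabla h)) (nabla1 k) x) (KEDeform.volume n M) :=
      (integrable_pairing_nabla1 hD ha).sub (integrable_pairing_nabla1 hhD hk)
    rw [l2_div2 (fun x => (hh x).fnBracket (hk x)) hh, l2_div2 hD ha, l2_div2 hhD hk,
      ← integral_const_mul, l2, ← integral_sub (integrable_pairing_nabla1 hD ha)
        (integrable_pairing_nabla1 hhD hk), ← integral_sub hi (integrable_inner hg hk)]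
    congr 1
    ext1 x
    exact two_mul_pairing_fnBracket (hs x) (hh x) (hk x)
  have h2 : div2 (fnBracket h h) =
      fun x v => div2 (dNabla (comp h h)) x v - div2 (sharp h (dNabla h)) x v := by
    have : fnBracket h h = fun x v w => dNabla (comp h h) x v w - sharp h (dNabla h) x v w := by
      funext x v w; exact fnBracket_self (hh x) v w
    funext x v
    rw [this, div2_sub (hc x) (hhD x)]
  have h3 : l2 (preV h) k = l2 (div2 (dNabla (comp h h))) k
      - 2 * l2 (div2 (sharp h (dNabla h))) k + l2 (anticomm h (div2 (dNabla h))) k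
      - l2 (gram (dNabla h)) k := by
    have ht (x) := (hhD x).div2.smul 2
    have hu (x) := (hc x).div2.sub (ht x)
    rw [← l2_smul_left, ← l2_sub_left (fun x => (hc x).div2) ht hk, ← l2_add_left hu hb hk,
      ← l2_sub_left (fun x => (hu x).add (hb x)) hg hk]
    rfl
  rw [fnBracket_comm (A := k), h2, l2_sub_left (fun x => (hc x).div2) (fun x => (hhD x).div2) hk,
    h3, ← l2_anticomm (fun x => (hD x).div2) hk hs]
  linarith

/-- The difference of the two sides is smooth and symmetric, hence itself an admissible test
section. Testing against it shows that its $L^2$ norm is zero. -/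
lemma IsV.tensor_eq {h v : EndField n M} (hh : IsSymTensor h) (hv : IsV h h v) :
    v.tensor = symPart (preV h.tensor) := by
  have hht := hh.1.tens1
  have hp := tens1_preV hht
  have hps := Tens1.symPart hp
  have hd (x) := (hv.1.1.tens1 x).sub (hps x)
  have hsym (x : M) (u w : TangentSpace (𝓡 n) x) :
      (inner ℝ (v.tensor x u - symPart (preV h.tensor) x u) w : ℝ)
        = inner ℝ u (v.tensor x w - symPart (preV h.tensor) x w) := by
    rw [inner_sub_left, inner_sub_right, inner_symPart (hp x),
      real_inner_comm (symPart _ x w), inner_symPart (hp x)]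
    have := hv.1.2 x u w
    change (inner ℝ (v.tensor x u) w : ℝ) = inner ℝ u (v.tensor x w) at this
    rw [this]; ring
  obtain ⟨d, hds, hdt⟩ := exists_isSmooth fun x => (hd x).at
  have hdS : IsSymTensor d := ⟨hds, fun x u w => by
    have := hsym x u w
    rw [← congrFun (congrFun hdt x) u, ← congrFun (congrFun hdt x) w] at this
    exact this⟩
  have h1 : l2 v.tensor d.tensor = l2 (symPart (preV h.tensor)) d.tensor := by
    rw [hv.2 d hdS, l2_preV hht hds.tens1 hh.2, l2_symPart (B := d.tensor) hp hdS.2]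
  have h2 : l2 d.tensor d.tensor = 0 := by
    conv_lhs => enter [1]; rw [hdt]
    rw [l2_sub_left hv.1.1.tens1 hps hds.tens1, h1, sub_self]
  funext x u
  have h3 := eq_zero_of_l2_self hds.tens1 h2 x u
  rw [hdt] at h3
  exact sub_eq_zero.1 h3

/-- Existence and uniqueness of `𝐯(h, h)`. -/
theorem existsUnique_isV {h : EndField n M} (hh : IsSymTensor h) : ∃! v : EndField n M, IsV h h v := by
  have hht := hh.1.tens1
  have hp := tens1_preV hht
  obtain ⟨v, hvs, hvt⟩ := exists_isSmooth fun x => (Tens1.symPart hp x).at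
  refine ⟨v, ⟨⟨hvs, fun x u w => ?_⟩, fun k hk => ?_⟩, fun w hw => ?_⟩
  · change (inner ℝ (v.tensor x u) w : ℝ) = inner ℝ u (v.tensor x w)
    rw [hvt, inner_symPart (hp x), real_inner_comm (symPart _ x w), inner_symPart (hp x)]
    ring
  · rw [hvt, l2_symPart (B := k.tensor) hp hk.2, ← l2_preV hht hk.1.tens1 hh.2]
  · have h1 : w.tensor = v.tensor := (hw.tensor_eq hh).trans hvt.symm
    funext x
    ext1 u
    exact congrFun (congrFun h1 x) u

end second_order_operator

/-! ### From the hypotheses on $h$ to data at a point -/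

section pointwise_data

variable {x : M} {A B : Tensor1 n M} {α : Tensor2 n M} {J h : EndField n M} {E : ℝ}

lemma nabla1_zero (v w : TangentSpace (𝓡 n) x) : nabla1 (fun _ _ => 0) x v w = 0 := by
  simp [nabla1, nabla_zero]

lemma nabla2_zero (u v w : TangentSpace (𝓡 n) x) : nabla2 (fun _ _ _ => 0) x u v w = 0 := by
  simp [nabla2, nabla_zero]

lemma Tens1.nabla1_inner (hA : Tens1 A x)
    (hs : ∀ y v w, (inner ℝ (A y v) w : ℝ) = inner ℝ v (A y w)) (u v w : TangentSpace (𝓡 n) x) :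
    (inner ℝ (KEDeform.nabla1 A x u v) w : ℝ) = inner ℝ v (KEDeform.nabla1 A x u w) := by
  have hv := msec_ext v
  have hw := msec_ext w
  have h1 : (fun y => (inner ℝ (A y (ext v y)) (ext w y) : ℝ)) =
      fun y => (inner ℝ (ext v y) (A y (ext w y)) : ℝ) := funext fun y => hs y _ _
  have h2 := mvfderiv_inner (hA.msec hv) hw u
  have h3 := mvfderiv_inner hv (hA.msec hw) u
  rw [h1, h3, hA.nabla_apply hv, hA.nabla_apply hw] at h2
  simp only [ext_self, inner_add_left, inner_add_right, hs] at h2 ⊢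
  linarith

/-- Differentiate $AB+BA=0$ with $B$ parallel. -/
lemma nabla1_anticommute (hA : Tens1 A x) (hB : Tens1 B x)
    (h0 : ∀ (y : M) (v w : TangentSpace (𝓡 n) y), nabla1 B y v w = 0)
    (h : ∀ (y : M) (v : TangentSpace (𝓡 n) y), A y (B y v) = -B y (A y v))
    (v w : TangentSpace (𝓡 n) x) : nabla1 A x v (B x w) = -B x (nabla1 A x v w) := by
  have h1 : (fun y X => comp A B y X + comp B A y X) = fun (y : M) (X : TangentSpace (𝓡 n) y) => 0 := by
    funext y X
    rw [comp, comp, h, neg_add_cancel]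
  have h2 := nabla1_add v w (hA.comp hB) (hB.comp hA)
  rw [h1, nabla1_zero, nabla1_comp v w hA hB, nabla1_comp v w hB hA, h0, h0, hA.at.lin.map_zero,
    add_zero, zero_add] at h2
  exact eq_neg_of_add_eq_zero_left h2.symm

/-- The first-order statement is applied to the endomorphism field $\nabla_UA$, which has the same
symmetry as $A$. The term with $\nabla_tU$ produced by freezing $U$ is symmetric too and drops out.
-/
lemma nabla2_nabla1_inner (hA : ∀ x, Tens1 A x)
    (hs : ∀ y v w, (inner ℝ (A y v) w : ℝ) = inner ℝ v (A y w)) (t u v w : TangentSpace (𝓡 n) x) :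
    (inner ℝ (nabla2 (nabla1 A) x t u v) w : ℝ) = inner ℝ v (nabla2 (nabla1 A) x t u w) := by
  have hu := Smt.ext u
  have h1 := ((hA x).nabla1.left hu).nabla1_inner (fun y v w => ?_) t v w
  · simp only [(hA x).nabla1.nabla1_left hu, ext_self, inner_add_left, inner_add_right,
      (hA x).nabla1_inner hs] at h1
    linarith
  · exact (hA y).nabla1_inner hs _ _ _

lemma nabla2_nabla1_anticommute (hA : ∀ x, Tens1 A x) (hB : ∀ x, Tens1 B x)
    (h0 : ∀ (y : M) (v w : TangentSpace (𝓡 n) y), nabla1 B y v w = 0)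
    (h : ∀ (y : M) (v : TangentSpace (𝓡 n) y), A y (B y v) = -B y (A y v))
    (u v w : TangentSpace (𝓡 n) x) :
    nabla2 (nabla1 A) x u v (B x w) = -B x (nabla2 (nabla1 A) x u v w) := by
  have hv := Smt.ext v
  have h1 := nabla1_anticommute ((hA x).nabla1.left hv) (hB x) h0
    (fun y w => nabla1_anticommute (hA y) (hB y) h0 h _ w) u w
  simp only [(hA x).nabla1.nabla1_left hv, ext_self, nabla1_anticommute (hA x) (hB x) h0 h,
    (hB x).add_apply, neg_add] at h1
  exact add_right_cancel h1

/-- The bilinear map given by a tensor field at a point. -/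
def Tens2.toLinearMap (hα : Tens2 α x) :
    TangentSpace (𝓡 n) x →ₗ[ℝ] TangentSpace (𝓡 n) x →ₗ[ℝ] TangentSpace (𝓡 n) x :=
  LinearMap.mk₂ ℝ (α x) hα.add_left hα.smul_left hα.add_right hα.smul_right

/-- The trilinear map given by a function of three tangent vectors. -/
def trilinear (T : TangentSpace (𝓡 n) x → TangentSpace (𝓡 n) x → TangentSpace (𝓡 n) x →
      TangentSpace (𝓡 n) x)
    (h₁ : ∀ v w, IsLinearMap ℝ fun u => T u v w) (h₂ : ∀ u w, IsLinearMap ℝ fun v => T u v w)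
    (h₃ : ∀ u v, IsLinearMap ℝ fun w => T u v w) :
    TangentSpace (𝓡 n) x →ₗ[ℝ] TangentSpace (𝓡 n) x →ₗ[ℝ] TangentSpace (𝓡 n) x →ₗ[ℝ]
      TangentSpace (𝓡 n) x :=
  LinearMap.mk₂ ℝ (fun u v => (h₃ u v).mk' _)
    (fun u u' v => LinearMap.ext fun w => (h₁ v w).map_add u u')
    (fun c u v => LinearMap.ext fun w => (h₁ v w).map_smul c u)
    (fun u v v' => LinearMap.ext fun w => (h₂ u w).map_add v v')
    (fun c u v => LinearMap.ext fun w => (h₂ u w).map_smul c v)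

/-- Because $\nabla_Xh$ anticommutes with $J$, the second $J$ in $d_\nabla h(J\cdot,J\cdot)$ can be
pulled out. The equation then says that $\nabla_Xh+J\nabla_{JX}h$ applied to $Y$ is symmetric in
$X,Y$. -/
lemma nabla1_dbar (hJt : Tens1 J.tensor x) (hJ : IsKaehler J) (hh : IsSmooth h)
    (h_anti : ∀ (x : M) (X : TangentSpace (𝓡 n) x), h x (J x X) = -J x (h x X))
    (h_dbar : ∀ (x : M) (X Y : TangentSpace (𝓡 n) x), dbar J h.tensor x X Y = 0)
    (v w : TangentSpace (𝓡 n) x) :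
    nabla1 h.tensor x v w + J x (nabla1 h.tensor x (J x v) w) =
      nabla1 h.tensor x w v + J x (nabla1 h.tensor x (J x w) v) := by
  have h1 := h_dbar x v w
  have h2 (u w) : nabla1 h.tensor x u (J x w) = -J x (nabla1 h.tensor x u w) :=
    nabla1_anticommute (hh.tens1 x) hJt hJ.parallel h_anti u w
  simp only [dbar, lambdaPart, dNabla, h2, smul_eq_zero, one_div, inv_eq_zero, OfNat.ofNat_ne_zero,
    false_or] at h1
  rw [← sub_eq_zero, ← h1]
  abel

/-- The identity `nabla1_dbar` holds at every point, so it may be differentiated as an identity of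
tensors. Parallelism of $J$ leaves its form unchanged. -/
lemma nabla2_nabla1_dbar (hJ : IsKaehler J) (hh : IsSmooth h)
    (h_anti : ∀ (x : M) (X : TangentSpace (𝓡 n) x), h x (J x X) = -J x (h x X))
    (h_dbar : ∀ (x : M) (X Y : TangentSpace (𝓡 n) x), dbar J h.tensor x X Y = 0)
    (u v w : TangentSpace (𝓡 n) x) :
    nabla2 (nabla1 h.tensor) x u v w + J x (nabla2 (nabla1 h.tensor) x u (J x v) w) =
      nabla2 (nabla1 h.tensor) x u w v + J x (nabla2 (nabla1 h.tensor) x u (J x w) v) := by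
  have hJt := hJ.smooth.tens1 x
  have hd := (hh.tens1 x).nabla1
  have hc := hd.comp_left hJt
  have hβ := hd.add (hc.comp_out hJt)
  have h1 := nabla2_sub u v w hβ hβ.flip
  have h2 : (fun y X Y => nabla1 h.tensor y X Y + J.tensor y (nabla1 h.tensor y (J.tensor y X) Y)
      - (nabla1 h.tensor y Y X + J.tensor y (nabla1 h.tensor y (J.tensor y Y) X)))
      = fun (y : M) (X Y : TangentSpace (𝓡 n) y) => (0 : TangentSpace (𝓡 n) y) := by
    funext y X Y
    exact sub_eq_zero.2 (nabla1_dbar (hJ.smooth.tens1 y) hJ hh h_anti h_dbar X Y)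
  rw [h2, nabla2_zero, nabla2_flip (α := fun y X Y => nabla1 h.tensor y X Y
    + J.tensor y (nabla1 h.tensor y (J.tensor y X) Y))] at h1
  simp only [nabla2_add _ _ _ hd (hc.comp_out hJt), nabla2_comp_out _ _ _ hc hJt,
    nabla2_comp_left _ _ _ hd hJt, hJ.parallel, (hd.at.lin₁ _).map_zero, add_zero] at h1
  exact (sub_eq_zero.1 h1.symm)

lemma sum_nabla2_nabla1_of_div1 (hA : Tens1 A x) (h0 : ∀ y, div1 A y = 0)
    (v : TangentSpace (𝓡 n) x) : ∑ i, nabla2 (nabla1 A) x v (frame x i) (frame x i) = 0 := by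
  rw [← hA.nabla1.nabla_sum_frame]
  have h1 : (fun y => ∑ i, nabla1 A y (frame y i) (frame y i)) = fun y => 0 := by
    funext y
    have := h0 y
    rwa [div1, neg_eq_zero] at this
  rw [h1, nabla_zero]

/-- `h` is an infinitesimal complex deformation in TT gauge of the Kähler–Einstein structure with
complex structure `J`. -/
structure IsDeformation (E : ℝ) (J h : EndField n M) : Prop where
  kaehler : IsKaehler J
  einstein : IsEinstein n M E
  sym : IsSymTensor h
  anti (x : M) (X : TangentSpace (𝓡 n) x) : h x (J x X) = -J x (h x X)
  dbar (x : M) (X Y : TangentSpace (𝓡 n) x) : dbar J h.tensor x X Y = 0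
  div (x : M) : div1 h.tensor x = 0

/-- The algebraic data at a point defined by an infinitesimal complex deformation. -/
def IsDeformation.pointData (H : IsDeformation E J h) (x : M) : PointData (frame (n := n) x) E :=
  have hht := H.sym.1.tens1
  have hJt := H.kaehler.smooth.tens1
  have hd := (hht x).nabla1
  { J := (J x).toLinearMap
    h := (h x).toLinearMap
    dh := hd.toLinearMap
    ddh := trilinear (nabla2 (nabla1 h.tensor) x) hd.nabla2_lin₁ hd.nabla2_lin₂ hd.nabla2_lin₃
    R := trilinear (curvature x) curvature_lin₁ curvature_lin₂ curvature_lin₃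
    J_sq := fun v => H.kaehler.sq x v
    J_inner := fun v w => by
      have := H.kaehler.orthogonal x v (J x w)
      rw [H.kaehler.sq, inner_neg_right] at this
      exact neg_eq_iff_eq_neg.1 this
    h_inner := fun v w => H.sym.2 x v w
    h_J := fun v => H.anti x v
    dh_inner := fun u v w => (hht x).nabla1_inner H.sym.2 u v w
    dh_J := fun v w =>
      nabla1_anticommute (A := h.tensor) (B := J.tensor) (hht x) (hJt x) H.kaehler.parallel H.anti v w
    dh_dbar := fun v w => nabla1_dbar (hJt x) H.kaehler H.sym.1 H.anti H.dbar v w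
    dh_div := neg_eq_zero.1 (H.div x)
    ddh_inner := fun t u v w => nabla2_nabla1_inner hht H.sym.2 t u v w
    ddh_J := fun u v w =>
      nabla2_nabla1_anticommute (A := h.tensor) (B := J.tensor) hht hJt H.kaehler.parallel H.anti u v w
    ddh_dbar := fun u v w => nabla2_nabla1_dbar H.kaehler H.sym.1 H.anti H.dbar u v w
    ddh_div := sum_nabla2_nabla1_of_div1 (hht x) H.div
    ricci_identity := fun u v w => (hht x).ricci_identity u v w
    R_antisymm := curvature_antisymm
    R_skew := curvature_skew
    R_pair := curvature_pair_symm
    R_bianchi := curvature_bianchi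
    R_J := fun u v w => curvature_parallel (A := J.tensor) (hJt x) H.kaehler.parallel u v w
    einstein := fun v => by
      refine ext_inner_right ℝ fun w => ?_
      rw [real_inner_smul_left, ← H.einstein x v w, sum_inner]
      rfl }

end pointwise_data

/-! ### Geometric operators expressed by the pointwise data -/

section translation

variable {x : M} {A : Tensor1 n M} {ξ : VecField n M} {f : M → ℝ} {J h : EndField n M} {E : ℝ}

lemma inner_deltaStar (hξ : MSec ξ x) (v w : TangentSpace (𝓡 n) x) :
    (inner ℝ (deltaStar ξ x v) w : ℝ) = (inner ℝ (nabla ξ x v) w + inner ℝ v (nabla ξ x w)) / 2 := by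
  refine inner_sum_linear_smul (f := fun w => (inner ℝ (nabla ξ x v) w + inner ℝ v (nabla ξ x w)) / 2)
    _ ⟨fun u w => ?_, fun c w => ?_⟩ w
  · simp only [nabla_vadd hξ, inner_add_right]; ring
  · simp only [nabla_vsmul hξ, real_inner_smul_right, smul_eq_mul]; ring

lemma mvfderiv_isLinearMap : IsLinearMap ℝ (mvfderiv (𝓡 n) f x) :=
  ⟨fun v w => map_add _ v w, fun c v => map_smul _ c v⟩

lemma inner_grad (v : TangentSpace (𝓡 n) x) :
    (inner ℝ (grad f x) v : ℝ) = mvfderiv (𝓡 n) f x v :=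
  inner_dual (θ := fun x v => mvfderiv (𝓡 n) f x v) mvfderiv_isLinearMap v

lemma smt_grad (hf : SmtF n f x) : Smt (grad (n := n) f) x :=
  smt_dual (θ := fun x v => mvfderiv (𝓡 n) f x v) (Eventually.of_forall fun _ => mvfderiv_isLinearMap)
    fun _ hZ => Smt.mvfderiv hf hZ

lemma inner_nabla_grad (hf : SmtF n f x) {Z : VecField n M} (hZ : Smt Z x)
    (v : TangentSpace (𝓡 n) x) :
    (inner ℝ (nabla (grad f) x v) (Z x) : ℝ) = mvfderiv (𝓡 n) (fun y => mvfderiv (𝓡 n) f y (Z y)) x v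
      - mvfderiv (𝓡 n) f x (nabla Z x v) := by
  have h1 := mvfderiv_inner (smt_grad hf).msec hZ.msec v
  simp only [inner_grad] at h1
  rw [h1]; ring

section trace_square

variable (hA : ∀ x, Tens1 A x) (hs : ∀ (y : M) v w, (inner ℝ (A y v) w : ℝ) = inner ℝ v (A y w))
include hA hs

omit hA in
lemma trace_comp_self :
    trace (comp A A) = fun x => ∑ i, (inner ℝ (A x (frame x i)) (A x (frame x i)) : ℝ) := by
  funext x
  exact Finset.sum_congr rfl fun i _ => hs _ _ _

lemma smtF_trace_comp_self (x : M) : SmtF n (trace (comp A A)) x := by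
  rw [trace_comp_self hs]
  exact (hA x).sum_inner_smt (hA x)

lemma mvfderiv_trace_comp_self (v : TangentSpace (𝓡 n) x) :
    mvfderiv (𝓡 n) (trace (comp A A)) x v
      = 2 * ∑ i, (inner ℝ (nabla1 A x v (frame x i)) (A x (frame x i)) : ℝ) := by
  rw [trace_comp_self hs, (hA x).mvfderiv_sum_inner (hA x), Finset.mul_sum]
  exact Finset.sum_congr rfl fun i _ => by rw [real_inner_comm (nabla1 A x v _), two_mul]

lemma inner_nabla_grad_trace (v w : TangentSpace (𝓡 n) x) :
    (inner ℝ (nabla (grad (trace (comp A A))) x v) w : ℝ) =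
      2 * (∑ i, inner ℝ (nabla2 (nabla1 A) x v w (frame x i)) (A x (frame x i))
        + ∑ i, inner ℝ (nabla1 A x v (frame x i)) (nabla1 A x w (frame x i))) := by
  have hw := Smt.ext w
  have h1 := inner_nabla_grad (smtF_trace_comp_self hA hs x) hw v
  have hl := (hA x).nabla1.left hw
  have hF := hl.sum_inner_smt (hA x)
  have h2 : mvfderiv (𝓡 n) (fun y => mvfderiv (𝓡 n) (trace (comp A A)) y (ext w y)) x v =
      2 * mvfderiv (𝓡 n) (fun y => ∑ i, (inner ℝ (nabla1 A y (ext w y) (frame y i))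
        (A y (frame y i)) : ℝ)) x v := by
    simp only [mvfderiv_trace_comp_self hA hs]
    rw [mvfderiv_mul' mdifferentiableAt_const hF.mdiff, mvfderiv_const]
    simp
  rw [h2, hl.mvfderiv_sum_inner (hA x), mvfderiv_trace_comp_self hA hs] at h1
  simp only [(hA x).nabla1.nabla1_left hw, ext_self, inner_add_left, Finset.sum_add_distrib] at h1
  rw [h1]
  simp only [real_inner_comm (nabla1 A x v _)]
  ring

end trace_square

lemma nabla2_nabla1_comp (hA : ∀ x, Tens1 A x) (u v w : TangentSpace (𝓡 n) x) :
    nabla2 (nabla1 (comp A A)) x u v w = nabla2 (nabla1 A) x u v (A x w)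
      + nabla1 A x v (nabla1 A x u w) + nabla1 A x u (nabla1 A x v w)
      + A x (nabla2 (nabla1 A) x u v w) := by
  have h1 : nabla1 (comp A A) =
      fun y X Y => nabla1 A y X (A y Y) + A y (nabla1 A y X Y) := by
    funext y X Y; exact nabla1_comp X Y (hA y) (hA y)
  have hd := (hA x).nabla1
  rw [h1, nabla2_add _ _ _ (hd.comp_right (hA x)) (hd.comp_out (hA x)),
    nabla2_comp_right _ _ _ hd (hA x), nabla2_comp_out _ _ _ hd (hA x)]
  abel

lemma nabla2_dNabla (hA : Tens1 A x) (u v w : TangentSpace (𝓡 n) x) :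
    nabla2 (dNabla A) x u v w = nabla2 (nabla1 A) x u v w - nabla2 (nabla1 A) x u w v := by
  rw [← nabla2_flip u v w (α := nabla1 A)]
  exact nabla2_sub _ _ _ hA.nabla1 hA.nabla1.flip

lemma nabla2_sharp {α : Tensor2 n M} (hA : Tens1 A x) (hα : Tens2 α x)
    (u v w : TangentSpace (𝓡 n) x) :
    nabla2 (sharp A α) x u v w = nabla2 α x u (A x v) w + α x (nabla1 A x u v) w
      + (nabla2 α x u v (A x w) + α x v (nabla1 A x u w)) := by
  rw [← nabla2_comp_left _ _ _ hα hA, ← nabla2_comp_right _ _ _ hα hA]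
  exact nabla2_add _ _ _ (hα.comp_left hA) (hα.comp_right hA)

namespace IsDeformation

variable (H : IsDeformation E J h)
include H

lemma tens1 (x : M) : Tens1 h.tensor x := H.sym.1.tens1 x

lemma tens1_J (x : M) : Tens1 J.tensor x := H.kaehler.smooth.tens1 x

lemma inner_preV (y z : TangentSpace (𝓡 n) x) :
    (inner ℝ (preV h.tensor x y) z : ℝ) = (H.pointData x).v y z := by
  have hh := H.tens1
  have h1 (w u v) : nabla2 (nabla1 (comp h.tensor h.tensor)) x w u v = (H.pointData x).ddhh w u v :=
    nabla2_nabla1_comp hh w u v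
  have h2 (w u v) : nabla2 (dNabla h.tensor) x w u v = (H.pointData x).dD w u v :=
    nabla2_dNabla (hh x) w u v
  have h3 (y) : div2 (sharp h.tensor (dNabla h.tensor)) x y = (H.pointData x).divSharp y := by
    simp only [div2, nabla2_sharp (hh x) (hh x).dNabla, h2, ← add_assoc]
    rfl
  have h4 (y) : div2 (dNabla (comp h.tensor h.tensor)) x y =
      -∑ i, ((H.pointData x).ddhh (frame x i) (frame x i) y
        - (H.pointData x).ddhh (frame x i) y (frame x i)) := by
    simp only [div2, nabla2_dNabla ((hh x).comp (hh x)), h1]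
  have h5 (y) : div2 (dNabla h.tensor) x y = (H.pointData x).S y := by
    simp only [div2, h2]; rfl
  simp only [preV]
  rw [inner_sub_left, inner_gram (hh x).dNabla, h3, h4, anticomm, h5, h5, ← add_assoc]
  rfl

/-- The factor $\frac12$ in front of $d\,\mathrm{tr}$ matches the normalisation of `PointData.hess`
as half of the Hessian of $\mathrm{tr}\,h^2$. -/
lemma inner_nabla_gauge (y z : TangentSpace (𝓡 n) x) :
    (inner ℝ (nabla (fun y => div1 (comp h.tensor h.tensor) y
        + (1 / 2 : ℝ) • grad (trace (comp h.tensor h.tensor)) y) x y) z : ℝ) =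
      -∑ i, inner ℝ ((H.pointData x).ddhh y (frame x i) (frame x i)) z + (H.pointData x).hess y z := by
  have hh := H.tens1
  have hc := ((hh x).comp (hh x)).nabla1
  have hg := (smt_grad (smtF_trace_comp_self hh H.sym.2 x))
  have h1 (w u v) : nabla2 (nabla1 (comp h.tensor h.tensor)) x w u v = (H.pointData x).ddhh w u v :=
    nabla2_nabla1_comp hh w u v
  have h2 : nabla (div1 (comp h.tensor h.tensor)) x y =
      -∑ i, (H.pointData x).ddhh y (frame x i) (frame x i) := by
    simp only [← h1]
    rw [← hc.nabla_sum_frame]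
    exact nabla_neg hc.sum_frame_smt.msec y
  rw [nabla_add' (Y := div1 (comp h.tensor h.tensor)) hc.sum_frame_smt.neg.msec
    (hg.const_smul _).msec, nabla_const_smul _ hg.msec, h2, inner_add_left, real_inner_smul_left,
    inner_nabla_grad_trace hh H.sym.2, inner_neg_left, sum_inner, PointData.hess, PointData.U,
    one_div, inv_mul_cancel_left₀ two_ne_zero]
  rfl

end IsDeformation

end translation

/-! ### The identity for $\mathbf v(h,h)$ -/

section main_identity

variable {x : M} {J h : EndField n M} {E : ℝ}

namespace IsDeformation

variable (H : IsDeformation E J h)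
include H

lemma smt_gauge (x : M) : Smt (fun y => div1 (comp h.tensor h.tensor) y
    + (1 / 2 : ℝ) • grad (trace (comp h.tensor h.tensor)) y) x :=
  Smt.add ((H.tens1 x).comp (H.tens1 x)).nabla1.sum_frame_smt.neg
    ((smt_grad (smtF_trace_comp_self H.tens1 H.sym.2 x)).const_smul _)

lemma inner_perturbedEinsteinOp (y z : TangentSpace (𝓡 n) x) :
    (inner ℝ (perturbedEinsteinOp (comp h.tensor h.tensor) x y) z : ℝ) =
      inner ℝ (-∑ i, (H.pointData x).ddhh (frame x i) (frame x i) y) z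
        - 2 * inner ℝ ((H.pointData x).rc ((H.pointData x).h ∘ₗ (H.pointData x).h) y) z
        - 2 * (((-∑ i, inner ℝ ((H.pointData x).ddhh y (frame x i) (frame x i)) z
              + (H.pointData x).hess y z)
          + (-∑ i, inner ℝ ((H.pointData x).ddhh z (frame x i) (frame x i)) y
              + (H.pointData x).hess z y)) / 2) := by
  have h1 (w u v) : nabla2 (nabla1 (comp h.tensor h.tensor)) x w u v = (H.pointData x).ddhh w u v :=
    nabla2_nabla1_comp H.tens1 w u v
  rw [perturbedEinsteinOp, einsteinOp, inner_sub_left, inner_sub_left, real_inner_smul_left,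
    real_inner_smul_left, inner_deltaStar (H.smt_gauge x).msec, real_inner_comm _ y,
    H.inner_nabla_gauge, H.inner_nabla_gauge, roughLaplacian]
  simp only [h1]
  rfl

lemma inner_antiInvPart (y z : TangentSpace (𝓡 n) x) :
    (inner ℝ (antiInvPart J (deltaStar (grad (trace (comp h.tensor h.tensor)))) x y) z : ℝ) =
      (H.pointData x).hess y z - (H.pointData x).hess (J x y) (J x z) := by
  have hg := (smt_grad (smtF_trace_comp_self H.tens1 H.sym.2 x)).msec
  have h0 (y z : TangentSpace (𝓡 n) x) :
      (inner ℝ (nabla (grad (trace (comp h.tensor h.tensor))) x y) z : ℝ) =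
        2 * (H.pointData x).hess y z := inner_nabla_grad_trace H.tens1 H.sym.2 y z
  have hs (y z : TangentSpace (𝓡 n) x) : (H.pointData x).hess y z = (H.pointData x).hess z y := by
    rw [PointData.hess, PointData.hess, PointData.U_symm]
    simp only [real_inner_comm]
  have h1 (y z : TangentSpace (𝓡 n) x) :
      (inner ℝ (deltaStar (grad (trace (comp h.tensor h.tensor))) x y) z : ℝ) =
        2 * (H.pointData x).hess y z := by
    rw [inner_deltaStar hg, h0, real_inner_comm, h0, hs z y]
    ring
  have h2 : (inner ℝ (J x (deltaStar (grad (trace (comp h.tensor h.tensor))) x (J x y))) z : ℝ) =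
      -inner ℝ (deltaStar (grad (trace (comp h.tensor h.tensor))) x (J x y)) (J x z) :=
    (H.pointData x).J_inner _ _
  rw [antiInvPart, real_inner_smul_left, inner_add_left, h2, h1, h1]
  ring

/-- The Kodaira–Spencer bracket in terms of `∇ h`. -/
lemma ksBracket_eq : ksBracket J h.tensor = fun x X Y => (1 / 2 : ℝ) •
    ((nabla1 h.tensor x (h.tensor x Y) X
        - J.tensor x (nabla1 h.tensor x (comp J.tensor h.tensor x Y) X))
      - (nabla1 h.tensor x (h.tensor x X) Y
        - J.tensor x (nabla1 h.tensor x (comp J.tensor h.tensor x X) Y))) := by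
  funext x X Y
  let D := H.pointData x
  -- In $d_\nabla h^2-h\sharp d_\nabla h$ the terms $(\nabla_Xh)hY$ and $(\nabla_Yh)hX$ cancel.
  have h1 (X Y) : fnBracket h.tensor h.tensor x X Y =
      D.h (D.dh X Y - D.dh Y X) - D.dh (D.h X) Y + D.dh (D.h Y) X := by
    rw [fnBracket_self (H.tens1 x), dNabla, nabla1_comp _ _ (H.tens1 x) (H.tens1 x),
      nabla1_comp _ _ (H.tens1 x) (H.tens1 x), map_sub]
    change D.dh X (D.h Y) + D.h (D.dh X Y) - (D.dh Y (D.h X) + D.h (D.dh Y X)) -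
      ((D.dh (D.h X) Y - D.dh Y (D.h X)) + (D.dh X (D.h Y) - D.dh (D.h Y) X)) = _
    abel
  -- This is $\bar\partial h=0$ again. It removes the terms $h(d_\nabla h)$ when the part
  -- $\frac12(\gamma-\gamma(J\cdot,J\cdot))$ is taken.
  have h2 (X Y) : D.dh (D.J X) (D.J Y) - D.dh (D.J Y) (D.J X) = D.dh X Y - D.dh Y X := by
    rw [D.dh_J, D.dh_J, ← sub_eq_zero, ← neg_eq_zero, ← sub_eq_zero.2 (D.dh_dbar X Y)]
    abel
  simp only [ksBracket, lambdaMinus, lambdaPart, h1]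
  change (1 / 2 : ℝ) • ((1 / 2 : ℝ) • ((D.h (D.dh X Y - D.dh Y X) - D.dh (D.h X) Y + D.dh (D.h Y) X)
      - (D.h (D.dh (D.J X) (D.J Y) - D.dh (D.J Y) (D.J X)) - D.dh (D.h (D.J X)) (D.J Y)
        + D.dh (D.h (D.J Y)) (D.J X)))
    + D.J ((1 / 2 : ℝ) • ((D.h (D.dh X (D.J Y) - D.dh (D.J Y) X) - D.dh (D.h X) (D.J Y)
        + D.dh (D.h (D.J Y)) X)
      - (D.h (D.dh (D.J X) (D.J (D.J Y)) - D.dh (D.J (D.J Y)) (D.J X))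
        - D.dh (D.h (D.J X)) (D.J (D.J Y)) + D.dh (D.h (D.J (D.J Y))) (D.J X))))) =
    (1 / 2 : ℝ) • ((D.dh (D.h Y) X - D.J (D.dh (D.J (D.h Y)) X))
      - (D.dh (D.h X) Y - D.J (D.dh (D.J (D.h X)) Y)))
  rw [h2 X Y, h2 X (D.J Y)]
  simp only [D.J_sq, D.h_J, D.dh_J, map_neg, LinearMap.neg_apply, map_sub, map_add, map_smul,
    neg_neg]
  module

/-- The factor $-2$ absorbs the sign of $\delta$ and the $\frac12$ in `ksBracket_eq`. As $J$ is
parallel, only derivatives of $h$ appear. -/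
lemma div2_ksBracket (y : TangentSpace (𝓡 n) x) :
    -(2 : ℝ) • div2 (ksBracket J h.tensor) x y = (H.pointData x).ks y := by
  have hh := H.tens1 x
  have hJ := H.tens1_J x
  have hJh := hJ.comp hh
  have hd := hh.nabla1
  have ha := hd.comp_left hh
  have hb := hd.comp_left hJh
  have hc := hb.comp_out hJ
  have hβ := ha.sub hc
  have h1 (u v w : TangentSpace (𝓡 n) x) : nabla2 (ksBracket J h.tensor) x u v w = (1 / 2 : ℝ) •
      ((nabla2 (nabla1 h.tensor) x u (h.tensor x w) v + nabla1 h.tensor x (nabla1 h.tensor x u w) v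
        - J.tensor x (nabla2 (nabla1 h.tensor) x u (J.tensor x (h.tensor x w)) v
          + nabla1 h.tensor x (J.tensor x (nabla1 h.tensor x u w)) v))
      - (nabla2 (nabla1 h.tensor) x u (h.tensor x v) w + nabla1 h.tensor x (nabla1 h.tensor x u v) w
        - J.tensor x (nabla2 (nabla1 h.tensor) x u (J.tensor x (h.tensor x v)) w
          + nabla1 h.tensor x (J.tensor x (nabla1 h.tensor x u v)) w))) := by
    have h2 (u v w : TangentSpace (𝓡 n) x) : nabla2 (fun y X Y => nabla1 h.tensor y (h.tensor y X) Y
        - J.tensor y (nabla1 h.tensor y (comp J.tensor h.tensor y X) Y)) x u v w =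
        nabla2 (nabla1 h.tensor) x u (h.tensor x v) w + nabla1 h.tensor x (nabla1 h.tensor x u v) w
        - J.tensor x (nabla2 (nabla1 h.tensor) x u (J.tensor x (h.tensor x v)) w
          + nabla1 h.tensor x (J.tensor x (nabla1 h.tensor x u v)) w) := by
      rw [nabla2_sub _ _ _ ha hc, nabla2_comp_left _ _ _ hd hh, nabla2_comp_out _ _ _ hb hJ,
        nabla2_comp_left _ _ _ hd hJh, nabla1_comp _ _ hJ hh, H.kaehler.parallel,
        H.kaehler.parallel, add_zero, zero_add]
      rfl
    rw [H.ksBracket_eq, nabla2_smul _ _ _ _ (hβ.flip.sub hβ), nabla2_sub _ _ _ hβ.flip hβ, h2 u v w,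
      nabla2_flip u v w (α := fun y X Y => nabla1 h.tensor y (h.tensor y X) Y
        - J.tensor y (nabla1 h.tensor y (comp J.tensor h.tensor y X) Y)), h2 u w v]
  simp only [div2, h1, ← Finset.smul_sum]
  rw [smul_neg, neg_smul, neg_neg, smul_smul, mul_one_div_cancel two_ne_zero, one_smul,
    PointData.ks]
  refine Finset.sum_congr rfl fun i _ => ?_
  simp only [(H.tens1_J x).add_apply]
  change _ = nabla2 (nabla1 h.tensor) x _ _ _ + nabla1 h.tensor x _ _
    - J.tensor x (nabla2 (nabla1 h.tensor) x _ _ _) - J.tensor x (nabla1 h.tensor x _ _)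
    - (nabla2 (nabla1 h.tensor) x _ _ _ + nabla1 h.tensor x _ _)
    + J.tensor x (nabla2 (nabla1 h.tensor) x _ _ _) + J.tensor x (nabla1 h.tensor x _ _)
  abel

variable [MeasurableSpace M] [BorelSpace M] [T2Space M] [CompactSpace M]

theorem secondOrderTerm_eq {v : EndField n M} (hv : IsV h h v) (y : TangentSpace (𝓡 n) x) :
    secondOrderTerm E h v x y = -(2 : ℝ) • div2 (ksBracket J h.tensor) x y
      - (1 / 2 : ℝ) • antiInvPart J (deltaStar (grad (trace (comp h.tensor h.tensor)))) x y := by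
  refine ext_inner_right ℝ fun z => ?_
  have h1 : (inner ℝ (v.tensor x y) z : ℝ) =
      ((H.pointData x).v y z + (H.pointData x).v z y) / 2 := by
    rw [hv.tensor_eq H.sym, inner_symPart (tens1_preV H.tens1 x), H.inner_preV, H.inner_preV]
  have h2 := (H.pointData x).main y z
  rw [secondOrderTerm, inner_sub_left, H.div2_ksBracket, real_inner_smul_left, H.inner_antiInvPart,
    inner_add_left, inner_sub_left, real_inner_smul_left, real_inner_smul_left,
    H.inner_perturbedEinsteinOp]
  change _ - inner ℝ (v.tensor x y) z + _ = _
  rw [h1]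
  exact h2

/-- The right-hand side of the identity anticommutes with $J$: every summand of `PointData.ks` does
in its argument $y$, and $\mathrm{Hess}(y,z)-\mathrm{Hess}(Jy,Jz)$ changes sign under
$(y,z)\mapsto(Jy,Jz)$. -/
theorem invPart_secondOrderTerm {v : EndField n M} (hv : IsV h h v) (y : TangentSpace (𝓡 n) x) :
    invPart J (secondOrderTerm E h v) x y = 0 := by
  let D := H.pointData x
  have h1 (y) : D.ks (D.J y) = -D.J (D.ks y) := by
    simp only [PointData.ks, map_sum, ← Finset.sum_neg_distrib]
    refine Finset.sum_congr rfl fun i _ => ?_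
    simp only [D.h_J, D.dh_J, D.ddh_J, D.J_sq, map_neg, map_add, map_sub, LinearMap.neg_apply, neg_neg]
    abel
  have h2 (y z) : D.hess (D.J (D.J y)) z = -D.hess y z := by
    simp [PointData.hess, PointData.U, D.J_sq]
    ring
  refine ext_inner_right ℝ fun z => ?_
  rw [invPart, H.secondOrderTerm_eq hv, H.secondOrderTerm_eq hv, H.div2_ksBracket, H.div2_ksBracket]
  have h3 : ∀ u z : TangentSpace (𝓡 n) x, (inner ℝ (J x u) z : ℝ) = -inner ℝ u (J x z) :=
    (H.pointData x).J_inner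
  rw [inner_zero_left, real_inner_smul_left, inner_sub_left, h3, inner_sub_left, inner_sub_left,
    real_inner_smul_left, real_inner_smul_left, H.inner_antiInvPart, H.inner_antiInvPart]
  change 1 / 2 * (inner ℝ (D.ks y) z - 1 / 2 * (D.hess y z - D.hess (D.J y) (D.J z))
    - -(inner ℝ (D.ks (D.J y)) (D.J z)
      - 1 / 2 * (D.hess (D.J y) (D.J z) - D.hess (D.J (D.J y)) (D.J (D.J z))))) = 0
  rw [h1, h2, D.J_sq z, inner_neg_left, D.J_inner_J]
  have h4 : D.hess y (-z) = -D.hess y z := by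
    simp [PointData.hess, PointData.U]
    ring
  rw [h4]
  ring

end IsDeformation

end main_identity

end KEDeform

end

theorem mainTheorem4 (n : ℕ) (M : Type*) [TopologicalSpace M] [T2Space M] [CompactSpace M]
    [ChartedSpace (EuclideanSpace ℝ (Fin n)) M] [IsManifold (𝓡 n) ∞ M]
    [MeasurableSpace M] [BorelSpace M]
    [Bundle.RiemannianBundle (fun x : M => TangentSpace (𝓡 n) x)]
    [IsContMDiffRiemannianBundle (𝓡 n) ∞ (EuclideanSpace ℝ (Fin n))
      (fun x : M => TangentSpace (𝓡 n) x)]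
    (J : KEDeform.EndField n M) (hJ : KEDeform.IsKaehler J)
    (E : ℝ) (hE : E < 0) (hEin : KEDeform.IsEinstein n M E)
    (h : KEDeform.EndField n M) (h_sym : KEDeform.IsSymTensor h)
    (h_anti : ∀ (x : M) (X : TangentSpace (𝓡 n) x), h x (J x X) = -J x (h x X))
    (h_dbar : ∀ (x : M) (X Y : TangentSpace (𝓡 n) x), KEDeform.dbar J h.tensor x X Y = 0)
    (h_div : ∀ x : M, KEDeform.div1 h.tensor x = 0) :
    (∃! v : KEDeform.EndField n M, KEDeform.IsV h h v) ∧
    ∀ v : KEDeform.EndField n M, KEDeform.IsV h h v →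
      (∀ (x : M) (X : TangentSpace (𝓡 n) x),
        KEDeform.secondOrderTerm E h v x X =
          -(2 : ℝ) • KEDeform.div2 (KEDeform.ksBracket J h.tensor) x X
          - (1 / 2 : ℝ) • KEDeform.antiInvPart J (KEDeform.deltaStar
              (KEDeform.grad (KEDeform.trace (KEDeform.comp h.tensor h.tensor)))) x X) ∧
      (∀ (x : M) (X : TangentSpace (𝓡 n) x),
        KEDeform.invPart J (KEDeform.secondOrderTerm E h v) x X = 0) := by
  have H : KEDeform.IsDeformation E J h := ⟨hJ, hEin, h_sym, h_anti, h_dbar, h_div⟩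
  exact ⟨KEDeform.existsUnique_isV h_sym, fun v hv =>
    ⟨fun x X => H.secondOrderTerm_eq hv X, fun x X => H.invPart_secondOrderTerm hv X⟩⟩
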